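/- **Setting.** Let $\ell_1,\ell_2>0$ and put $\ell=\sqrt{\ell_1\ell_2}$, $\theta=\ell_2/\ell_1$, $L=\max(\ell_1,\ell_2)$. Consider the rectangular lattice graph in the plane with vertices $(n\ell_1,m\ell_2)$, $n,m\in\mathbb Z$, whose edges are the horizontal segments of length $\ell_1$ and the vertical segments of length $\ell_2$ joining neighbouring vertices. For $c\in\mathbb R$ let $H_c$ be the operator $f\mapsto -f''$ on the $L^2$ space of the graph (the direct sum of the spaces $L^2$ of the edges), whose domain consists of all $f\in L^2$ with components in $H^{2}$ on every edge and $f''\in L^2$ that are continuous at every vertex and satisfy there $\sum_j f_j'=c f$, where the sum runs over the outward derivatives along the four edges at the vertex. Let $\sigma(c)=\sigma(\ell,\theta,c)$ be its spectrum. The Kronig–Penney model with coupling constant $c$ and spacing $\lambda$ is the operator $-d^2/dx^2$ on $L^2(\mathbb R)$ with continuous functions satisfying $f'(n\lambda+)-f'(n\lambda-)=c f(n\lambda)$ for all $n\in\mathbb Z$. A gap of a spectrum is a connected component of its complement in $\mathbb R$ (the component below the bottom of the spectrum included); for the lattice, a gap is above the threshold if it lies above the bottom $\alpha_1$ of the spectrum.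 **Statement.** For every $c\in\mathbb R$: (a) $\sigma(c)=\bigcup_{r=1}^N[\alpha_r,\beta_r]$ for some $1\le N\le\infty$, with real $\alpha_r$ and $\alpha_r<\beta_r<\alpha_{r+1}$ (where $\beta_N=\infty$ is allowed if $N<\infty$, the last band then being $[\alpha_N,\infty)$). (b) $\sigma(0)=[0,\infty)$. (c) If $c>0$, each finite $\beta_r$ equals $(\pi n/\lambda)^2$ for some $n\in\mathbb Z$ and $\lambda\in\{\ell_1,\ell_2\}$. If $c<0$, each $\alpha_r$ with $r\ge2$ equals $(\pi m/\lambda)^2$ for some $m\in\mathbb Z$ and $\lambda\in\{\ell_1,\ell_2\}$. (d) $\alpha_1>0$ iff $c>0$, and $\alpha_1<0$ iff $c<0$. (e) If $c<-4\ell^{-1}(\theta^{1/2}+\theta^{-1/2})$, then $N\ge 2$, $\beta_1<0$ and $\alpha_2=(\pi/L)^2$. (f) If $c'\in\mathbb R$ satisfies $|c'|>|c|$ and $cc'\ge0$, then $\sigma(c')\cap[0,\infty)\subset\sigma(c)\cap[0,\infty)$. (g) Each gap of $\sigma(c)$ (for $c<0$: each gap above the threshold) is contained in the intersection of a gap of the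 Kronig–Penney model with coupling constant $c$ and spacing $\ell_1$ and a gap of the Kronig–Penney model with coupling constant $c$ and spacing $\ell_2$. (h) All gaps above the threshold are bounded. If there are infinitely many of them ($N=\infty$), there is a constant $C$, which may depend on $\ell_1,\ell_2,c$, such that for all $r\ge1$ $$\alpha_{r+1}-\beta_r<\frac{2|c|}{\ell_1+\ell_2}+\frac{C}{r}.$$ -/

import Mathlib

open MeasureTheory

noncomputable section

/-- A (possibly infinite, locally finite) oriented metric graph with vertices `V` and edges `E`.
The edge `e` is identified with the interval `[0, len e]`, with `0` placed at the vertex `src e` and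
`len e` at the vertex `tgt e`.  The finite sets `out v` and `inc v` consist of the edges that start,
respectively end, at `v`. -/
structure MetricGraph (V E : Type) where
  src : E → V
  tgt : E → V
  len : E → ℝ
  len_pos : ∀ e, 0 < len e
  out : V → Finset E
  inc : V → Finset E
  mem_out : ∀ v e, e ∈ out v ↔ src e = v
  mem_inc : ∀ v e, e ∈ inc v ↔ tgt e = v

namespace MetricGraph

variable {V E : Type}

/-- `L²(0, len e)`. -/
abbrev EdgeL2 (G : MetricGraph V E) (e : E) : Type :=
  Lp ℂ 2 (volume.restrict (Set.Ioc 0 (G.len e)))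

/-- The state space `L²(G) = ⨁ₑ L²(0, len e)` (Hilbert space direct sum). -/
abbrev L2 (G : MetricGraph V E) : Type := lp (fun e : E => G.EdgeL2 e) 2

/-- `G.EdgeRep f h u u'`: on every edge `e` the function `u e` is a continuously differentiable
representative of `f e` with derivative `u' e`, and `u' e` is absolutely continuous with
`(u' e)' = - h e` almost everywhere.  Thus `f e` belongs to the Sobolev space `H²(0, len e)`, its
second weak derivative is `- h e`, and `u e`, `u' e` give its boundary values. -/
def EdgeRep (G : MetricGraph V E) (f h : G.L2) (u u' : E → ℝ → ℂ) : Prop :=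
  ∀ e, (f e : ℝ → ℂ) =ᵐ[volume.restrict (Set.Ioc 0 (G.len e))] u e ∧
    (∀ x ∈ Set.Icc 0 (G.len e), HasDerivWithinAt (u e) (u' e x) (Set.Icc 0 (G.len e)) x) ∧
    (∀ x ∈ Set.Icc 0 (G.len e), u' e x = u' e 0 - ∫ t in (0 : ℝ)..x, (h e : ℝ → ℂ) t)

/-- The `δ` coupling with constant `c` at every vertex: the function is continuous at each vertex,
and the sum of its outward derivatives over all the edge ends at the vertex is `c` times its value
there. -/
def DeltaCoupling (G : MetricGraph V E) (c : ℝ) (u u' : E → ℝ → ℂ) : Prop :=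
  ∃ F : V → ℂ,
    (∀ e, u e 0 = F (G.src e) ∧ u e (G.len e) = F (G.tgt e)) ∧
    (∀ v, (∑ e ∈ G.out v, u' e 0) - (∑ e ∈ G.inc v, u' e (G.len e)) = (c : ℂ) * F v)

theorem integral_edge_congr (G : MetricGraph V E) (e : E) {p q : ℝ → ℂ}
    (h : p =ᵐ[volume.restrict (Set.Ioc 0 (G.len e))] q) {x : ℝ}
    (hx : x ∈ Set.Icc 0 (G.len e)) :
    ∫ t in (0 : ℝ)..x, p t = ∫ t in (0 : ℝ)..x, q t := by
  rw [intervalIntegral.integral_of_le hx.1, intervalIntegral.integral_of_le hx.1]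
  exact integral_congr_ae (ae_mono (Measure.restrict_mono (Set.Ioc_subset_Ioc_right hx.2) le_rfl) h)

theorem edge_intervalIntegrable (G : MetricGraph V E) (e : E) (h : G.EdgeL2 e) {x : ℝ}
    (hx : x ∈ Set.Icc 0 (G.len e)) :
    IntervalIntegrable (h : ℝ → ℂ) volume 0 x := by
  rw [intervalIntegrable_iff_integrableOn_Ioc_of_le hx.1]
  have h1 : Integrable (h : ℝ → ℂ) (volume.restrict (Set.Ioc 0 (G.len e))) :=
    (Lp.memLp h).integrable one_le_two
  exact IntegrableOn.mono_set h1 (Set.Ioc_subset_Ioc_right hx.2)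

/-- The graph of the Hamiltonian with `δ` couplings: all pairs `(f, - f'')` such that `f` and `f''`
are in `L²(G)`, each component of `f` is in `H²`, and `f` satisfies the `δ` coupling conditions. -/
def deltaHamiltonianGraph (G : MetricGraph V E) (c : ℝ) : Submodule ℂ (G.L2 × G.L2) where
  carrier := {p | ∃ u u' : E → ℝ → ℂ, G.EdgeRep p.1 p.2 u u' ∧ G.DeltaCoupling c u u'}
  zero_mem' := by
    refine ⟨fun _ _ => 0, fun _ _ => 0, fun e => ⟨?_, fun x _ => hasDerivWithinAt_const _ _ _,
      fun x hx => ?_⟩, fun _ => 0, by simp, by simp⟩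
    · exact Lp.coeFn_zero _ _ _
    · have i := integral_edge_congr G e (Lp.coeFn_zero ℂ 2 _) hx
      change (0 : ℂ) = 0 - ∫ t in (0 : ℝ)..x, (↑↑(0 : G.EdgeL2 e) : ℝ → ℂ) t
      rw [i]
      simp
  add_mem' := by
    rintro ⟨f₁, h₁⟩ ⟨f₂, h₂⟩ ⟨u₁, v₁, r₁, F₁, a₁, b₁⟩ ⟨u₂, v₂, r₂, F₂, a₂, b₂⟩
    refine ⟨fun e x => u₁ e x + u₂ e x, fun e x => v₁ e x + v₂ e x, fun e => ⟨?_, fun x hx => ?_,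
      fun x hx => ?_⟩, fun v => F₁ v + F₂ v, fun e => ?_, fun v => ?_⟩
    · exact (Lp.coeFn_add (f₁ e) (f₂ e)).trans ((r₁ e).1.add (r₂ e).1)
    · exact ((r₁ e).2.1 x hx).add ((r₂ e).2.1 x hx)
    · have i := integral_edge_congr G e (Lp.coeFn_add (h₁ e) (h₂ e)) hx
      change _ = _ - ∫ t in (0 : ℝ)..x, (↑↑(h₁ e + h₂ e) : ℝ → ℂ) t
      rw [i]
      simp only [Pi.add_apply]
      rw [intervalIntegral.integral_add (edge_intervalIntegrable G e (h₁ e) hx)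
        (edge_intervalIntegrable G e (h₂ e) hx), (r₁ e).2.2 x hx, (r₂ e).2.2 x hx]
      ring
    · exact ⟨by simp only [(a₁ e).1, (a₂ e).1], by simp only [(a₁ e).2, (a₂ e).2]⟩
    · rw [Finset.sum_add_distrib, Finset.sum_add_distrib]
      linear_combination b₁ v + b₂ v
  smul_mem' := by
    rintro k ⟨f, h⟩ ⟨u, v, r, F, a, b⟩
    refine ⟨fun e x => k * u e x, fun e x => k * v e x, fun e => ⟨?_, fun x hx => ?_,
      fun x hx => ?_⟩, fun v => k * F v, fun e => ?_, fun w => ?_⟩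
    · refine (Lp.coeFn_smul k (f e)).trans ?_
      filter_upwards [(r e).1] with x hx
      simp [hx]
    · exact ((r e).2.1 x hx).const_mul k
    · have i := integral_edge_congr G e (Lp.coeFn_smul k (h e)) hx
      change _ = _ - ∫ t in (0 : ℝ)..x, (↑↑(k • h e) : ℝ → ℂ) t
      rw [i]
      simp only [Pi.smul_apply, smul_eq_mul]
      rw [intervalIntegral.integral_const_mul, (r e).2.2 x hx]
      ring
    · exact ⟨by simp only [(a e).1], by simp only [(a e).2]⟩
    · rw [← Finset.mul_sum, ← Finset.mul_sum]
      linear_combination k * b w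

/-- The Hamiltonian `f ↦ - f''` on `L²(G)` with the `δ` coupling of constant `c` at every vertex. -/
def deltaHamiltonian (G : MetricGraph V E) (c : ℝ) : G.L2 →ₗ.[ℂ] G.L2 :=
  (G.deltaHamiltonianGraph c).toLinearPMap

/-- The second derivative is determined by the function, so that the Hamiltonian is well defined. -/
theorem deltaHamiltonian_graph (G : MetricGraph V E) (c : ℝ) :
    (G.deltaHamiltonian c).graph = G.deltaHamiltonianGraph c := by
  refine Submodule.toLinearPMap_graph_eq _ ?_
  rintro ⟨f, h⟩ ⟨u, v, r, -⟩ rfl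
  refine lp.ext (funext fun e => ?_)
  obtain ⟨r1, r2, r3⟩ := r e
  have hl := G.len_pos e
  have hcont : ContinuousOn (u e) (Set.Icc 0 (G.len e)) := fun x hx =>
    (r2 x hx).continuousWithinAt
  have hu0 : Set.EqOn (u e) (fun _ => 0) (Set.Icc 0 (G.len e)) := by
    refine Measure.eqOn_Icc_of_ae_eq volume hl.ne ?_ hcont continuousOn_const
    rw [← restrict_Ioc_eq_restrict_Icc]
    refine r1.symm.trans (Lp.coeFn_zero ℂ 2 _)
  have hv0 : ∀ x ∈ Set.Icc 0 (G.len e), v e x = 0 := fun x hx =>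
    (uniqueDiffOn_Icc hl x hx).eq_deriv _ (r2 x hx)
      ((hasDerivWithinAt_const x _ (0 : ℂ)).congr hu0 (hu0 hx))
  have hint : ∀ x ∈ Set.Icc 0 (G.len e), ∫ t in (0 : ℝ)..x, (h e : ℝ → ℂ) t = 0 := by
    intro x hx
    have := r3 x hx
    rw [hv0 x hx, hv0 0 ⟨le_rfl, hl.le⟩] at this
    simpa using this.symm
  have hii := edge_intervalIntegrable G e (h e) (x := G.len e) ⟨hl.le, le_rfl⟩
  refine (Lp.eq_zero_iff_ae_eq_zero).2 ?_
  have key : (h e : ℝ → ℂ) =ᵐ[volume.restrict (Set.Ioo 0 (G.len e))] 0 := ?_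
  · rw [restrict_Ioo_eq_restrict_Ioc] at key
    exact key
  refine (ae_restrict_iff' measurableSet_Ioo).2 ?_
  filter_upwards [hii.ae_hasDerivAt_integral] with x hx hx'
  have hx2 := hx (by rw [Set.uIcc_of_le hl.le]; exact Set.Ioo_subset_Icc_self hx')
    0 (by simp)
  refine hx2.unique ((hasDerivAt_const x (0 : ℂ)).congr_of_eventuallyEq ?_)
  filter_upwards [Ioo_mem_nhds hx'.1 hx'.2] with y hy
  exact hint y (Set.Ioo_subset_Icc_self hy)

end MetricGraph

/-- The spectrum of an unbounded operator `T`: all `z` for which `T - z` has no bounded everywhere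
defined inverse. -/
def unboundedSpectrum {H : Type*} [NormedAddCommGroup H] [NormedSpace ℂ H] (T : H →ₗ.[ℂ] H) :
    Set ℂ :=
  {z | ¬ ∃ R : H →L[ℂ] H,
    (∀ g, ∃ hg : R g ∈ T.domain, T ⟨R g, hg⟩ - z • R g = g) ∧
    (∀ f : T.domain, R (T f - z • (f : H)) = f)}

/-- The rectangular lattice graph with spacings `ℓ₁` and `ℓ₂`: vertices `(n, m) ∈ ℤ²`; the edge
`inl (n, m)`, of length `ℓ₁`, joins `(n, m)` to `(n + 1, m)`, and the edge `inr (n, m)`, of length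
`ℓ₂`, joins `(n, m)` to `(n, m + 1)`. -/
def rectangularLattice (ℓ₁ ℓ₂ : ℝ) (h₁ : 0 < ℓ₁) (h₂ : 0 < ℓ₂) :
    MetricGraph (ℤ × ℤ) ((ℤ × ℤ) ⊕ (ℤ × ℤ)) where
  src := Sum.elim id id
  tgt := Sum.elim (fun p => (p.1 + 1, p.2)) (fun p => (p.1, p.2 + 1))
  len := Sum.elim (fun _ => ℓ₁) (fun _ => ℓ₂)
  len_pos := by rintro (_ | _) <;> simpa
  out := fun v => {Sum.inl v, Sum.inr v}
  inc := fun v => {Sum.inl (v.1 - 1, v.2), Sum.inr (v.1, v.2 - 1)}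
  mem_out := by rintro v (e | e) <;> simp
  mem_inc := by
    rintro ⟨a, b⟩ (⟨n, m⟩ | ⟨n, m⟩) <;> simp <;> omega

/-- The line as a chain of edges of length `ℓ` that join consecutive integers. -/
def chain (ℓ : ℝ) (h : 0 < ℓ) : MetricGraph ℤ ℤ where
  src := id
  tgt := fun n => n + 1
  len := fun _ => ℓ
  len_pos := fun _ => h
  out := fun v => {v}
  inc := fun v => {v - 1}
  mem_out := by simp
  mem_inc := by intro v e; simp; omega

/-- The spectrum of the `δ` lattice Hamiltonian with spacings `ℓ₁`, `ℓ₂` and coupling constant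
`c`. -/
def latticeSpectrum (ℓ₁ ℓ₂ : ℝ) (h₁ : 0 < ℓ₁) (h₂ : 0 < ℓ₂) (c : ℝ) : Set ℂ :=
  unboundedSpectrum ((rectangularLattice ℓ₁ ℓ₂ h₁ h₂).deltaHamiltonian c)

/-- The spectrum of the Kronig-Penney model with spacing `ℓ` and coupling constant `c`: the operator
`- d²/dx²` on the line with `f' (n ℓ +) - f' (n ℓ -) = c f (n ℓ)` for all integers `n`. -/
def kronigPenneySpectrum (ℓ : ℝ) (h : 0 < ℓ) (c : ℝ) : Set ℂ :=
  unboundedSpectrum ((chain ℓ h).deltaHamiltonian c)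

/-- A gap of a spectrum `S`: a connected component of the set of real numbers outside `S`.  The
component below the bottom of `S`, if there is one, counts as a gap in this sense. -/
def IsGap (S : Set ℂ) (J : Set ℝ) : Prop :=
  ∃ x : ℝ, (x : ℂ) ∉ S ∧ J = connectedComponentIn {y : ℝ | (y : ℂ) ∉ S} x

/-- `S` is the union of the `N` bands `[α r, β r]`, `1 ≤ r ≤ N`, with
`α r < β r < α (r + 1)`; here `1 ≤ N ≤ ∞`, and `β r = ∞` is allowed, the band then being the half
line `[α r, ∞)`. -/
structure IsBandDecomposition (S : Set ℂ) (N : ℕ∞) (α : ℕ → ℝ) (β : ℕ → EReal) : Prop where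
  one_le : 1 ≤ N
  eq_union : S = Complex.ofReal ''
    {x : ℝ | ∃ r : ℕ, 1 ≤ r ∧ (r : ℕ∞) ≤ N ∧ (α r : EReal) ≤ x ∧ (x : EReal) ≤ β r}
  band_lt : ∀ r : ℕ, 1 ≤ r → (r : ℕ∞) ≤ N → (α r : EReal) < β r
  gap_lt : ∀ r : ℕ, 1 ≤ r → ((r + 1 : ℕ) : ℕ∞) ≤ N → β r < (α (r + 1) : EReal)

end

/-! Let φ, ψ be the fundamental solutions of -y'' = z y. If ψ does not vanish at the length l of an
edge, then -u'' - z u = g is solvable there for all boundary values, and the outward derivative of u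
at an end is (value at the other end - φ l * value at this end) / ψ l plus a bounded functional of
g. The δ conditions thus become one equation on ℓ² of the vertices. If its operator is invertible, z
is in the resolvent set (`IsUniform.notMem_spectrum`); if z is in the resolvent set, the operator is
bounded below (`IsUniform.exists_lower_bound`). On the lattice it is a combination of shifts with
symbol 2 (t₁ - φ ℓ₁) / ψ ℓ₁ + 2 (t₂ - φ ℓ₂) / ψ ℓ₂ - c for t₁, t₂ in [-1, 1]. Without zeros of the
symbol the quadratic form is coercive; at a zero, plane waves cut off to large boxes are approximate
eigenvectors.

For nonreal z the imaginary parts of both terms have the sign of Im z (`symbol_im_pos`), so the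
spectrum is real. For z = k² the criterion reads -2k (cot y₁ + cot y₂) ≤ c ≤ 2k (tan y₁ + tan y₂),
where y₁, y₂ in (0, π/2) are the halves of k ℓ₁, k ℓ₂ modulo π. In a cell between consecutive zeros
of sin (k ℓ₁) sin (k ℓ₂), the tangent bound increases and blows up at the right end; the cotangent
bound decreases and, except in the first cell, blows up at the left end. Hence for c ≥ 0 the
spectrum fills a right part of each cell, and for c < 0 a left part. Below zero tanh and coth take
over; for c < 0 the lowest band starts there. The zeros themselves, where the reduction breaks down,
belong to the spectrum because it is closed. This yields a sequence of intervals (`exists_bands`),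
and merging those that touch gives the bands.

At each energy E ≥ 0 the admissible couplings form an interval containing 0, which is the reason for
(b) and (f). The lattice bounds are sums of two positive Kronig-Penney bounds, so a coupling beyond
the sum is beyond both summands, which is (g). The inequalities tan y ≥ y and cot y ≥ π/2 - y
control the lengths of the gaps in (h). -/

/-! ### Square-summable families -/

/-- The family `x` has square sum at most `K ^ 2`, tested on finite sets. -/
def SqBdd {ι : Type*} (x : ι → ℝ) (K : ℝ) : Prop :=
  0 ≤ K ∧ ∀ s : Finset ι, ∑ i ∈ s, x i ^ 2 ≤ K ^ 2

namespace SqBdd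

variable {ι κ : Type*} {x y : ι → ℝ} {K K' : ℝ}

theorem mono (h : SqBdd y K) (hxy : ∀ i, |x i| ≤ y i) : SqBdd x K :=
  ⟨h.1, fun s => (Finset.sum_le_sum fun i _ => sq_le_sq' (abs_le.1 (hxy i)).1
    (abs_le.1 (hxy i)).2).trans (h.2 s)⟩

theorem add (h : SqBdd x K) (h' : SqBdd y K') : SqBdd (fun i => x i + y i) (K + K') := by
  refine ⟨add_nonneg h.1 h'.1, fun s => ?_⟩
  have h1 := h.2 s
  have h2 := h'.2 s
  have h3 : ∑ i ∈ s, x i * y i ≤ K * K' := by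
    refine abs_le_of_sq_le_sq' ?_ (mul_nonneg h.1 h'.1) |>.2
    calc (∑ i ∈ s, x i * y i) ^ 2 ≤ (∑ i ∈ s, x i ^ 2) * ∑ i ∈ s, y i ^ 2 :=
          Finset.sum_mul_sq_le_sq_mul_sq s x y
      _ ≤ K ^ 2 * K' ^ 2 := by
          refine mul_le_mul h1 h2 (Finset.sum_nonneg fun i _ => sq_nonneg _) (sq_nonneg _)
      _ = (K * K') ^ 2 := by ring
  have h4 : ∑ i ∈ s, (x i + y i) ^ 2
      = ∑ i ∈ s, x i ^ 2 + 2 * ∑ i ∈ s, x i * y i + ∑ i ∈ s, y i ^ 2 := by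
    rw [Finset.mul_sum, ← Finset.sum_add_distrib, ← Finset.sum_add_distrib]
    exact Finset.sum_congr rfl fun i _ => by ring
  rw [h4]
  nlinarith

theorem const_mul (h : SqBdd x K) {a : ℝ} (ha : 0 ≤ a) : SqBdd (fun i => a * x i) (a * K) := by
  refine ⟨mul_nonneg ha h.1, fun s => ?_⟩
  simp only [mul_pow]
  rw [← Finset.mul_sum]
  exact mul_le_mul_of_nonneg_left (h.2 s) (sq_nonneg a)

theorem weaken (h : SqBdd x K) (hK : K ≤ K') : SqBdd x K' :=
  ⟨h.1.trans hK, fun s => (h.2 s).trans (pow_le_pow_left₀ h.1 hK 2)⟩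

/-- Each value is repeated at most d times, so the square sum grows at most by the factor d; the
cruder d² avoids square roots. -/
theorem comp_fiber {x : κ → ℝ} (h : SqBdd x K) (σ : ι → κ) (N : κ → Finset ι) (d : ℕ)
    (hN : ∀ i, i ∈ N (σ i)) (hd : ∀ j, (N j).card ≤ d) :
    SqBdd (fun i => x (σ i)) (d * K) := by
  classical
  refine ⟨mul_nonneg d.cast_nonneg h.1, fun s => ?_⟩
  calc ∑ i ∈ s, x (σ i) ^ 2
      = ∑ j ∈ s.image σ, ∑ i ∈ s with σ i = j, x (σ i) ^ 2 :=
        (Finset.sum_fiberwise_of_maps_to (fun i hi => Finset.mem_image_of_mem σ hi) _).symm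
    _ ≤ ∑ j ∈ s.image σ, d * x j ^ 2 := by
        refine Finset.sum_le_sum fun j _ => ?_
        have : ∑ i ∈ s with σ i = j, x (σ i) ^ 2 = ∑ i ∈ s with σ i = j, x j ^ 2 :=
          Finset.sum_congr rfl fun i hi => by rw [(Finset.mem_filter.1 hi).2]
        rw [this, Finset.sum_const, nsmul_eq_mul]
        refine mul_le_mul_of_nonneg_right ?_ (sq_nonneg _)
        refine Nat.cast_le.2 (le_trans (Finset.card_le_card fun i hi => ?_) (hd j))
        rw [← (Finset.mem_filter.1 hi).2]
        exact hN i
    _ = d * ∑ j ∈ s.image σ, x j ^ 2 := (Finset.mul_sum _ _ _).symm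
    _ ≤ d * K ^ 2 := mul_le_mul_of_nonneg_left (h.2 _) d.cast_nonneg
    _ ≤ (d * K) ^ 2 := by
        rw [mul_pow]
        refine mul_le_mul_of_nonneg_right ?_ (sq_nonneg _)
        exact_mod_cast Nat.le_self_pow two_ne_zero d

/-- Cauchy-Schwarz on each N j; these sets lie in different fibres of σ and hence are disjoint. -/
theorem sum_fiber (h : SqBdd x K) (σ : ι → κ) (N : κ → Finset ι) (d : ℕ)
    (hN : ∀ j, ∀ i ∈ N j, σ i = j) (hd : ∀ j, (N j).card ≤ d) :
    SqBdd (fun j => ∑ i ∈ N j, x i) (d * K) := by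
  classical
  refine ⟨mul_nonneg d.cast_nonneg h.1, fun s => ?_⟩
  calc ∑ j ∈ s, (∑ i ∈ N j, x i) ^ 2 ≤ ∑ j ∈ s, d * ∑ i ∈ N j, x i ^ 2 := by
        refine Finset.sum_le_sum fun j _ => sq_sum_le_card_mul_sum_sq.trans ?_
        exact mul_le_mul_of_nonneg_right (Nat.cast_le.2 (hd j))
          (Finset.sum_nonneg fun i _ => sq_nonneg _)
    _ = d * ∑ i ∈ s.biUnion N, x i ^ 2 := by
        rw [← Finset.mul_sum, Finset.sum_biUnion]
        intro j _ j' _ hjj'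
        refine Finset.disjoint_left.2 fun i hi hi' => hjj' ?_
        rw [← hN j i hi, hN j' i hi']
    _ ≤ d * K ^ 2 := mul_le_mul_of_nonneg_left (h.2 _) d.cast_nonneg
    _ ≤ (d * K) ^ 2 := by
        rw [mul_pow]
        refine mul_le_mul_of_nonneg_right ?_ (sq_nonneg _)
        exact_mod_cast Nat.le_self_pow two_ne_zero d

theorem comp_injective {x : κ → ℝ} (h : SqBdd x K) (σ : ι → κ) (hσ : Function.Injective σ) :
    SqBdd (fun i => x (σ i)) K := by
  classical
  refine ⟨h.1, fun s => ?_⟩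
  have := h.2 (s.image σ)
  rwa [Finset.sum_image fun a _ b _ hab => hσ hab] at this

theorem prod {y : κ → ℝ} (h : SqBdd x K) (h' : SqBdd y K') :
    SqBdd (fun p : ι × κ => x p.1 * y p.2) (K * K') := by
  classical
  refine ⟨mul_nonneg h.1 h'.1, fun s => ?_⟩
  calc ∑ p ∈ s, (x p.1 * y p.2) ^ 2
      ≤ ∑ p ∈ s.image Prod.fst ×ˢ s.image Prod.snd, (x p.1 * y p.2) ^ 2 :=
        Finset.sum_le_sum_of_subset_of_nonneg Finset.subset_product fun _ _ _ => sq_nonneg _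
    _ = (∑ i ∈ s.image Prod.fst, x i ^ 2) * ∑ j ∈ s.image Prod.snd, y j ^ 2 := by
        simp only [mul_pow]
        rw [Finset.sum_product, Finset.sum_mul_sum]
    _ ≤ K ^ 2 * K' ^ 2 :=
        mul_le_mul (h.2 _) (h'.2 _) (Finset.sum_nonneg fun _ _ => sq_nonneg _) (sq_nonneg _)
    _ = (K * K') ^ 2 := by ring

theorem of_lp {E : ι → Type*} [∀ i, NormedAddCommGroup (E i)] (f : lp E 2) :
    SqBdd (fun i => ‖f i‖) ‖f‖ := by
  refine ⟨norm_nonneg _, fun s => ?_⟩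
  have := lp.sum_rpow_le_norm_rpow (p := 2) (by norm_num) f s
  simpa using this

theorem exists_lp {E : ι → Type*} [∀ i, NormedAddCommGroup (E i)] {f : ∀ i, E i}
    (h : SqBdd (fun i => ‖f i‖) K) : ∃ F : lp E 2, (∀ i, F i = f i) ∧ ‖F‖ ≤ K := by
  have hm : Memℓp f 2 := memℓp_gen' (C := K ^ 2) fun s => by simpa using h.2 s
  refine ⟨⟨f, hm⟩, fun i => rfl, lp.norm_le_of_forall_sum_le (p := 2) (by norm_num) h.1 fun s => ?_⟩
  simpa using h.2 s

end SqBdd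

/-! ### Resolvent criteria for unbounded operators -/

section Spectrum

variable {H : Type*} [NormedAddCommGroup H] [NormedSpace ℂ H] {T : H →ₗ.[ℂ] H} {z : ℂ}

/-- The a priori bound makes T - z injective and bounds the inverse that surjectivity provides; T
need not be known to be closed. Pairs in the graph are used because the domain of the Hamiltonian is
accessible only through them. -/
theorem notMem_unboundedSpectrum_of_graph
    (hs : ∀ g, ∃ f h, (f, h) ∈ T.graph ∧ h - z • f = g) (C : ℝ)
    (hb : ∀ f h, (f, h) ∈ T.graph → ‖f‖ ≤ C * ‖h - z • f‖) : z ∉ unboundedSpectrum T := by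
  let A : T.domain →ₗ[ℂ] H := T.toFun - z • T.domain.subtype
  have hA : ∀ f, A f = T f - z • (f : H) := fun f => rfl
  have hgr : ∀ f : T.domain, ((f : H), T f) ∈ T.graph := fun f => T.mem_graph f
  have hinj : Function.Injective A := by
    refine (injective_iff_map_eq_zero A).2 fun f hf => ?_
    have := hb _ _ (hgr f)
    rw [← hA, hf, norm_zero, mul_zero] at this
    exact Subtype.ext (norm_le_zero_iff.1 this)
  have hsurj : Function.Surjective A := by
    intro g
    obtain ⟨f, h, hfh, rfl⟩ := hs g
    obtain ⟨y, hy1, hy2⟩ := (LinearPMap.mem_graph_iff T).1 hfh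
    refine ⟨y, ?_⟩
    rw [hA, hy2, hy1]
  let e := LinearEquiv.ofBijective A ⟨hinj, hsurj⟩
  have he : ∀ g, A (e.symm g) = g := fun g => e.apply_symm_apply g
  let R : H →L[ℂ] H := (T.domain.subtype ∘ₗ (e.symm : H →ₗ[ℂ] T.domain)).mkContinuous C
    fun g => by
      have := hb _ _ (hgr (e.symm g))
      rw [← hA, he] at this
      exact this
  refine fun hz => hz ⟨R, fun g => ⟨(e.symm g).2, ?_⟩, fun f => ?_⟩
  · exact he g
  · change ((e.symm (A f) : T.domain) : H) = f
    exact congrArg _ (e.symm_apply_apply f)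

theorem exists_bound_of_notMem_unboundedSpectrum (hz : z ∉ unboundedSpectrum T) :
    ∃ C : ℝ, 0 ≤ C ∧ ∀ f h, (f, h) ∈ T.graph → ‖f‖ ≤ C * ‖h - z • f‖ := by
  obtain ⟨R, -, hR⟩ := not_not.1 hz
  refine ⟨‖R‖, norm_nonneg _, fun f h hfh => ?_⟩
  obtain ⟨y, hy1, hy2⟩ := (LinearPMap.mem_graph_iff T).1 hfh
  have := hR y
  rw [hy2] at this
  simp only at hy1 this
  rw [hy1] at this
  conv_lhs => rw [← this]
  exact R.le_opNorm _

/-- Neumann series: the resolvent at w near z is R (1 - (w - z) R)⁻¹. Closedness later puts the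
Dirichlet energies into the spectrum. -/
theorem isClosed_unboundedSpectrum [CompleteSpace H] : IsClosed (unboundedSpectrum T) := by
  rw [← isOpen_compl_iff, Metric.isOpen_iff]
  intro z hz
  obtain ⟨R, hR1, hR2⟩ := not_not.1 hz
  refine ⟨(‖R‖ + 1)⁻¹, by positivity, fun w hw => not_not.2 ?_⟩
  have hlt : ‖(w - z) • R‖ < 1 := by
    rw [norm_smul, ← dist_eq_norm]
    calc dist w z * ‖R‖ ≤ (‖R‖ + 1)⁻¹ * ‖R‖ := by gcongr; exact (Metric.mem_ball.1 hw).le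
      _ < 1 := by
        rw [inv_mul_lt_iff₀ (by positivity)]
        linarith
  let U := Units.oneSub ((w - z) • R) hlt
  have hU : ∀ g, (U⁻¹ : (H →L[ℂ] H)ˣ).1 g - (w - z) • R ((U⁻¹ : (H →L[ℂ] H)ˣ).1 g) = g := fun g => by
    have : (U.1 * (U⁻¹ : (H →L[ℂ] H)ˣ).1) g = g := by rw [Units.mul_inv]; rfl
    exact this
  have hU' : ∀ g, (U⁻¹ : (H →L[ℂ] H)ˣ).1 (g - (w - z) • R g) = g := fun g => by
    have : ((U⁻¹ : (H →L[ℂ] H)ˣ).1 * U.1) g = g := by rw [Units.inv_mul]; rfl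
    exact this
  refine ⟨R * (U⁻¹ : (H →L[ℂ] H)ˣ).1, fun g => ?_, fun f => ?_⟩
  · obtain ⟨hg, hg'⟩ := hR1 ((U⁻¹ : (H →L[ℂ] H)ˣ).1 g)
    refine ⟨hg, ?_⟩
    have h3 := hU g
    change T ⟨R ((U⁻¹ : (H →L[ℂ] H)ˣ).1 g), hg⟩ - w • R ((U⁻¹ : (H →L[ℂ] H)ˣ).1 g) = g
    rw [sub_eq_iff_eq_add] at hg' h3 ⊢
    rw [hg']
    nth_rewrite 1 [h3]
    module
  · have h3 := hR2 f
    have h4 := hU' (T f - z • (f : H))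
    rw [h3] at h4
    change R ((U⁻¹ : (H →L[ℂ] H)ˣ).1 (T f - w • (f : H))) = f
    have h5 : T f - w • (f : H) = T f - z • (f : H) - (w - z) • (f : H) := by module
    rw [h5, h4, h3]

end Spectrum

/-! ### The inhomogeneous equation on one edge -/

/-- `φ`, `ψ` are the solutions of `- y'' = z y` with `φ 0 = 1`, `φ' 0 = 0`, `ψ 0 = 0`, `ψ' 0 = 1`. -/
structure IsFund (z : ℂ) (φ ψ : ℝ → ℂ) : Prop where
  phi_zero : φ 0 = 1
  psi_zero : ψ 0 = 0
  hasDerivAt_psi : ∀ x, HasDerivAt ψ (φ x) x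
  hasDerivAt_phi : ∀ x, HasDerivAt φ (-z * ψ x) x

namespace IsFund

variable {z : ℂ} {φ ψ : ℝ → ℂ}

theorem continuous_phi (hF : IsFund z φ ψ) : Continuous φ :=
  continuous_iff_continuousAt.2 fun x => (hF.hasDerivAt_phi x).continuousAt

theorem continuous_psi (hF : IsFund z φ ψ) : Continuous ψ :=
  continuous_iff_continuousAt.2 fun x => (hF.hasDerivAt_psi x).continuousAt

/-- This is the Wronskian φ ψ' - φ' ψ, which is constant. -/
theorem phi_sq_add (hF : IsFund z φ ψ) (x : ℝ) : φ x * φ x + z * (ψ x * ψ x) = 1 := by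
  have hd : ∀ x, HasDerivAt (fun x => φ x * φ x + z * (ψ x * ψ x)) 0 x := fun x => by
    refine HasDerivAt.congr_deriv (((hF.hasDerivAt_phi x).mul (hF.hasDerivAt_phi x)).add
      (((hF.hasDerivAt_psi x).mul (hF.hasDerivAt_psi x)).const_mul z)) ?_
    ring
  have := is_const_of_deriv_eq_zero (fun x => (hd x).differentiableAt) (fun x => (hd x).deriv) x 0
  rw [this, hF.phi_zero, hF.psi_zero]
  ring

end IsFund

/-- The space `L²(0, ℓ)`. -/
abbrev SegL2 (ℓ : ℝ) : Type := Lp ℂ 2 (volume.restrict (Set.Ioc 0 ℓ))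

/-- `u`, with derivative `u'`, solves `- u'' - z u = g` on `[0, ℓ]` and represents `f`. -/
structure EdgeSol (z : ℂ) (ℓ : ℝ) (f g : SegL2 ℓ) (u u' : ℝ → ℂ) : Prop where
  ae : (f : ℝ → ℂ) =ᵐ[volume.restrict (Set.Ioc 0 ℓ)] u
  deriv : ∀ x ∈ Set.Icc 0 ℓ, HasDerivWithinAt u (u' x) (Set.Icc 0 ℓ) x
  prim : ∀ x ∈ Set.Icc 0 ℓ,
    u' x = u' 0 - (∫ t in (0 : ℝ)..x, (g : ℝ → ℂ) t) - z * ∫ t in (0 : ℝ)..x, u t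

section Seg

variable {z : ℂ} {φ ψ : ℝ → ℂ} {ℓ : ℝ}

theorem seg_intervalIntegrable (g : SegL2 ℓ) {x : ℝ} (hx : x ∈ Set.Icc 0 ℓ) :
    IntervalIntegrable (g : ℝ → ℂ) volume 0 x := by
  rw [intervalIntegrable_iff_integrableOn_Ioc_of_le hx.1]
  have h1 : Integrable (g : ℝ → ℂ) (volume.restrict (Set.Ioc 0 ℓ)) :=
    (Lp.memLp g).integrable one_le_two
  exact IntegrableOn.mono_set h1 (Set.Ioc_subset_Ioc_right hx.2)

theorem integral_seg_congr {p q : ℝ → ℂ}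
    (h : p =ᵐ[volume.restrict (Set.Ioc 0 ℓ)] q) {x : ℝ} (hx : x ∈ Set.Icc 0 ℓ) :
    ∫ t in (0 : ℝ)..x, p t = ∫ t in (0 : ℝ)..x, q t := by
  rw [intervalIntegral.integral_of_le hx.1, intervalIntegral.integral_of_le hx.1]
  exact integral_congr_ae (ae_mono (Measure.restrict_mono (Set.Ioc_subset_Ioc_right hx.2) le_rfl) h)

/-- The primitive of `g`, extended to the line. -/
noncomputable def segPrim (g : SegL2 ℓ) (x : ℝ) : ℂ :=
  ∫ t in (0 : ℝ)..x, (Set.Ioc 0 ℓ).indicator (g : ℝ → ℂ) t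

theorem integrable_indicator_seg (g : SegL2 ℓ) :
    Integrable ((Set.Ioc 0 ℓ).indicator (g : ℝ → ℂ)) :=
  (integrable_indicator_iff measurableSet_Ioc).2 ((Lp.memLp g).integrable one_le_two)

theorem continuous_segPrim (g : SegL2 ℓ) : Continuous (segPrim g) :=
  intervalIntegral.continuous_primitive
    (fun _ _ => (integrable_indicator_seg g).intervalIntegrable) 0

theorem segPrim_zero (g : SegL2 ℓ) : segPrim g 0 = 0 := intervalIntegral.integral_same

theorem segPrim_eq (g : SegL2 ℓ) {x : ℝ} (hx : x ∈ Set.Icc 0 ℓ) :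
    segPrim g x = ∫ t in (0 : ℝ)..x, (g : ℝ → ℂ) t := by
  refine integral_seg_congr ?_ hx
  filter_upwards [ae_restrict_mem measurableSet_Ioc] with t ht
  exact Set.indicator_of_mem ht _

/-- A bound for the `L²` norm in terms of the supremum. -/
noncomputable def segConst (ℓ : ℝ) : ℝ :=
  (measureUnivNNReal (volume.restrict (Set.Ioc 0 ℓ)) : ℝ) ^ (2 : ENNReal).toReal⁻¹

theorem segConst_nonneg : 0 ≤ segConst ℓ := Real.rpow_nonneg (NNReal.coe_nonneg _) _

theorem seg_norm_le {f : SegL2 ℓ} {u : ℝ → ℂ} {D : ℝ} (hD : 0 ≤ D)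
    (h : (f : ℝ → ℂ) =ᵐ[volume.restrict (Set.Ioc 0 ℓ)] u) (hu : ∀ x ∈ Set.Icc 0 ℓ, ‖u x‖ ≤ D) :
    ‖f‖ ≤ segConst ℓ * D := by
  refine Lp.norm_le_of_ae_bound hD ?_
  filter_upwards [h, ae_restrict_mem measurableSet_Ioc] with x hx hx'
  rw [hx]
  exact hu x (Set.Ioc_subset_Icc_self hx')

theorem memLp_of_continuous {u : ℝ → ℂ} (hu : Continuous u) :
    MemLp u 2 (volume.restrict (Set.Ioc 0 ℓ)) := by
  obtain ⟨D, hD⟩ := isCompact_Icc.exists_bound_of_continuousOn (hu.continuousOn (s := Set.Icc 0 ℓ))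
  refine MemLp.of_bound hu.aestronglyMeasurable D ?_
  filter_upwards [ae_restrict_mem measurableSet_Ioc] with x hx
  exact hD x (Set.Ioc_subset_Icc_self hx)

/-- The element of `L²(0, ℓ)` given by a continuous function. -/
noncomputable def segOf (ℓ : ℝ) (u : ℝ → ℂ) (hu : Continuous u) : SegL2 ℓ :=
  (memLp_of_continuous hu).toLp u

theorem segOf_ae {u : ℝ → ℂ} (hu : Continuous u) :
    (segOf ℓ u hu : ℝ → ℂ) =ᵐ[volume.restrict (Set.Ioc 0 ℓ)] u := MemLp.coeFn_toLp _

/-- Hölder's inequality on a finite measure space: the L¹ norm is dominated by the L² norm. -/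
theorem exists_segPrim_bound (ℓ : ℝ) :
    ∃ C : ℝ, 0 ≤ C ∧ ∀ (g : SegL2 ℓ), ∀ x, ‖segPrim g x‖ ≤ C * ‖g‖ := by
  let μ := volume.restrict (Set.Ioc 0 ℓ)
  refine ⟨((μ Set.univ) ^ (1 / (1 : ENNReal).toReal - 1 / (2 : ENNReal).toReal)).toReal,
    ENNReal.toReal_nonneg, fun g x => ?_⟩
  have hint : Integrable (g : ℝ → ℂ) μ := (Lp.memLp g).integrable one_le_two
  have h1 : ‖segPrim g x‖ ≤ ∫ t, ‖(g : ℝ → ℂ) t‖ ∂μ := by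
    calc ‖segPrim g x‖ ≤ ∫ t in Set.uIoc 0 x, ‖(Set.Ioc 0 ℓ).indicator (g : ℝ → ℂ) t‖ :=
          intervalIntegral.norm_integral_le_integral_norm_uIoc
      _ ≤ ∫ t, ‖(Set.Ioc 0 ℓ).indicator (g : ℝ → ℂ) t‖ :=
          setIntegral_le_integral (integrable_indicator_seg g).norm
            (Filter.Eventually.of_forall fun _ => norm_nonneg _)
      _ = ∫ t, ‖(g : ℝ → ℂ) t‖ ∂μ := by
          rw [← integral_indicator measurableSet_Ioc]
          simp only [norm_indicator_eq_indicator_norm]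
  have h2 : ∫ t, ‖(g : ℝ → ℂ) t‖ ∂μ = (eLpNorm (g : ℝ → ℂ) 1 μ).toReal := by
    rw [eLpNorm_one_eq_lintegral_enorm, integral_norm_eq_lintegral_enorm hint.1]
  have h3 := eLpNorm_le_eLpNorm_mul_rpow_measure_univ (μ := μ) (one_le_two (α := ENNReal))
    (Lp.memLp g).1
  rw [h2] at h1
  refine h1.trans ?_
  rw [Lp.norm_def, mul_comm, ← ENNReal.toReal_mul]
  refine ENNReal.toReal_mono (ENNReal.mul_ne_top (Lp.memLp g).2.ne ?_) h3
  exact ENNReal.rpow_ne_top_of_nonneg (by norm_num) (measure_ne_top _ _)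

/-- The solution of `- u'' - z u = g` with zero initial data, and its derivative plus `segPrim g`. -/
noncomputable def segU (z : ℂ) (φ ψ : ℝ → ℂ) (g : SegL2 ℓ) (x : ℝ) : ℂ :=
  -(φ x * (∫ t in (0 : ℝ)..x, φ t * segPrim g t) + z * (ψ x * ∫ t in (0 : ℝ)..x, ψ t * segPrim g t))

/-- The derivative of `segU z φ ψ g`, plus `segPrim g`. -/
noncomputable def segV (z : ℂ) (φ ψ : ℝ → ℂ) (g : SegL2 ℓ) (x : ℝ) : ℂ :=
  z * (ψ x * (∫ t in (0 : ℝ)..x, φ t * segPrim g t) - φ x * ∫ t in (0 : ℝ)..x, ψ t * segPrim g t)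

theorem hasDerivAt_integral_mul_segPrim {χ : ℝ → ℂ} (hχ : Continuous χ) (g : SegL2 ℓ) (x : ℝ) :
    HasDerivAt (fun x => ∫ t in (0 : ℝ)..x, χ t * segPrim g t) (χ x * segPrim g x) x :=
  ((hχ.mul (continuous_segPrim g)).integral_hasStrictDerivAt 0 x).hasDerivAt

/-- Variation of constants for the system u' = v - ∫ g, v' = -z u. With v = u' + ∫ g as second
unknown, the source is continuous instead of merely square integrable, so that classical
differentiation suffices. -/
theorem hasDerivAt_segU (hF : IsFund z φ ψ) (g : SegL2 ℓ) (x : ℝ) :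
    HasDerivAt (segU z φ ψ g) (segV z φ ψ g x - segPrim g x) x := by
  have hP := hasDerivAt_integral_mul_segPrim hF.continuous_phi g x
  have hQ := hasDerivAt_integral_mul_segPrim hF.continuous_psi g x
  refine HasDerivAt.congr_deriv ((((hF.hasDerivAt_phi x).mul hP).add
    (((hF.hasDerivAt_psi x).mul hQ).const_mul z)).neg) ?_
  unfold segV
  linear_combination -segPrim g x * hF.phi_sq_add x

theorem hasDerivAt_segV (hF : IsFund z φ ψ) (g : SegL2 ℓ) (x : ℝ) :
    HasDerivAt (segV z φ ψ g) (-z * segU z φ ψ g x) x := by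
  have hP := hasDerivAt_integral_mul_segPrim hF.continuous_phi g x
  have hQ := hasDerivAt_integral_mul_segPrim hF.continuous_psi g x
  refine HasDerivAt.congr_deriv ((((hF.hasDerivAt_psi x).mul hP).sub ((hF.hasDerivAt_phi x).mul hQ)).const_mul z) ?_
  unfold segU
  ring

theorem segU_zero (g : SegL2 ℓ) : segU z φ ψ g 0 = 0 := by simp [segU]

theorem segV_zero (g : SegL2 ℓ) : segV z φ ψ g 0 = 0 := by simp [segV]

theorem continuous_segU (hF : IsFund z φ ψ) (g : SegL2 ℓ) : Continuous (segU z φ ψ g) :=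
  continuous_iff_continuousAt.2 fun x => (hasDerivAt_segU hF g x).continuousAt

theorem exists_seg_bound (hF : IsFund z φ ψ) (ℓ : ℝ) :
    ∃ C : ℝ, 0 ≤ C ∧ ∀ g : SegL2 ℓ, ∀ x ∈ Set.Icc 0 ℓ, ‖φ x‖ ≤ C ∧ ‖ψ x‖ ≤ C ∧
      ‖segU z φ ψ g x‖ ≤ C * ‖g‖ ∧ ‖segV z φ ψ g x - segPrim g x‖ ≤ C * ‖g‖ := by
  obtain ⟨A, hA⟩ := isCompact_Icc.exists_bound_of_continuousOn
    (hF.continuous_phi.continuousOn (s := Set.Icc 0 ℓ))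
  obtain ⟨B, hB⟩ := isCompact_Icc.exists_bound_of_continuousOn
    (hF.continuous_psi.continuousOn (s := Set.Icc 0 ℓ))
  obtain ⟨c, hc, hcg⟩ := exists_segPrim_bound ℓ
  have hint : ∀ (χ : ℝ → ℂ) (D : ℝ), (∀ x ∈ Set.Icc 0 ℓ, ‖χ x‖ ≤ D) → ∀ (g : SegL2 ℓ),
      ∀ x ∈ Set.Icc 0 ℓ, ‖∫ t in (0 : ℝ)..x, χ t * segPrim g t‖ ≤ |D| * (c * ‖g‖) * |ℓ| := by
    intro χ D hD g x hx
    calc ‖∫ t in (0 : ℝ)..x, χ t * segPrim g t‖ ≤ |D| * (c * ‖g‖) * |x - 0| := by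
          refine intervalIntegral.norm_integral_le_of_norm_le_const fun t ht => ?_
          rw [Set.uIoc_of_le hx.1] at ht
          rw [norm_mul]
          exact mul_le_mul ((hD t ⟨ht.1.le, ht.2.trans hx.2⟩).trans (le_abs_self _)) (hcg g t)
            (norm_nonneg _) (abs_nonneg _)
      _ ≤ |D| * (c * ‖g‖) * |ℓ| := by
          refine mul_le_mul_of_nonneg_left ?_ (by positivity)
          rw [sub_zero, abs_of_nonneg hx.1]
          exact hx.2.trans (le_abs_self _)
  have h1 : ∀ a b a' b' : ℂ, ∀ D E D' E' : ℝ, ‖a‖ ≤ D → ‖b‖ ≤ E → ‖a'‖ ≤ D' → ‖b'‖ ≤ E' →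
      ‖a * b‖ + ‖a' * b'‖ ≤ |D| * E + |D'| * E' := by
    intro a b a' b' D E D' E' h h' h'' h'''
    rw [norm_mul, norm_mul]
    have e1 : 0 ≤ E := (norm_nonneg _).trans h'
    have e2 : 0 ≤ E' := (norm_nonneg _).trans h'''
    gcongr
    · exact h.trans (le_abs_self _)
    · exact h''.trans (le_abs_self _)
  let S : ℝ := |A| + |B|
  have hAS : |A| ≤ S := le_add_of_nonneg_right (abs_nonneg _)
  have hBS : |B| ≤ S := le_add_of_nonneg_left (abs_nonneg _)
  have hS : 0 ≤ S := add_nonneg (abs_nonneg _) (abs_nonneg _)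
  refine ⟨S + c + (1 + ‖z‖) * (2 * S * S * c * |ℓ|), by positivity, fun g x hx => ?_⟩
  have hφ : ‖φ x‖ ≤ S := ((hA x hx).trans (le_abs_self _)).trans hAS
  have hψ : ‖ψ x‖ ≤ S := ((hB x hx).trans (le_abs_self _)).trans hBS
  have hP : ‖∫ t in (0 : ℝ)..x, φ t * segPrim g t‖ ≤ S * (c * ‖g‖) * |ℓ| :=
    (hint φ A hA g x hx).trans (by gcongr)
  have hQ : ‖∫ t in (0 : ℝ)..x, ψ t * segPrim g t‖ ≤ S * (c * ‖g‖) * |ℓ| :=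
    (hint ψ B hB g x hx).trans (by gcongr)
  have hg := hcg g x
  have hM : ∀ a b : ℂ, ‖a‖ ≤ S → ‖b‖ ≤ S * (c * ‖g‖) * |ℓ| → ‖a * b‖ ≤ S * S * c * |ℓ| * ‖g‖ := by
    intro a b ha hb
    rw [norm_mul]
    calc ‖a‖ * ‖b‖ ≤ S * (S * (c * ‖g‖) * |ℓ|) := by gcongr
      _ = _ := by ring
  set M := S * S * c * |ℓ| * ‖g‖ with hMdef
  have hM0 : 0 ≤ M := by positivity
  have hz := norm_nonneg z
  have hN := norm_nonneg g
  refine ⟨hφ.trans ?_, hψ.trans ?_, ?_, ?_⟩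
  · have : 0 ≤ c + (1 + ‖z‖) * (2 * S * S * c * |ℓ|) := by positivity
    linarith
  · have : 0 ≤ c + (1 + ‖z‖) * (2 * S * S * c * |ℓ|) := by positivity
    linarith
  · unfold segU
    rw [norm_neg]
    refine (norm_add_le _ _).trans ?_
    rw [norm_mul z]
    have e1 := hM _ _ hφ hP
    have e2 := hM _ _ hψ hQ
    have e3 : ‖z‖ * ‖ψ x * ∫ t in (0 : ℝ)..x, ψ t * segPrim g t‖ ≤ ‖z‖ * M := by gcongr
    have e4 : (S + c + (1 + ‖z‖) * (2 * S * S * c * |ℓ|)) * ‖g‖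
      = S * ‖g‖ + c * ‖g‖ + 2 * M + 2 * (‖z‖ * M) := by rw [hMdef]; ring
    rw [e4]
    have : 0 ≤ S * ‖g‖ + c * ‖g‖ + M + ‖z‖ * M := by positivity
    linarith
  · unfold segV
    refine (norm_sub_le _ _).trans ?_
    rw [norm_mul z]
    have e1 := hM _ _ hψ hP
    have e2 := hM _ _ hφ hQ
    have e3 : ‖z‖ * ‖ψ x * (∫ t in (0 : ℝ)..x, φ t * segPrim g t)
        - φ x * ∫ t in (0 : ℝ)..x, ψ t * segPrim g t‖ ≤ ‖z‖ * (M + M) := by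
      refine mul_le_mul_of_nonneg_left ((norm_sub_le _ _).trans (add_le_add e1 e2)) hz
    have e4 : (S + c + (1 + ‖z‖) * (2 * S * S * c * |ℓ|)) * ‖g‖
      = S * ‖g‖ + c * ‖g‖ + 2 * M + 2 * (‖z‖ * M) := by rw [hMdef]; ring
    rw [e4]
    have : 0 ≤ S * ‖g‖ + 2 * M := by positivity
    linarith

/-- Uniqueness for the initial value problem: the inverse of the fundamental matrix, applied to (u,
v) and corrected by the integrals of the source, gives the pair α, β with zero derivative, so both
keep their initial values u 0 and u' 0. -/
theorem EdgeSol.eq_segU (hF : IsFund z φ ψ) {f g : SegL2 ℓ} {u u' : ℝ → ℂ}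
    (h : EdgeSol z ℓ f g u u') (hℓ : 0 < ℓ) {x : ℝ} (hx : x ∈ Set.Icc 0 ℓ) :
    u x = φ x * u 0 + ψ x * u' 0 + segU z φ ψ g x ∧
      u' x = -z * ψ x * u 0 + φ x * u' 0 + (segV z φ ψ g x - segPrim g x) := by
  have huc : ContinuousOn u (Set.Icc 0 ℓ) := fun x hx => (h.deriv x hx).continuousWithinAt
  -- A continuous extension of u to the line, so that its primitive is differentiable everywhere.
  let w : ℝ → ℂ := Set.IccExtend hℓ.le ((Set.Icc 0 ℓ).domRestrict u)
  have hw : Continuous w := (continuousOn_iff_continuous_domRestrict.1 huc).Icc_extend'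
  have hwu : ∀ x ∈ Set.Icc 0 ℓ, w x = u x := fun x hx => Set.IccExtend_of_mem hℓ.le _ hx
  let v : ℝ → ℂ := fun x => u' 0 - z * ∫ t in (0 : ℝ)..x, w t
  have hv : ∀ x ∈ Set.Icc 0 ℓ, u' x = v x - segPrim g x := by
    intro x hx
    rw [h.prim x hx, segPrim_eq g hx]
    have : ∫ t in (0 : ℝ)..x, u t = ∫ t in (0 : ℝ)..x, w t := by
      refine intervalIntegral.integral_congr fun t ht => ?_
      rw [Set.uIcc_of_le hx.1] at ht
      exact (hwu t ⟨ht.1, ht.2.trans hx.2⟩).symm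
    rw [this]
    ring
  have hvd : ∀ x ∈ Set.Icc 0 ℓ, HasDerivWithinAt v (-z * u x) (Set.Icc 0 ℓ) x := by
    intro x hx
    rw [← hwu x hx]
    refine HasDerivWithinAt.congr_deriv ((((hw.integral_hasStrictDerivAt 0 x).hasDerivAt.const_mul z).const_sub
      (u' 0)).hasDerivWithinAt) ?_
    ring
  let α : ℝ → ℂ := fun x => φ x * u x - ψ x * v x + ∫ t in (0 : ℝ)..x, φ t * segPrim g t
  let β : ℝ → ℂ := fun x => z * (ψ x * u x) + φ x * v x + z * ∫ t in (0 : ℝ)..x, ψ t * segPrim g t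
  have hα : ∀ x ∈ Set.Icc 0 ℓ, HasDerivWithinAt α 0 (Set.Icc 0 ℓ) x := by
    intro x hx
    have hud := h.deriv x hx
    rw [hv x hx] at hud
    refine HasDerivWithinAt.congr_deriv ((((hF.hasDerivAt_phi x).hasDerivWithinAt.mul hud).sub
      ((hF.hasDerivAt_psi x).hasDerivWithinAt.mul (hvd x hx))).add
      (hasDerivAt_integral_mul_segPrim hF.continuous_phi g x).hasDerivWithinAt) ?_
    ring
  have hβ : ∀ x ∈ Set.Icc 0 ℓ, HasDerivWithinAt β 0 (Set.Icc 0 ℓ) x := by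
    intro x hx
    have hud := h.deriv x hx
    rw [hv x hx] at hud
    refine HasDerivWithinAt.congr_deriv (((((hF.hasDerivAt_psi x).hasDerivWithinAt.mul hud).const_mul z).add
      ((hF.hasDerivAt_phi x).hasDerivWithinAt.mul (hvd x hx))).add
      ((hasDerivAt_integral_mul_segPrim hF.continuous_psi g x).hasDerivWithinAt.const_mul z)) ?_
    ring
  have hconst : ∀ γ : ℝ → ℂ, (∀ x ∈ Set.Icc 0 ℓ, HasDerivWithinAt γ 0 (Set.Icc 0 ℓ) x) →
      γ x = γ 0 := fun γ hγ =>
    constant_of_derivWithin_zero (fun y hy => (hγ y hy).differentiableWithinAt)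
      (fun y hy => (hγ y ⟨hy.1, hy.2.le⟩).derivWithin
        (uniqueDiffOn_Icc hℓ y ⟨hy.1, hy.2.le⟩)) x hx
  have h1 : φ x * u x - ψ x * v x + ∫ t in (0 : ℝ)..x, φ t * segPrim g t = u 0 := by
    have := hconst α hα
    simpa [α, hF.phi_zero, hF.psi_zero] using this
  have h2 : z * (ψ x * u x) + φ x * v x + z * ∫ t in (0 : ℝ)..x, ψ t * segPrim g t = u' 0 := by
    have := hconst β hβ
    simpa [β, v, hF.phi_zero, hF.psi_zero] using this
  have h3 := hF.phi_sq_add x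
  rw [hv x hx]
  unfold segU segV
  constructor
  · linear_combination φ x * h1 + ψ x * h2 - u x * h3
  · linear_combination -z * ψ x * h1 + φ x * h2 - v x * h3

theorem exists_edgeSol (hF : IsFund z φ ψ) (g : SegL2 ℓ) (a b : ℂ) :
    ∃ f u u', EdgeSol z ℓ f g u u' ∧ u 0 = a ∧ u' 0 = b := by
  let u : ℝ → ℂ := fun x => φ x * a + ψ x * b + segU z φ ψ g x
  let v : ℝ → ℂ := fun x => -z * ψ x * a + φ x * b + segV z φ ψ g x
  have hu : ∀ x, HasDerivAt u (v x - segPrim g x) x := fun x => by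
    refine HasDerivAt.congr_deriv ((((hF.hasDerivAt_phi x).mul_const a).add ((hF.hasDerivAt_psi x).mul_const b)).add
      (hasDerivAt_segU hF g x)) ?_
    simp only [v]
    ring
  have hv : ∀ x, HasDerivAt v (-z * u x) x := fun x => by
    refine HasDerivAt.congr_deriv (((((hF.hasDerivAt_psi x).const_mul (-z)).mul_const a).add
      ((hF.hasDerivAt_phi x).mul_const b)).add (hasDerivAt_segV hF g x)) ?_
    simp only [u]
    ring
  have huc : Continuous u := continuous_iff_continuousAt.2 fun x => (hu x).continuousAt
  refine ⟨segOf ℓ u huc, u, fun x => v x - segPrim g x, ⟨segOf_ae huc,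
    fun x _ => (hu x).hasDerivWithinAt, fun x hx => ?_⟩, ?_, ?_⟩
  · have := intervalIntegral.integral_eq_sub_of_hasDerivAt (a := 0) (b := x) (fun y _ => hv y)
      ((continuous_const.mul huc).intervalIntegrable _ _)
    rw [intervalIntegral.integral_const_mul] at this
    rw [segPrim_zero, ← segPrim_eq g hx]
    linear_combination -this
  · simp [u, hF.phi_zero, hF.psi_zero, segU_zero]
  · simp [v, hF.phi_zero, hF.psi_zero, segV_zero, segPrim_zero]

theorem EdgeSol.add {f g f' g' : SegL2 ℓ} {u u' w w' : ℝ → ℂ} (h : EdgeSol z ℓ f g u u')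
    (h' : EdgeSol z ℓ f' g' w w') :
    EdgeSol z ℓ (f + f') (g + g') (fun x => u x + w x) (fun x => u' x + w' x) where
  ae := (Lp.coeFn_add f f').trans (h.ae.add h'.ae)
  deriv x hx := (h.deriv x hx).add (h'.deriv x hx)
  prim x hx := by
    have hc : ∀ {u u' : ℝ → ℂ}, (∀ x ∈ Set.Icc 0 ℓ, HasDerivWithinAt u (u' x) (Set.Icc 0 ℓ) x) →
        IntervalIntegrable u volume 0 x := fun {u u'} hu => by
      refine ContinuousOn.intervalIntegrable ?_
      rw [Set.uIcc_of_le hx.1]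
      exact fun y hy => ((hu y ⟨hy.1, hy.2.trans hx.2⟩).continuousWithinAt).mono
        (Set.Icc_subset_Icc_right hx.2)
    rw [integral_seg_congr (Lp.coeFn_add g g') hx]
    simp only [Pi.add_apply]
    rw [intervalIntegral.integral_add (seg_intervalIntegrable g hx) (seg_intervalIntegrable g' hx),
      intervalIntegral.integral_add (hc h.deriv) (hc h'.deriv), h.prim x hx, h'.prim x hx]
    ring

/-- A function that vanishes at both ends, with slope `w` at `0` and slope `0` at `ℓ`. -/
theorem exists_edgeSol_bump (z : ℂ) (hℓ : 0 < ℓ) :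
    ∃ C : ℝ, 0 ≤ C ∧ ∀ w : ℂ, ∃ f g u u', EdgeSol z ℓ f g u u' ∧ u 0 = 0 ∧ u ℓ = 0 ∧
      u' 0 = w ∧ u' ℓ = 0 ∧ ‖g‖ ≤ C * ‖w‖ := by
  obtain ⟨L, hLℓ⟩ : ∃ L : ℂ, (ℓ : ℂ) = L := ⟨_, rfl⟩
  have hL : L ≠ 0 := hLℓ ▸ Complex.ofReal_ne_zero.2 hℓ.ne'
  -- The cubic has a simple zero with slope 1 at 0 and a double zero at ℓ; `η1`, `η2` are its first
  -- two derivatives.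
  let η : ℝ → ℂ := fun x => (x : ℂ) * ((1 - x / L) * (1 - x / L))
  let η1 : ℝ → ℂ := fun x => (1 - x / L) * (1 - 3 * x / L)
  let η2 : ℝ → ℂ := fun x => -4 / L + 6 * x / L ^ 2
  have hid : ∀ x : ℝ, HasDerivAt (fun x : ℝ => (x : ℂ)) 1 x := fun x => Complex.ofRealCLM.hasDerivAt
  have hη : ∀ x, HasDerivAt η (η1 x) x := fun x => by
    refine HasDerivAt.congr_deriv ((hid x).mul ((((hid x).div_const L).const_sub 1).mul
      (((hid x).div_const L).const_sub 1))) ?_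
    simp only [η1]
    field_simp
    ring
  have hη1 : ∀ x, HasDerivAt η1 (η2 x) x := fun x => by
    refine HasDerivAt.congr_deriv ((((hid x).div_const L).const_sub 1).mul
      ((((hid x).const_mul 3).div_const L).const_sub 1)) ?_
    simp only [η2]
    field_simp
    ring
  have hηc : Continuous η := continuous_iff_continuousAt.2 fun x => (hη x).continuousAt
  have hη2c : Continuous η2 := by fun_prop
  have hgc : ∀ w : ℂ, Continuous fun x => -w * (η2 x + z * η x) := fun w => by fun_prop
  obtain ⟨D, hD⟩ := isCompact_Icc.exists_bound_of_continuousOn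
    ((hgc 1).continuousOn (s := Set.Icc 0 ℓ))
  refine ⟨segConst ℓ * |D|, mul_nonneg segConst_nonneg (abs_nonneg _), fun w =>
    ⟨segOf ℓ (fun x => w * η x) (continuous_const.mul hηc), segOf ℓ _ (hgc w), fun x => w * η x,
    fun x => w * η1 x, ⟨segOf_ae _, fun x _ => ((hη x).const_mul w).hasDerivWithinAt,
    fun x hx => ?_⟩, ?_, ?_, ?_, ?_, ?_⟩⟩
  · rw [integral_seg_congr (segOf_ae (hgc w)) hx]
    have := intervalIntegral.integral_eq_sub_of_hasDerivAt (a := 0) (b := x) (fun y _ => hη1 y)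
      (hη2c.intervalIntegrable _ _)
    rw [intervalIntegral.integral_const_mul, intervalIntegral.integral_add (g := fun x => z * η x)
      (hη2c.intervalIntegrable _ _) ((continuous_const.mul hηc).intervalIntegrable _ _),
      intervalIntegral.integral_const_mul, intervalIntegral.integral_const_mul, this]
    ring
  · simp [η]
  · simp only [η]
    rw [hLℓ, div_self hL]
    ring
  · simp [η1]
  · simp only [η1]
    rw [hLℓ, div_self hL]
    ring
  · rw [mul_assoc]
    refine seg_norm_le (by positivity) (segOf_ae (hgc w)) fun x hx => ?_
    have := (hD x hx).trans (le_abs_self D)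
    rw [norm_mul] at this ⊢
    rw [norm_neg] at this ⊢
    rw [norm_one, one_mul] at this
    rw [mul_comm]
    gcongr

/-- Solvability of the Dirichlet problem for `- u'' - z u = g` on an edge, with the linear relation
between boundary values and outward derivatives, and uniform bounds. -/
structure EdgeResponse (z : ℂ) (φ ψ : ℝ → ℂ) (ℓ : ℝ) (ρ₀ ρ₁ : SegL2 ℓ → ℂ) (C : ℝ) : Prop where
  nonneg : 0 ≤ C
  src_deriv : ∀ {f g u u'}, EdgeSol z ℓ f g u u' → u' 0 = (u ℓ - φ ℓ * u 0) / ψ ℓ + ρ₀ g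
  tgt_deriv : ∀ {f g u u'}, EdgeSol z ℓ f g u u' → -u' ℓ = (u 0 - φ ℓ * u ℓ) / ψ ℓ + ρ₁ g
  norm_le : ∀ {f g u u'}, EdgeSol z ℓ f g u u' → ‖f‖ ≤ C * (‖u 0‖ + ‖u ℓ‖ + ‖g‖)
  trace_le : ∀ {f g u u'}, EdgeSol z ℓ f g u u' → ‖u 0‖ ≤ C * (‖f‖ + ‖g‖)
  rho₀_le : ∀ g, ‖ρ₀ g‖ ≤ C * ‖g‖
  rho₁_le : ∀ g, ‖ρ₁ g‖ ≤ C * ‖g‖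
  exists_sol : ∀ g a b, ∃ f u u', EdgeSol z ℓ f g u u' ∧ u 0 = a ∧ u ℓ = b
  exists_corr : ∀ a b w, ∃ f g u u', EdgeSol z ℓ f g u u' ∧ u 0 = a ∧ u ℓ = b ∧
    u' 0 = (b - φ ℓ * a) / ψ ℓ + w ∧ -u' ℓ = (a - φ ℓ * b) / ψ ℓ ∧ ‖g‖ ≤ C * ‖w‖

theorem EdgeResponse.mono {ρ₀ ρ₁ : SegL2 ℓ → ℂ} {C C' : ℝ} (h : EdgeResponse z φ ψ ℓ ρ₀ ρ₁ C)
    (hC : C ≤ C') : EdgeResponse z φ ψ ℓ ρ₀ ρ₁ C' where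
  nonneg := h.nonneg.trans hC
  src_deriv := h.src_deriv
  tgt_deriv := h.tgt_deriv
  norm_le hs := (h.norm_le hs).trans (by gcongr)
  trace_le hs := (h.trace_le hs).trans (by gcongr)
  rho₀_le g := (h.rho₀_le g).trans (by gcongr)
  rho₁_le g := (h.rho₁_le g).trans (by gcongr)
  exists_sol := h.exists_sol
  exists_corr a b w := by
    obtain ⟨f, g, u, u', h1, h2, h3, h4, h5, h6⟩ := h.exists_corr a b w
    exact ⟨f, g, u, u', h1, h2, h3, h4, h5, h6.trans (by gcongr)⟩

/-- Since ψ ℓ ≠ 0, the formula for u ℓ can be solved for u' 0. The Wronskian identity then turns the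
formula for u' ℓ into the mirror image of the one at the source end. -/
theorem exists_edgeResponse (hF : IsFund z φ ψ) (hℓ : 0 < ℓ) (hψ : ψ ℓ ≠ 0) :
    ∃ ρ₀ ρ₁ C, EdgeResponse z φ ψ ℓ ρ₀ ρ₁ C := by
  have hmem : ℓ ∈ Set.Icc 0 ℓ := ⟨hℓ.le, le_rfl⟩
  obtain ⟨B, hB, hb⟩ := exists_seg_bound hF ℓ
  obtain ⟨Cb, hCb, hbump⟩ := exists_edgeSol_bump z hℓ
  have hφB := fun x hx => (hb 0 x hx).1
  have hψB := fun x hx => (hb 0 x hx).2.1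
  have hUB := fun g x hx => (hb g x hx).2.2.1
  have hVB := fun g x hx => (hb g x hx).2.2.2
  let ρ₀ : SegL2 ℓ → ℂ := fun g => -segU z φ ψ g ℓ / ψ ℓ
  let ρ₁ : SegL2 ℓ → ℂ := fun g => φ ℓ / ψ ℓ * segU z φ ψ g ℓ - (segV z φ ψ g ℓ - segPrim g ℓ)
  -- Initial data to homogeneous solution. It is injective on a finite-dimensional space, hence
  -- bounded below; this controls u 0 by L² norms in the trace estimate.
  let Φ : ℂ × ℂ →ₗ[ℂ] SegL2 ℓ :=
    (LinearMap.fst ℂ ℂ ℂ).smulRight (segOf ℓ φ hF.continuous_phi) +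
      (LinearMap.snd ℂ ℂ ℂ).smulRight (segOf ℓ ψ hF.continuous_psi)
  have hΦ : ∀ a b : ℂ, (Φ (a, b) : ℝ → ℂ) =ᵐ[volume.restrict (Set.Ioc 0 ℓ)]
      fun x => φ x * a + ψ x * b := by
    intro a b
    change ((a • segOf ℓ φ hF.continuous_phi + b • segOf ℓ ψ hF.continuous_psi : SegL2 ℓ) : ℝ → ℂ)
      =ᵐ[_] _
    filter_upwards [Lp.coeFn_add (a • segOf ℓ φ hF.continuous_phi) (b • segOf ℓ ψ hF.continuous_psi),
      Lp.coeFn_smul a (segOf ℓ φ hF.continuous_phi), Lp.coeFn_smul b (segOf ℓ ψ hF.continuous_psi),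
      segOf_ae hF.continuous_phi, segOf_ae hF.continuous_psi] with x h1 h2 h3 h4 h5
    rw [h1, Pi.add_apply, h2, h3, Pi.smul_apply, Pi.smul_apply, h4, h5, smul_eq_mul, smul_eq_mul]
    ring
  have hker : Φ.ker = ⊥ := by
    refine LinearMap.ker_eq_bot'.2 ?_
    rintro ⟨a, b⟩ hab
    have h1 := hΦ a b
    rw [hab] at h1
    have h2 : Set.EqOn (fun x => φ x * a + ψ x * b) (fun _ => 0) (Set.Icc 0 ℓ) := by
      refine Measure.eqOn_Icc_of_ae_eq volume hℓ.ne ?_ ?_ continuousOn_const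
      · rw [← restrict_Ioc_eq_restrict_Icc]
        exact h1.symm.trans (Lp.coeFn_zero ℂ 2 _)
      · exact ((hF.continuous_phi.mul continuous_const).add
          (hF.continuous_psi.mul continuous_const)).continuousOn
    have ha : a = 0 := by simpa [hF.phi_zero, hF.psi_zero] using h2 ⟨le_rfl, hℓ.le⟩
    have hb : b = 0 := by simpa [ha, hψ] using h2 hmem
    rw [ha, hb]
    rfl
  obtain ⟨K, -, hK⟩ := Φ.exists_antilipschitzWith hker
  have hs0 : ∀ {f g u u'}, EdgeSol z ℓ f g u u' → u' 0 = (u ℓ - φ ℓ * u 0) / ψ ℓ + ρ₀ g := by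
    intro f g u u' h
    have := (h.eq_segU hF hℓ hmem).1
    simp only [ρ₀]
    field_simp
    linear_combination -this
  have hs1 : ∀ {f g u u'}, EdgeSol z ℓ f g u u' → -u' ℓ = (u 0 - φ ℓ * u ℓ) / ψ ℓ + ρ₁ g := by
    intro f g u u' h
    obtain ⟨h1, h2⟩ := h.eq_segU hF hℓ hmem
    simp only [ρ₁]
    field_simp
    linear_combination -ψ ℓ * h2 + φ ℓ * h1 + u 0 * hF.phi_sq_add ℓ
  have hr0 : ∀ g, ‖ρ₀ g‖ ≤ B / ‖ψ ℓ‖ * ‖g‖ := by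
    intro g
    simp only [ρ₀]
    rw [norm_div, norm_neg, div_mul_eq_mul_div]
    gcongr
    exact hUB g ℓ hmem
  have hr1 : ∀ g, ‖ρ₁ g‖ ≤ (B / ‖ψ ℓ‖ * B + B) * ‖g‖ := by
    intro g
    simp only [ρ₁]
    refine (norm_sub_le _ _).trans ?_
    rw [norm_mul, norm_div, add_mul, mul_assoc]
    gcongr
    · exact hφB ℓ hmem
    · exact hUB g ℓ hmem
    · exact hVB g ℓ hmem
  have hr00 : ρ₀ 0 = 0 := by simpa using hr0 0
  have hr10 : ρ₁ 0 = 0 := by simpa using hr1 0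
  have hex : ∀ g a b, ∃ f u u', EdgeSol z ℓ f g u u' ∧ u 0 = a ∧ u ℓ = b := by
    intro g a b
    obtain ⟨f, u, u', h, h0, h0'⟩ := exists_edgeSol hF g a ((b - φ ℓ * a) / ψ ℓ + ρ₀ g)
    refine ⟨f, u, u', h, h0, ?_⟩
    have := hs0 h
    rw [h0', h0, add_left_inj] at this
    field_simp at this
    linear_combination -this
  have hp : 0 < ‖ψ ℓ‖ := norm_pos_iff.2 hψ
  let C₁ : ℝ := segConst ℓ * (B + B * (1 / ‖ψ ℓ‖ + B / ‖ψ ℓ‖) + B * (B / ‖ψ ℓ‖) + B)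
  let C₂ : ℝ := K * (1 + segConst ℓ * B)
  have hsc := segConst_nonneg (ℓ := ℓ)
  have hC₁ : 0 ≤ C₁ := by positivity
  have hC₂ : 0 ≤ C₂ := by positivity
  have hb0 : 0 ≤ B / ‖ψ ℓ‖ := by positivity
  have hb1 : 0 ≤ B / ‖ψ ℓ‖ * B + B := by positivity
  refine ⟨ρ₀, ρ₁, C₁ + C₂ + B / ‖ψ ℓ‖ + (B / ‖ψ ℓ‖ * B + B) + Cb, ?_⟩
  have hmono : ∀ {D x : ℝ}, 0 ≤ x → D ≤ C₁ + C₂ + B / ‖ψ ℓ‖ + (B / ‖ψ ℓ‖ * B + B) + Cb →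
      D * x ≤ (C₁ + C₂ + B / ‖ψ ℓ‖ + (B / ‖ψ ℓ‖ * B + B) + Cb) * x :=
    fun hx hD => mul_le_mul_of_nonneg_right hD hx
  refine ⟨by linarith, hs0, hs1, fun {f g u u'} h => ?_, fun {f g u u'} h => ?_, fun g => ?_,
    fun g => ?_, hex, fun a b w => ?_⟩
  · refine le_trans ?_ (hmono (D := C₁) (by positivity) (by linarith))
    simp only [C₁]
    rw [mul_assoc]
    refine seg_norm_le (by positivity) h.ae fun x hx => ?_
    have hd : ‖u' 0‖ ≤ (1 / ‖ψ ℓ‖) * ‖u ℓ‖ + (B / ‖ψ ℓ‖) * ‖u 0‖ + (B / ‖ψ ℓ‖) * ‖g‖ := by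
      rw [hs0 h]
      refine (norm_add_le _ _).trans (add_le_add ?_ (hr0 g))
      rw [norm_div]
      calc ‖u ℓ - φ ℓ * u 0‖ / ‖ψ ℓ‖ ≤ (‖u ℓ‖ + B * ‖u 0‖) / ‖ψ ℓ‖ := by
            gcongr
            refine (norm_sub_le _ _).trans ?_
            rw [norm_mul]
            gcongr
            exact hφB ℓ hmem
        _ = _ := by ring
    rw [(h.eq_segU hF hℓ hx).1]
    have e1 : ‖φ x * u 0‖ ≤ B * ‖u 0‖ := by
      rw [norm_mul]
      gcongr
      exact hφB x hx
    have e2 : ‖ψ x * u' 0‖ ≤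
        B * ((1 / ‖ψ ℓ‖) * ‖u ℓ‖ + (B / ‖ψ ℓ‖) * ‖u 0‖ + (B / ‖ψ ℓ‖) * ‖g‖) := by
      rw [norm_mul]
      gcongr
      exact hψB x hx
    refine (norm_add₃_le).trans ((add_le_add (add_le_add e1 e2) (hUB g x hx)).trans ?_)
    have n1 := norm_nonneg (u 0)
    have n2 := norm_nonneg (u ℓ)
    have n3 := norm_nonneg g
    have : 0 ≤ B * (1 / ‖ψ ℓ‖) * (‖u 0‖ + ‖g‖) + B * (B / ‖ψ ℓ‖) * (‖u ℓ‖ + ‖g‖)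
      + B * (B / ‖ψ ℓ‖) * (‖u ℓ‖ + ‖u 0‖) + B * (‖u ℓ‖ + ‖g‖) + B * (‖u 0‖ + ‖u ℓ‖) := by positivity
    nlinarith
  · refine le_trans ?_ (hmono (D := C₂) (by positivity) (by linarith))
    have h1 : ‖(u 0, u' 0)‖ ≤ K * ‖Φ (u 0, u' 0)‖ := by
      simpa using hK.le_mul_dist (u 0, u' 0) 0
    have hUc := continuous_segU hF g
    have h2 : f = Φ (u 0, u' 0) + segOf ℓ _ hUc := by
      refine Lp.ext ?_
      filter_upwards [h.ae, hΦ (u 0) (u' 0), segOf_ae hUc, ae_restrict_mem measurableSet_Ioc,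
        Lp.coeFn_add (Φ (u 0, u' 0)) (segOf ℓ _ hUc)] with x e1 e2 e3 e4 e5
      rw [e1, e5, Pi.add_apply, e2, e3, (h.eq_segU hF hℓ (Set.Ioc_subset_Icc_self e4)).1]
    have h3 : ‖segOf ℓ _ hUc‖ ≤ segConst ℓ * (B * ‖g‖) :=
      seg_norm_le (by positivity) (segOf_ae hUc) fun x hx => hUB g x hx
    have h4 : Φ (u 0, u' 0) = f - segOf ℓ _ hUc := by rw [h2]; abel
    rw [h4] at h1
    calc ‖u 0‖ ≤ ‖(u 0, u' 0)‖ := norm_fst_le (u 0, u' 0)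
      _ ≤ K * (‖f‖ + segConst ℓ * (B * ‖g‖)) := by
          refine h1.trans ?_
          gcongr
          exact (norm_sub_le _ _).trans (by gcongr)
      _ ≤ C₂ * (‖f‖ + ‖g‖) := by
          simp only [C₂]
          rw [mul_assoc]
          gcongr
          have : 0 ≤ segConst ℓ * B * ‖f‖ := by positivity
          linarith [norm_nonneg g]
  · exact (hr0 g).trans (hmono (norm_nonneg _) (by linarith))
  · exact (hr1 g).trans (hmono (norm_nonneg _) (by linarith))
  -- The homogeneous solution with the given boundary values, plus a bump that changes the slope at
  -- the source end only.
  · obtain ⟨f, u, u', h, h0, hl⟩ := hex 0 a b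
    obtain ⟨f', g', v, v', h', e1, e2, e3, e4, e5⟩ := hbump w
    refine ⟨f + f', 0 + g', fun x => u x + v x, fun x => u' x + v' x, h.add h', ?_, ?_, ?_, ?_, ?_⟩
    · simp [h0, e1]
    · simp [hl, e2]
    · simp only
      rw [hs0 h, e3, hr00, h0, hl, add_zero]
    · simp only
      rw [e4, add_zero, hs1 h, hr10, h0, hl, add_zero]
    · rw [zero_add]
      exact e5.trans (hmono (norm_nonneg _) (by linarith))

end Seg

/-! ### Reduction to an equation on the vertices -/

/-- Square summable functions on the vertices. -/
abbrev VertexL2 (V : Type) : Type := lp (fun _ : V => ℂ) 2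

namespace MetricGraph

variable {V E : Type} {G : MetricGraph V E} {z : ℂ} {φ ψ : ℝ → ℂ} {c : ℝ}

/-- The vertex condition, expressed through the vertex values of a solution of `- u'' = z u`. -/
noncomputable def vertexSum (G : MetricGraph V E) (φ ψ : ℝ → ℂ) (c : ℝ) (F : V → ℂ) (v : V) : ℂ :=
  ∑ e ∈ G.out v, (F (G.tgt e) - φ (G.len e) * F v) / ψ (G.len e) +
    ∑ e ∈ G.inc v, (F (G.src e) - φ (G.len e) * F v) / ψ (G.len e) - c * F v

theorem integral_eq_of_edge (f h : G.L2) (e : E) {u : ℝ → ℂ}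
    (hu : (f e : ℝ → ℂ) =ᵐ[volume.restrict (Set.Ioc 0 (G.len e))] u) {x : ℝ}
    (hx : x ∈ Set.Icc 0 (G.len e)) :
    ∫ t in (0 : ℝ)..x, (h e : ℝ → ℂ) t =
      (∫ t in (0 : ℝ)..x, (((h - z • f) e : SegL2 (G.len e)) : ℝ → ℂ) t)
        + z * ∫ t in (0 : ℝ)..x, u t := by
  have h1 : (h e : ℝ → ℂ) =ᵐ[volume.restrict (Set.Ioc 0 (G.len e))]
      fun t => (((h - z • f) e : SegL2 (G.len e)) : ℝ → ℂ) t + z * (f e : ℝ → ℂ) t := by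
    filter_upwards [Lp.coeFn_sub (h e) (z • f e), Lp.coeFn_smul z (f e)] with t e1 e2
    change _ = (((h e - z • f e : SegL2 (G.len e)) : ℝ → ℂ) t) + _
    rw [e1, Pi.sub_apply, e2, Pi.smul_apply, smul_eq_mul]
    ring
  rw [integral_seg_congr h1 hx, ← integral_seg_congr hu hx, intervalIntegral.integral_add
    (seg_intervalIntegrable _ hx) ((seg_intervalIntegrable _ hx).const_mul z),
    intervalIntegral.integral_const_mul]

theorem edgeRep_iff (f h : G.L2) (z : ℂ) (u u' : E → ℝ → ℂ) :
    G.EdgeRep f h u u' ↔ ∀ e, EdgeSol z (G.len e) (f e) ((h - z • f) e) (u e) (u' e) := by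
  refine ⟨fun H e => ⟨(H e).1, (H e).2.1, fun x hx => ?_⟩, fun H e =>
    ⟨(H e).ae, (H e).deriv, fun x hx => ?_⟩⟩
  · rw [(H e).2.2 x hx, integral_eq_of_edge (z := z) f h e (H e).1 hx]
    ring
  · rw [(H e).prim x hx, integral_eq_of_edge (z := z) f h e (H e).ae hx]
    ring

theorem mem_deltaHamiltonian_graph {f h : G.L2} :
    (f, h) ∈ (G.deltaHamiltonian c).graph ↔
      ∃ u u' : E → ℝ → ℂ, G.EdgeRep f h u u' ∧ G.DeltaCoupling c u u' := by
  rw [deltaHamiltonian_graph]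
  rfl

theorem exists_uniform_edgeResponse (hF : IsFund z φ ψ) (hψ : ∀ e, ψ (G.len e) ≠ 0)
    (hfin : (Set.range G.len).Finite) :
    ∃ (ρ₀ ρ₁ : ∀ e, SegL2 (G.len e) → ℂ) (C : ℝ), 0 ≤ C ∧
      ∀ e, EdgeResponse z φ ψ (G.len e) (ρ₀ e) (ρ₁ e) C := by
  have h : ∀ ℓ : Set.range G.len, ∃ ρ₀ ρ₁ C, EdgeResponse z φ ψ ℓ.1 ρ₀ ρ₁ C := by
    rintro ⟨ℓ, e, rfl⟩
    exact exists_edgeResponse hF (G.len_pos e) (hψ e)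
  choose ρ₀ ρ₁ C hC using h
  have := hfin.to_subtype
  obtain ⟨D, hD⟩ := (Set.finite_range C).bddAbove
  refine ⟨fun e => ρ₀ ⟨G.len e, e, rfl⟩, fun e => ρ₁ ⟨G.len e, e, rfl⟩, max D 0, le_max_right _ _,
    fun e => (hC ⟨G.len e, e, rfl⟩).mono ((hD ⟨_, rfl⟩).trans (le_max_left _ _))⟩

/-- All vertices have at most `d` outgoing and at most `d` incoming edges, and at least one outgoing
edge, and there are finitely many edge lengths. -/
structure IsUniform (G : MetricGraph V E) (d : ℕ) : Prop where
  finite_len : (Set.range G.len).Finite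
  card_out_le : ∀ v, (G.out v).card ≤ d
  card_inc_le : ∀ v, (G.inc v).card ≤ d
  out_nonempty : ∀ v, (G.out v).Nonempty

namespace IsUniform

variable {d : ℕ} (hG : G.IsUniform d)
include hG

theorem comp_src {x : V → ℝ} {K : ℝ} (h : SqBdd x K) : SqBdd (fun e => x (G.src e)) (d * K) :=
  h.comp_fiber G.src G.out d (fun e => (G.mem_out _ e).2 rfl) hG.card_out_le

theorem comp_tgt {x : V → ℝ} {K : ℝ} (h : SqBdd x K) : SqBdd (fun e => x (G.tgt e)) (d * K) :=
  h.comp_fiber G.tgt G.inc d (fun e => (G.mem_inc _ e).2 rfl) hG.card_inc_le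

theorem sum_out {x : E → ℝ} {K : ℝ} (h : SqBdd x K) :
    SqBdd (fun v => ∑ e ∈ G.out v, x e) (d * K) :=
  h.sum_fiber G.src G.out d (fun v e he => (G.mem_out v e).1 he) hG.card_out_le

theorem sum_inc {x : E → ℝ} {K : ℝ} (h : SqBdd x K) :
    SqBdd (fun v => ∑ e ∈ G.inc v, x e) (d * K) :=
  h.sum_fiber G.tgt G.inc d (fun v e he => (G.mem_inc v e).1 he) hG.card_inc_le

/-- The forcing term at the vertices produced by a right-hand side on the edges. -/
theorem exists_vertexForce {ρ₀ ρ₁ : ∀ e, SegL2 (G.len e) → ℂ} {C : ℝ}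
    (hρ : ∀ e, EdgeResponse z φ ψ (G.len e) (ρ₀ e) (ρ₁ e) C) (hC : 0 ≤ C) (g : G.L2) :
    ∃ r : VertexL2 V, (∀ v, r v = -(∑ e ∈ G.out v, ρ₀ e (g e)) - ∑ e ∈ G.inc v, ρ₁ e (g e)) ∧
      ‖r‖ ≤ (d * C + d * C) * ‖g‖ := by
  have hg := (SqBdd.of_lp g).const_mul hC
  have h1 := (hG.sum_out hg).add (hG.sum_inc hg)
  have h2 : SqBdd (fun v => ‖-(∑ e ∈ G.out v, ρ₀ e (g e)) - ∑ e ∈ G.inc v, ρ₁ e (g e)‖) _ :=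
    h1.mono fun v => by
      rw [abs_norm]
      refine (norm_sub_le _ _).trans ?_
      rw [norm_neg]
      exact add_le_add
        ((norm_sum_le _ _).trans (Finset.sum_le_sum fun e _ => (hρ e).rho₀_le _))
        ((norm_sum_le _ _).trans (Finset.sum_le_sum fun e _ => (hρ e).rho₁_le _))
  obtain ⟨r, hr, hr'⟩ := h2.exists_lp (E := fun _ => ℂ)
  exact ⟨r, hr, hr'.trans (by ring_nf; rfl)⟩

theorem edge_norm_le {ρ₀ ρ₁ : ∀ e, SegL2 (G.len e) → ℂ} {C : ℝ}
    (hρ : ∀ e, EdgeResponse z φ ψ (G.len e) (ρ₀ e) (ρ₁ e) C) (hC : 0 ≤ C) (g : G.L2)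
    (F : VertexL2 V) {f : ∀ e, SegL2 (G.len e)} {u u' : E → ℝ → ℂ}
    (hs : ∀ e, EdgeSol z (G.len e) (f e) (g e) (u e) (u' e))
    (hu : ∀ e, u e 0 = F (G.src e) ∧ u e (G.len e) = F (G.tgt e)) :
    SqBdd (fun e => ‖f e‖) (C * (d * ‖F‖ + d * ‖F‖ + ‖g‖)) := by
  refine ((((hG.comp_src (SqBdd.of_lp F)).add (hG.comp_tgt (SqBdd.of_lp F))).add
    (SqBdd.of_lp g)).const_mul hC).mono fun e => ?_
  rw [abs_norm, ← (hu e).1, ← (hu e).2]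
  exact (hρ e).norm_le (hs e)

/-- Once the edges are solved for prescribed vertex values F, the δ conditions read M F = r with a
force r that is bounded by the right-hand side; so F = M⁻¹ r gives existence. Conversely, the vertex
values of any element of the domain are square summable by the trace estimate and solve the same
equation, which gives the a priori bound. -/
theorem notMem_spectrum (hF : IsFund z φ ψ) (hψ : ∀ e, ψ (G.len e) ≠ 0)
    (M : VertexL2 V →L[ℂ] VertexL2 V) (hM : IsUnit M)
    (hMv : ∀ F v, M F v = G.vertexSum φ ψ c F v) :
    z ∉ unboundedSpectrum (G.deltaHamiltonian c) := by
  obtain ⟨ρ₀, ρ₁, C, hC, hρ⟩ := exists_uniform_edgeResponse hF hψ hG.finite_len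
  obtain ⟨M, rfl⟩ := hM
  have hinv : ∀ r, M.1 ((M⁻¹ : (VertexL2 V →L[ℂ] VertexL2 V)ˣ).1 r) = r := fun r => by
    have : (M.1 * (M⁻¹ : (VertexL2 V →L[ℂ] VertexL2 V)ˣ).1) r = r := by rw [Units.mul_inv]; rfl
    exact this
  have hinv' : ∀ r, (M⁻¹ : (VertexL2 V →L[ℂ] VertexL2 V)ˣ).1 (M.1 r) = r := fun r => by
    have : ((M⁻¹ : (VertexL2 V →L[ℂ] VertexL2 V)ˣ).1 * M.1) r = r := by rw [Units.inv_mul]; rfl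
    exact this
  set N := (M⁻¹ : (VertexL2 V →L[ℂ] VertexL2 V)ˣ).1
  -- The defect in the δ condition of an edgewise solution is M F - r.
  have hvert : ∀ (g : G.L2) (r F : VertexL2 V) (f : ∀ e, SegL2 (G.len e)) (u u' : E → ℝ → ℂ),
      (∀ v, r v = -(∑ e ∈ G.out v, ρ₀ e (g e)) - ∑ e ∈ G.inc v, ρ₁ e (g e)) →
      (∀ e, EdgeSol z (G.len e) (f e) (g e) (u e) (u' e)) →
      (∀ e, u e 0 = F (G.src e) ∧ u e (G.len e) = F (G.tgt e)) → ∀ v,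
      (∑ e ∈ G.out v, u' e 0) - (∑ e ∈ G.inc v, u' e (G.len e)) - (c : ℂ) * F v
        = M.1 F v - r v := by
    intro g r F f u u' hr hs hu v
    have h1 : ∑ e ∈ G.out v, u' e 0 = ∑ e ∈ G.out v,
        (F (G.tgt e) - φ (G.len e) * F v) / ψ (G.len e) + ∑ e ∈ G.out v, ρ₀ e (g e) := by
      rw [← Finset.sum_add_distrib]
      refine Finset.sum_congr rfl fun e he => ?_
      rw [(hρ e).src_deriv (hs e), (hu e).1, (hu e).2, (G.mem_out v e).1 he]
    have h2 : -∑ e ∈ G.inc v, u' e (G.len e) = ∑ e ∈ G.inc v,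
        (F (G.src e) - φ (G.len e) * F v) / ψ (G.len e) + ∑ e ∈ G.inc v, ρ₁ e (g e) := by
      rw [← Finset.sum_add_distrib, ← Finset.sum_neg_distrib]
      refine Finset.sum_congr rfl fun e he => ?_
      rw [(hρ e).tgt_deriv (hs e), (hu e).1, (hu e).2, (G.mem_inc v e).1 he]
    rw [hMv, hr, vertexSum]
    linear_combination h1 + h2
  refine notMem_unboundedSpectrum_of_graph (fun g => ?_)
    (C * (d * (‖N‖ * (d * C + d * C)) + d * (‖N‖ * (d * C + d * C)) + 1)) (fun f h hfh => ?_)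
  · obtain ⟨r, hr, -⟩ := hG.exists_vertexForce hρ hC g
    choose f u u' hs h0 hl using fun e =>
      (hρ e).exists_sol (g e) (N r (G.src e)) (N r (G.tgt e))
    have hb := hG.edge_norm_le hρ hC g (N r) hs fun e => ⟨h0 e, hl e⟩
    obtain ⟨f', hf', -⟩ := hb.exists_lp
    refine ⟨f', g + z • f', mem_deltaHamiltonian_graph.2 ⟨u, u', ?_, N r, fun e => ⟨h0 e, hl e⟩,
      fun v => ?_⟩, by rw [add_sub_cancel_right]⟩
    · rw [edgeRep_iff _ _ z, add_sub_cancel_right]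
      intro e
      rw [hf']
      exact hs e
    · have := hvert g r (N r) f u u' hr hs (fun e => ⟨h0 e, hl e⟩) v
      rw [hinv, sub_self] at this
      exact sub_eq_zero.1 this
  · obtain ⟨u, u', hrep, F, hu, hv⟩ := mem_deltaHamiltonian_graph.1 hfh
    rw [edgeRep_iff _ _ z] at hrep
    set g := h - z • f
    -- One outgoing edge per vertex: its trace estimate bounds the vertex value, and distinct
    -- vertices use distinct edges.
    choose o ho using hG.out_nonempty
    have hsrc : ∀ v, G.src (o v) = v := fun v => (G.mem_out v _).1 (ho v)
    have hoi : Function.Injective o := fun a b hab => by rw [← hsrc a, hab, hsrc]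
    have hFb : SqBdd (fun v => ‖F v‖) (C * (‖f‖ + ‖g‖)) := by
      refine ((((SqBdd.of_lp f).add (SqBdd.of_lp g)).const_mul hC).comp_injective o hoi).mono
        fun v => ?_
      rw [abs_norm]
      have := (hρ (o v)).trace_le (hrep (o v))
      rw [(hu (o v)).1, hsrc] at this
      exact this
    obtain ⟨F', hF', -⟩ := hFb.exists_lp (E := fun _ => ℂ)
    have hu' : ∀ e, u e 0 = F' (G.src e) ∧ u e (G.len e) = F' (G.tgt e) := fun e => by
      rw [hF', hF']
      exact hu e
    obtain ⟨r, hr, hrn⟩ := hG.exists_vertexForce hρ hC g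
    have hMr : M.1 F' = r := by
      refine lp.ext (funext fun v => ?_)
      have := hvert g r F' (fun e => f e) u u' hr hrep hu' v
      rw [hF' v, hv v, sub_self] at this
      exact (sub_eq_zero.1 this.symm)
    have hFr : F' = N r := by rw [← hMr, hinv']
    have hFn : ‖F'‖ ≤ ‖N‖ * (d * C + d * C) * ‖g‖ := by
      rw [hFr, mul_assoc]
      exact (N.le_opNorm r).trans (by gcongr)
    have hfb := hG.edge_norm_le hρ hC g F' hrep hu'
    have h1 : ‖f‖ ≤ C * (d * ‖F'‖ + d * ‖F'‖ + ‖g‖) := by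
      refine lp.norm_le_of_forall_sum_le (p := 2) (by norm_num) hfb.1 fun s => ?_
      simpa using hfb.2 s
    refine h1.trans ?_
    calc C * (d * ‖F'‖ + d * ‖F'‖ + ‖g‖)
        ≤ C * (d * (‖N‖ * (d * C + d * C) * ‖g‖) + d * (‖N‖ * (d * C + d * C) * ‖g‖) + ‖g‖) := by
          gcongr
      _ = _ := by ring

/-- F is interpolated by homogeneous edge solutions, whose defect at the vertices is y; bumps of
size comparable to y remove the defect. The result f lies in the domain, (H - z) f is bounded by y,
and the resolvent bound together with the trace estimate returns to F. -/
theorem exists_lower_bound (hF : IsFund z φ ψ) (hψ : ∀ e, ψ (G.len e) ≠ 0)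
    (hz : z ∉ unboundedSpectrum (G.deltaHamiltonian c)) :
    ∃ C : ℝ, 0 ≤ C ∧ ∀ F y : VertexL2 V, (∀ v, y v = G.vertexSum φ ψ c F v) → ‖F‖ ≤ C * ‖y‖ := by
  obtain ⟨ρ₀, ρ₁, C, hC, hρ⟩ := exists_uniform_edgeResponse hF hψ hG.finite_len
  obtain ⟨B, hB, hres⟩ := exists_bound_of_notMem_unboundedSpectrum hz
  refine ⟨C * (B * (C * d) + C * d), by positivity, fun F y hy => ?_⟩
  -- The slope correction -y v is shared equally among the edges that leave v.
  let w : E → ℂ := fun e => -y (G.src e) / (G.out (G.src e)).card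
  have hw : ∀ v, ∑ e ∈ G.out v, w e = -y v := by
    intro v
    have h1 : ∑ e ∈ G.out v, w e = ∑ e ∈ G.out v, -y v / (G.out v).card :=
      Finset.sum_congr rfl fun e he => by simp only [w]; rw [(G.mem_out v e).1 he]
    rw [h1, Finset.sum_const, nsmul_eq_mul, mul_div_cancel₀]
    exact Nat.cast_ne_zero.2 (Finset.card_ne_zero.2 (hG.out_nonempty v))
  have hwn : SqBdd (fun e => ‖w e‖) (d * ‖y‖) := (hG.comp_src (SqBdd.of_lp y)).mono fun e => by
    rw [abs_norm, norm_div, norm_neg, Complex.norm_natCast]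
    refine div_le_self (norm_nonneg _) ?_
    exact_mod_cast Finset.card_pos.2 (hG.out_nonempty _)
  choose f g u u' hs h0 hl h0' hl' hg using fun e =>
    (hρ e).exists_corr (F (G.src e)) (F (G.tgt e)) (w e)
  have hgb : SqBdd (fun e => ‖g e‖) (C * (d * ‖y‖)) := (hwn.const_mul hC).mono fun e => by
    rw [abs_norm]
    exact hg e
  obtain ⟨g', hg', hgn⟩ := hgb.exists_lp
  have hs' : ∀ e, EdgeSol z (G.len e) (f e) (g' e) (u e) (u' e) := fun e => by
    rw [hg']
    exact hs e
  have hfb := hG.edge_norm_le hρ hC g' F hs' fun e => ⟨h0 e, hl e⟩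
  obtain ⟨f', hf', -⟩ := hfb.exists_lp
  have hgr : (f', g' + z • f') ∈ (G.deltaHamiltonian c).graph := by
    refine mem_deltaHamiltonian_graph.2 ⟨u, u', ?_, F, fun e => ⟨h0 e, hl e⟩, fun v => ?_⟩
    · rw [edgeRep_iff _ _ z, add_sub_cancel_right]
      intro e
      rw [hf']
      exact hs' e
    · have h1 : ∑ e ∈ G.out v, u' e 0 = ∑ e ∈ G.out v,
          (F (G.tgt e) - φ (G.len e) * F v) / ψ (G.len e) + ∑ e ∈ G.out v, w e := by
        rw [← Finset.sum_add_distrib]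
        refine Finset.sum_congr rfl fun e he => ?_
        rw [h0', (G.mem_out v e).1 he]
      have h2 : -∑ e ∈ G.inc v, u' e (G.len e) = ∑ e ∈ G.inc v,
          (F (G.src e) - φ (G.len e) * F v) / ψ (G.len e) := by
        rw [← Finset.sum_neg_distrib]
        refine Finset.sum_congr rfl fun e he => ?_
        rw [hl', (G.mem_inc v e).1 he]
      have h3 := hy v
      rw [vertexSum] at h3
      rw [hw] at h1
      linear_combination h1 + h2 - h3
  have hfn := hres _ _ hgr
  rw [add_sub_cancel_right] at hfn
  choose o ho using hG.out_nonempty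
  have hsrc : ∀ v, G.src (o v) = v := fun v => (G.mem_out v _).1 (ho v)
  have hoi : Function.Injective o := fun a b hab => by rw [← hsrc a, hab, hsrc]
  have hFb : SqBdd (fun v => ‖F v‖) (C * (‖f'‖ + ‖g'‖)) := by
    refine ((((SqBdd.of_lp f').add (SqBdd.of_lp g')).const_mul hC).comp_injective o hoi).mono
      fun v => ?_
    rw [abs_norm]
    have := (hρ (o v)).trace_le (hs' (o v))
    rw [h0, hsrc] at this
    rw [hf']
    exact this
  have h1 : ‖F‖ ≤ C * (‖f'‖ + ‖g'‖) := by
    refine lp.norm_le_of_forall_sum_le (p := 2) (by norm_num) hFb.1 fun s => ?_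
    simpa using hFb.2 s
  calc ‖F‖ ≤ C * (B * (C * (d * ‖y‖)) + C * (d * ‖y‖)) := by
        refine h1.trans ?_
        gcongr
        exact hfn.trans (by gcongr)
    _ = _ := by ring

end IsUniform

end MetricGraph

/-! ### Shift operators and their symbols -/

theorem SqBdd.of_support {ι : Type*} {x : ι → ℝ} {K b : ℝ} (hK : 0 ≤ K) (T : Finset ι)
    (h0 : ∀ i, i ∉ T → x i = 0) (hb : ∀ i, |x i| ≤ b) (hT : T.card * b ^ 2 ≤ K ^ 2) : SqBdd x K := by
  classical
  refine ⟨hK, fun s => le_trans ?_ hT⟩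
  calc ∑ i ∈ s, x i ^ 2 ≤ ∑ i ∈ s ∪ T, x i ^ 2 :=
        Finset.sum_le_sum_of_subset_of_nonneg Finset.subset_union_left fun _ _ _ => sq_nonneg _
    _ = ∑ i ∈ T, x i ^ 2 := by
        refine (Finset.sum_subset Finset.subset_union_right fun i _ hi => ?_).symm
        rw [h0 i hi, zero_pow two_ne_zero]
    _ ≤ ∑ i ∈ T, b ^ 2 := Finset.sum_le_sum fun i _ => sq_le_sq' (abs_le.1 (hb i)).1
        (abs_le.1 (hb i)).2
    _ = T.card * b ^ 2 := by rw [Finset.sum_const, nsmul_eq_mul]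

section Shift

variable {V : Type} [AddCommGroup V]

/-- Translation by `g` on `ℓ²(V)`. -/
noncomputable def shift (g : V) : VertexL2 V →L[ℂ] VertexL2 V :=
  LinearMap.mkContinuous
    { toFun := fun F => ⟨fun v => F (v + g), by
        have := (SqBdd.of_lp F).comp_injective (fun v => v + g) (add_left_injective g)
        exact memℓp_gen' (C := ‖F‖ ^ 2) fun s => by simpa using this.2 s⟩
      map_add' := fun _ _ => rfl
      map_smul' := fun _ _ => rfl } 1 fun F => by
    have := (SqBdd.of_lp F).comp_injective (fun v => v + g) (add_left_injective g)
    rw [one_mul]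
    refine lp.norm_le_of_forall_sum_le (p := 2) (by norm_num) this.1 fun s => ?_
    have h := this.2 s
    simp only [ENNReal.toReal_ofNat, Real.rpow_ofNat]
    exact h

@[simp] theorem shift_apply (g : V) (F : VertexL2 V) (v : V) : shift g F v = F (v + g) := rfl

theorem norm_shift_le (g : V) (F : VertexL2 V) : ‖shift g F‖ ≤ ‖F‖ := by
  have := (shift g).le_of_opNorm_le (LinearMap.mkContinuous_norm_le _ zero_le_one _) F
  rwa [one_mul] at this

theorem inner_shift_shift (g : V) (A B : VertexL2 V) :
    inner ℂ (shift g A) (shift g B) = inner ℂ A B := by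
  rw [lp.inner_eq_tsum, lp.inner_eq_tsum]
  exact (Equiv.addRight g).tsum_eq fun v => inner ℂ (A v) (B v)

/-- The two shifts are adjoint to each other, so the form equals 2 Re ⟨F, shift F⟩, which is at most
2 ‖F‖² in modulus. This substitutes for the Fourier transform: t plays the role of the cosine of a
quasimomentum, averaged over F. -/
theorem exists_inner_shift (g : V) (F : VertexL2 V) :
    ∃ t ∈ Set.Icc (-1 : ℝ) 1, inner ℂ F ((shift g + shift (-g)) F) = 2 * (t : ℂ) * (‖F‖ : ℂ) ^ 2 := by
  have h1 : inner ℂ F (shift (-g) F) = (starRingEnd ℂ) (inner ℂ F (shift g F)) := by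
    rw [← inner_shift_shift g, inner_conj_symm]
    congr 1
    refine lp.ext (funext fun v => ?_)
    simp
  have h2 : inner ℂ F ((shift g + shift (-g)) F) = ((2 * (inner ℂ F (shift g F)).re : ℝ) : ℂ) := by
    rw [add_apply, inner_add_right, h1, Complex.add_conj]
  have h3 : |(inner ℂ F (shift g F)).re| ≤ ‖F‖ ^ 2 := by
    refine (Complex.abs_re_le_norm _).trans ((norm_inner_le_norm _ _).trans ?_)
    rw [sq]
    exact mul_le_mul_of_nonneg_left (norm_shift_le g F) (norm_nonneg _)
  rcases eq_or_ne F 0 with rfl | hF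
  · exact ⟨0, by norm_num, by simp⟩
  · have hp : 0 < ‖F‖ ^ 2 := by positivity
    refine ⟨(inner ℂ F (shift g F)).re / ‖F‖ ^ 2, ?_, ?_⟩
    · rw [abs_le] at h3
      constructor
      · rw [le_div_iff₀ hp]
        linarith
      · rw [div_le_iff₀ hp]
        linarith
    · rw [h2]
      have : (‖F‖ : ℂ) ≠ 0 := by simpa using hF
      push_cast
      field_simp

omit [AddCommGroup V] in
-- On the compact square |D| has a positive minimum, so the quadratic form of M is bounded away from
-- zero on unit vectors; this coercivity makes M invertible.
theorem isUnit_of_symbol (M : VertexL2 V →L[ℂ] VertexL2 V) (D : ℝ × ℝ → ℂ) (hD : Continuous D)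
    (h0 : ∀ t ∈ Set.Icc (-1 : ℝ) 1 ×ˢ Set.Icc (-1 : ℝ) 1, D t ≠ 0)
    (hM : ∀ F, ∃ t ∈ Set.Icc (-1 : ℝ) 1 ×ˢ Set.Icc (-1 : ℝ) 1,
      inner ℂ F (M F) = D t * (‖F‖ : ℂ) ^ 2) : IsUnit M := by
  obtain ⟨t₀, ht₀, hmin⟩ := (isCompact_Icc.prod isCompact_Icc).exists_isMinOn
    (s := Set.Icc (-1 : ℝ) 1 ×ˢ Set.Icc (-1 : ℝ) 1) ⟨(0, 0), by norm_num⟩ hD.norm.continuousOn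
  refine ContinuousLinearMap.isUnit_of_forall_le_norm_inner_map M (c := ‖D t₀‖₊)
    (norm_pos_iff.2 (h0 t₀ ht₀)) fun F => ?_
  obtain ⟨t, ht, h⟩ := hM F
  rw [norm_inner_symm, h, norm_mul, mul_comm, norm_pow, Complex.norm_real, norm_norm]
  exact mul_le_mul_of_nonneg_right (hmin ht) (sq_nonneg _)

end Shift

/-! ### The symbol criterion for the lattice and the chain -/

section Lattice

variable {ℓ₁ ℓ₂ : ℝ} {h₁ : 0 < ℓ₁} {h₂ : 0 < ℓ₂} {z : ℂ} {φ ψ : ℝ → ℂ} {c : ℝ}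

theorem rectangularLattice_isUniform : (rectangularLattice ℓ₁ ℓ₂ h₁ h₂).IsUniform 2 where
  finite_len := by
    refine (Set.toFinite {ℓ₁, ℓ₂}).subset ?_
    rintro _ ⟨e | e, rfl⟩ <;> simp [rectangularLattice]
  card_out_le _ := Finset.card_le_two
  card_inc_le _ := Finset.card_le_two
  out_nonempty _ := Finset.insert_nonempty _ _

theorem chain_isUniform (ℓ : ℝ) (h : 0 < ℓ) : (chain ℓ h).IsUniform 2 where
  finite_len := by
    refine (Set.toFinite {ℓ}).subset ?_
    rintro _ ⟨e, rfl⟩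
    simp [chain]
  card_out_le v := by simp [chain]
  card_inc_le v := by simp [chain]
  out_nonempty v := by simp [chain]

theorem vertexSum_rectangularLattice (F : ℤ × ℤ → ℂ) (v : ℤ × ℤ) :
    (rectangularLattice ℓ₁ ℓ₂ h₁ h₂).vertexSum φ ψ c F v =
      (F (v.1 + 1, v.2) + F (v.1 - 1, v.2) - 2 * φ ℓ₁ * F v) / ψ ℓ₁ +
      (F (v.1, v.2 + 1) + F (v.1, v.2 - 1) - 2 * φ ℓ₂ * F v) / ψ ℓ₂ - c * F v := by
  simp only [MetricGraph.vertexSum, rectangularLattice]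
  rw [Finset.sum_pair (by simp), Finset.sum_pair (by simp)]
  simp only [Sum.elim_inl, Sum.elim_inr, id]
  ring

theorem vertexSum_chain (ℓ : ℝ) (h : 0 < ℓ) (F : ℤ → ℂ) (v : ℤ) :
    (chain ℓ h).vertexSum φ ψ c F v = (F (v + 1) + F (v - 1) - 2 * φ ℓ * F v) / ψ ℓ - c * F v := by
  simp only [MetricGraph.vertexSum, chain, Finset.sum_singleton, id]
  ring

theorem notMem_latticeSpectrum (hF : IsFund z φ ψ) (hψ₁ : ψ ℓ₁ ≠ 0) (hψ₂ : ψ ℓ₂ ≠ 0)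
    (hs : ∀ t₁ ∈ Set.Icc (-1 : ℝ) 1, ∀ t₂ ∈ Set.Icc (-1 : ℝ) 1,
      2 * (t₁ - φ ℓ₁) / ψ ℓ₁ + 2 * (t₂ - φ ℓ₂) / ψ ℓ₂ ≠ (c : ℂ)) :
    z ∉ latticeSpectrum ℓ₁ ℓ₂ h₁ h₂ c := by
  let M : VertexL2 (ℤ × ℤ) →L[ℂ] VertexL2 (ℤ × ℤ) :=
    (ψ ℓ₁)⁻¹ • (shift (1, 0) + shift (-(1, 0))) + (ψ ℓ₂)⁻¹ • (shift (0, 1) + shift (-(0, 1)))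
      - (2 * φ ℓ₁ / ψ ℓ₁ + 2 * φ ℓ₂ / ψ ℓ₂ + c) • 1
  refine rectangularLattice_isUniform.notMem_spectrum hF (by rintro (e | e) <;> assumption) M
    (isUnit_of_symbol M
      (fun t => 2 * (t.1 - φ ℓ₁) / ψ ℓ₁ + 2 * (t.2 - φ ℓ₂) / ψ ℓ₂ - c) (by fun_prop)
      (fun t ht => sub_ne_zero.2 (hs t.1 ht.1 t.2 ht.2)) fun F => ?_) fun F v => ?_
  · obtain ⟨t₁, ht₁, e₁⟩ := exists_inner_shift (1, 0) F
    obtain ⟨t₂, ht₂, e₂⟩ := exists_inner_shift (0, 1) F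
    refine ⟨(t₁, t₂), ⟨ht₁, ht₂⟩, ?_⟩
    have e₀ : inner ℂ F F = (‖F‖ : ℂ) ^ 2 := inner_self_eq_norm_sq_to_K F
    simp only [M]
    rw [sub_apply, add_apply, smul_apply, smul_apply, smul_apply, one_apply_eq_self]
    rw [inner_sub_right, inner_add_right, inner_smul_right, inner_smul_right, inner_smul_right,
      e₀, e₁, e₂]
    ring
  · rw [vertexSum_rectangularLattice]
    change (ψ ℓ₁)⁻¹ * (F (v + (1, 0)) + F (v + -(1, 0)))
      + (ψ ℓ₂)⁻¹ * (F (v + (0, 1)) + F (v + -(0, 1))) - _ * F v = _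
    have e1 : v + (1, 0) = (v.1 + 1, v.2) := by ext <;> simp
    have e2 : v + -(1, 0) = (v.1 - 1, v.2) := by ext <;> simp [sub_eq_add_neg]
    have e3 : v + (0, 1) = (v.1, v.2 + 1) := by ext <;> simp
    have e4 : v + -(0, 1) = (v.1, v.2 - 1) := by ext <;> simp [sub_eq_add_neg]
    rw [e1, e2, e3, e4]
    ring

theorem notMem_kronigPenneySpectrum {ℓ : ℝ} (h : 0 < ℓ) (hF : IsFund z φ ψ) (hψ : ψ ℓ ≠ 0)
    (hs : ∀ t ∈ Set.Icc (-1 : ℝ) 1, 2 * (t - φ ℓ) / ψ ℓ ≠ (c : ℂ)) :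
    z ∉ kronigPenneySpectrum ℓ h c := by
  let M : VertexL2 ℤ →L[ℂ] VertexL2 ℤ :=
    (ψ ℓ)⁻¹ • (shift 1 + shift (-1)) - (2 * φ ℓ / ψ ℓ + c) • 1
  refine (chain_isUniform ℓ h).notMem_spectrum hF (fun _ => hψ) M
    (isUnit_of_symbol M (fun t => 2 * (t.1 - φ ℓ) / ψ ℓ - c) (by fun_prop)
      (fun t ht => sub_ne_zero.2 (hs t.1 ht.1)) fun F => ?_) fun F v => ?_
  · obtain ⟨t, ht, e⟩ := exists_inner_shift 1 F
    refine ⟨(t, t), ⟨ht, ht⟩, ?_⟩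
    have e₀ : inner ℂ F F = (‖F‖ : ℂ) ^ 2 := inner_self_eq_norm_sq_to_K F
    simp only [M]
    rw [sub_apply, smul_apply, smul_apply, one_apply_eq_self]
    rw [inner_sub_right, inner_smul_right, inner_smul_right, e₀, e]
    ring
  · rw [vertexSum_chain]
    change (ψ ℓ)⁻¹ * (F (v + 1) + F (v - 1)) - _ * F v = _
    ring

/-- A plane wave with `cos θ = t`, cut off outside `[0, N)`. -/
noncomputable def cutWave (t : ℝ) (N : ℕ) (n : ℤ) : ℂ :=
  if n ∈ Finset.Ico (0 : ℤ) N then Complex.exp (Complex.I * (Real.arccos t * n : ℝ)) else 0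

theorem norm_cutWave (t : ℝ) (N : ℕ) (n : ℤ) :
    ‖cutWave t N n‖ = if n ∈ Finset.Ico (0 : ℤ) N then 1 else 0 := by
  unfold cutWave
  split_ifs
  · rw [Complex.norm_exp_I_mul_ofReal]
  · exact norm_zero

theorem norm_cutWave_le (t : ℝ) (N : ℕ) (n : ℤ) : ‖cutWave t N n‖ ≤ 1 := by
  rw [norm_cutWave]
  split_ifs <;> norm_num

theorem sqBdd_cutWave (t : ℝ) (N : ℕ) : SqBdd (fun n => ‖cutWave t N n‖) (√N) := by
  refine SqBdd.of_support (b := 1) (Real.sqrt_nonneg _) (Finset.Ico (0 : ℤ) N) (fun n hn => ?_)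
    (fun n => ?_) ?_
  · rw [norm_cutWave, if_neg hn]
  · rw [abs_norm]
    exact norm_cutWave_le t N n
  · rw [Real.sq_sqrt (Nat.cast_nonneg _)]
    simp

/-- By 2 cos θ = exp (iθ) + exp (-iθ) the uncut wave has no defect. The cut creates one only next to
the two ends of the window, so the bound does not depend on N. -/
theorem sqBdd_cutWave_defect {t : ℝ} (ht : t ∈ Set.Icc (-1 : ℝ) 1) (N : ℕ) :
    SqBdd (fun n => ‖cutWave t N (n + 1) + cutWave t N (n - 1) - 2 * t * cutWave t N n‖) 8 := by
  -- Four sites with a defect of at most 1 + 1 + 2 each: 4 * 4² = 8².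
  refine SqBdd.of_support (b := 4) (by norm_num) {-1, 0, (N : ℤ) - 1, (N : ℤ)} (fun n hn => ?_)
    (fun n => ?_) ?_
  · simp only [Finset.mem_insert, Finset.mem_singleton, not_or] at hn
    rw [norm_eq_zero]
    unfold cutWave
    by_cases hmem : n ∈ Finset.Ico (0 : ℤ) N
    · have h1 : n + 1 ∈ Finset.Ico (0 : ℤ) N := by
        rw [Finset.mem_Ico] at hmem ⊢
        omega
      have h2 : n - 1 ∈ Finset.Ico (0 : ℤ) N := by
        rw [Finset.mem_Ico] at hmem ⊢
        omega
      rw [if_pos hmem, if_pos h1, if_pos h2]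
      have e : (2 * t : ℂ) = Complex.exp (Complex.I * (Real.arccos t : ℝ))
          + Complex.exp (-(Complex.I * (Real.arccos t : ℝ))) := by
        have h3 := Complex.two_cos (Real.arccos t : ℂ)
        rw [← Complex.ofReal_cos, Real.cos_arccos ht.1 ht.2] at h3
        rw [h3]
        congr 2 <;> ring
      rw [e, add_mul, ← Complex.exp_add, ← Complex.exp_add]
      push_cast
      have e1 : Complex.I * (Real.arccos t * (n + 1 : ℂ))
        = Complex.I * Real.arccos t + Complex.I * (Real.arccos t * n) := by ring
      have e2 : Complex.I * (Real.arccos t * (n - 1 : ℂ))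
        = -(Complex.I * Real.arccos t) + Complex.I * (Real.arccos t * n) := by ring
      rw [e1, e2, sub_self]
    · have h1 : n + 1 ∉ Finset.Ico (0 : ℤ) N := by
        rw [Finset.mem_Ico] at hmem ⊢
        omega
      have h2 : n - 1 ∉ Finset.Ico (0 : ℤ) N := by
        rw [Finset.mem_Ico] at hmem ⊢
        omega
      rw [if_neg hmem, if_neg h1, if_neg h2]
      simp
  · rw [abs_norm]
    have h1 := norm_cutWave_le t N (n + 1)
    have h2 := norm_cutWave_le t N (n - 1)
    have h3 : ‖2 * (t : ℂ) * cutWave t N n‖ ≤ 2 := by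
      rw [norm_mul, norm_mul, Complex.norm_two, Complex.norm_real]
      have h4 : ‖t‖ ≤ 1 := abs_le.2 ht
      have h5 := norm_cutWave_le t N n
      have h6 := norm_nonneg (cutWave t N n)
      nlinarith [norm_nonneg t]
    refine (norm_sub_le _ _).trans ?_
    have := norm_add_le (cutWave t N (n + 1)) (cutWave t N (n - 1))
    linarith
  · have h1 : (({-1, 0, (N : ℤ) - 1, (N : ℤ)} : Finset ℤ).card : ℝ) ≤ 4 := by
      exact_mod_cast Finset.card_le_four
    linarith

/-- Weyl sequence: the product of two cut waves has norm N, while its defect lives near the boundary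
of the N × N box and is of order √N. A lower bound for the vertex operator would keep √N bounded. -/
theorem mem_latticeSpectrum (hF : IsFund z φ ψ) (hψ₁ : ψ ℓ₁ ≠ 0) (hψ₂ : ψ ℓ₂ ≠ 0) {t₁ t₂ : ℝ}
    (ht₁ : t₁ ∈ Set.Icc (-1 : ℝ) 1) (ht₂ : t₂ ∈ Set.Icc (-1 : ℝ) 1)
    (hs : 2 * (t₁ - φ ℓ₁) / ψ ℓ₁ + 2 * (t₂ - φ ℓ₂) / ψ ℓ₂ = (c : ℂ)) :
    z ∈ latticeSpectrum ℓ₁ ℓ₂ h₁ h₂ c := by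
  by_contra hz
  obtain ⟨C, hC, hlow⟩ := rectangularLattice_isUniform.exists_lower_bound hF
    (by rintro (e | e) <;> assumption) hz
  let K : ℝ := ‖(ψ ℓ₁)⁻¹‖ * 8 + ‖(ψ ℓ₂)⁻¹‖ * 8
  have hK : 0 ≤ K := by positivity
  have key : ∀ N : ℕ, 0 < N → √(N : ℝ) ≤ C * K := by
    intro N hN
    have hFb : SqBdd (fun p : ℤ × ℤ => ‖cutWave t₁ N p.1 * cutWave t₂ N p.2‖) (√N * √N) :=
      ((sqBdd_cutWave t₁ N).prod (sqBdd_cutWave t₂ N)).mono fun p => by rw [abs_norm, norm_mul]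
    obtain ⟨F, hFv, -⟩ := hFb.exists_lp (E := fun _ => ℂ)
    have hyb : SqBdd (fun p : ℤ × ℤ =>
        ‖(rectangularLattice ℓ₁ ℓ₂ h₁ h₂).vertexSum φ ψ c F p‖) (√N * K) := by
      have b1 := ((sqBdd_cutWave_defect ht₁ N).prod (sqBdd_cutWave t₂ N)).const_mul
        (norm_nonneg (ψ ℓ₁)⁻¹)
      have b2 := ((sqBdd_cutWave t₁ N).prod (sqBdd_cutWave_defect ht₂ N)).const_mul
        (norm_nonneg (ψ ℓ₂)⁻¹)
      refine ((b1.add b2).mono fun p => ?_).weaken (by simp only [K]; ring_nf; rfl)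
      rw [abs_norm, ← norm_mul, ← norm_mul, ← norm_mul, ← norm_mul]
      refine le_trans (le_of_eq (congrArg _ ?_)) (norm_add_le _ _)
      rw [vertexSum_rectangularLattice, ← hs]
      simp only [hFv]
      ring
    obtain ⟨y, hy, hyn⟩ := hyb.exists_lp (E := fun _ => ℂ)
    have h1 : ‖F‖ ≤ C * (√N * K) := (hlow F y hy).trans (by gcongr)
    have h2 : (N : ℝ) ≤ ‖F‖ := by
      refine (pow_le_pow_iff_left₀ (Nat.cast_nonneg _) (norm_nonneg _) two_ne_zero).1 ?_
      refine le_trans (le_of_eq ?_)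
        ((SqBdd.of_lp F).2 (Finset.Ico (0 : ℤ) N ×ˢ Finset.Ico (0 : ℤ) N))
      rw [Finset.sum_congr rfl (g := fun _ => (1 : ℝ))]
      · simp [sq]
      · rintro ⟨a, b⟩ hab
        rw [Finset.mem_product] at hab
        change ‖F (a, b)‖ ^ 2 = 1
        rw [hFv, norm_mul, norm_cutWave, norm_cutWave, if_pos hab.1, if_pos hab.2]
        norm_num
    have h3 : 0 < √(N : ℝ) := Real.sqrt_pos.2 (Nat.cast_pos.2 hN)
    have h4 : √(N : ℝ) * √N = N := Real.mul_self_sqrt (Nat.cast_nonneg _)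
    nlinarith
  obtain ⟨N, hN⟩ := exists_nat_gt ((C * K) ^ 2)
  have h0 : 0 < N := by
    have : (0 : ℝ) < N := lt_of_le_of_lt (sq_nonneg _) hN
    exact_mod_cast this
  have := key N h0
  rw [Real.sqrt_le_left (by positivity)] at this
  linarith

theorem isClosed_latticeSpectrum : IsClosed (latticeSpectrum ℓ₁ ℓ₂ h₁ h₂ c) :=
  isClosed_unboundedSpectrum

end Lattice

/-! ### Explicit fundamental solutions and reality of the spectrum -/

theorem isFund_complex {k : ℂ} (hk : k ≠ 0) :
    IsFund (k ^ 2) (fun x => Complex.cos (k * x)) (fun x => Complex.sin (k * x) / k) where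
  phi_zero := by simp
  psi_zero := by simp
  hasDerivAt_psi x := by
    have h : HasDerivAt (fun x : ℝ => k * (x : ℂ)) k x := by
      simpa using Complex.ofRealCLM.hasDerivAt.const_mul k
    refine (((Complex.hasDerivAt_sin _).comp x h).div_const k).congr_deriv ?_
    field_simp
  hasDerivAt_phi x := by
    have h : HasDerivAt (fun x : ℝ => k * (x : ℂ)) k x := by
      simpa using Complex.ofRealCLM.hasDerivAt.const_mul k
    refine ((Complex.hasDerivAt_cos _).comp x h).congr_deriv ?_
    field_simp

theorem isFund_trig {k : ℝ} (hk : k ≠ 0) :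
    IsFund ((k ^ 2 : ℝ) : ℂ) (fun x => ((Real.cos (k * x) : ℝ) : ℂ))
      (fun x => ((Real.sin (k * x) / k : ℝ) : ℂ)) := by
  have := isFund_complex (Complex.ofReal_ne_zero.2 hk)
  push_cast
  exact this

theorem isFund_hyp {k : ℝ} (hk : k ≠ 0) :
    IsFund ((-k ^ 2 : ℝ) : ℂ) (fun x => ((Real.cosh (k * x) : ℝ) : ℂ))
      (fun x => ((Real.sinh (k * x) / k : ℝ) : ℂ)) where
  phi_zero := by simp
  psi_zero := by simp
  hasDerivAt_psi x := by
    have h : HasDerivAt (fun x : ℝ => k * x) k x := by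
      simpa using (hasDerivAt_id x).const_mul k
    refine ((((Real.hasDerivAt_sinh _).comp x h).div_const k).congr_deriv ?_).ofReal_comp
    field_simp
  hasDerivAt_phi x := by
    have h : HasDerivAt (fun x : ℝ => k * x) k x := by
      simpa using (hasDerivAt_id x).const_mul k
    refine ((Real.hasDerivAt_cosh _).comp x h).ofReal_comp.congr_deriv ?_
    push_cast
    have : (k : ℂ) ≠ 0 := Complex.ofReal_ne_zero.2 hk
    field_simp

theorem isFund_free :
    IsFund ((0 : ℝ) : ℂ) (fun _ => ((1 : ℝ) : ℂ)) (fun x => ((x : ℝ) : ℂ)) where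
  phi_zero := by simp
  psi_zero := by simp
  hasDerivAt_psi x := by simpa using (hasDerivAt_id x).ofReal_comp
  hasDerivAt_phi x := by simpa using hasDerivAt_const x (1 : ℂ)

/-- From |sin α| ≤ |α| and β² < β sinh β; the factor α β makes the inequality independent of signs.
-/
theorem abs_sin_mul_lt {α β : ℝ} (hα : α ≠ 0) (hβ : β ≠ 0) :
    |α * β * (β * Real.sin α)| < α * β * (α * Real.sinh β) := by
  have h1 : |Real.sin α| ≤ |α| := Real.abs_sin_le_abs
  have h2 : β ^ 2 < β * Real.sinh β := by
    rcases lt_or_gt_of_ne hβ with h | h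
    · have := Real.sinh_lt_self_iff.2 h
      nlinarith
    · have := Real.self_lt_sinh_iff.2 h
      nlinarith
  have h3 : 0 < α ^ 2 := by positivity
  calc |α * β * (β * Real.sin α)| = |α| * β ^ 2 * |Real.sin α| := by
        rw [← sq_abs β, abs_mul, abs_mul, abs_mul]
        ring
    _ ≤ |α| * β ^ 2 * |α| := by gcongr
    _ = α ^ 2 * β ^ 2 := by rw [← sq_abs α]; ring
    _ < α ^ 2 * (β * Real.sinh β) := by gcongr
    _ = _ := by ring

/-- Herglotz property with k = a + i b: the imaginary part of each term of the symbol has the sign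
of a b, that is, of Im k². Two such terms cannot add up to a real c. -/
theorem symbol_im_pos {a b ℓ t : ℝ} (ha : a ≠ 0) (hb : b ≠ 0) (hℓ : 0 < ℓ)
    (ht : t ∈ Set.Icc (-1 : ℝ) 1) :
    Complex.sin ((a + b * Complex.I) * ℓ) / (a + b * Complex.I) ≠ 0 ∧
    0 < a * b * (2 * ((t : ℂ) - Complex.cos ((a + b * Complex.I) * ℓ)) /
      (Complex.sin ((a + b * Complex.I) * ℓ) / (a + b * Complex.I))).im := by
  obtain ⟨α, hα⟩ : ∃ α, α = a * ℓ := ⟨_, rfl⟩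
  obtain ⟨β, hβ⟩ : ∃ β, β = b * ℓ := ⟨_, rfl⟩
  have hα0 : α ≠ 0 := hα ▸ mul_ne_zero ha hℓ.ne'
  have hβ0 : β ≠ 0 := hβ ▸ mul_ne_zero hb hℓ.ne'
  have hk : (a + b * Complex.I : ℂ) ≠ 0 := fun h => ha (by simpa using congrArg Complex.re h)
  have hw : (a + b * Complex.I : ℂ) * ℓ = α + β * Complex.I := by
    rw [hα, hβ]
    push_cast
    ring
  have hs : Complex.sin (α + β * Complex.I) =
      ⟨Real.sin α * Real.cosh β, Real.cos α * Real.sinh β⟩ := by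
    rw [Complex.sin_add_mul_I, ← Complex.ofReal_sin, ← Complex.ofReal_cos, ← Complex.ofReal_cosh,
      ← Complex.ofReal_sinh, ← Complex.ofReal_mul, ← Complex.ofReal_mul, ← Complex.mk_eq_add_mul_I]
  have hc : Complex.cos (α + β * Complex.I) =
      ⟨Real.cos α * Real.cosh β, -(Real.sin α * Real.sinh β)⟩ := by
    rw [Complex.cos_add_mul_I, ← Complex.ofReal_sin, ← Complex.ofReal_cos, ← Complex.ofReal_cosh,
      ← Complex.ofReal_sinh, ← Complex.ofReal_mul, ← Complex.ofReal_mul, sub_eq_add_neg, ← neg_mul,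
      ← Complex.ofReal_neg, ← Complex.mk_eq_add_mul_I]
  have hsh : 0 < Real.sinh β ^ 2 := by
    have : Real.sinh β ≠ 0 := by simpa using hβ0
    positivity
  have e1 := Real.sin_sq_add_cos_sq α
  have e2 := Real.cosh_sq β
  have hN : 0 < Complex.normSq (Complex.sin (α + β * Complex.I)) := by
    rw [hs, Complex.normSq_mk]
    have : Real.sin α * Real.cosh β * (Real.sin α * Real.cosh β)
        + Real.cos α * Real.sinh β * (Real.cos α * Real.sinh β)
        = Real.sin α ^ 2 + Real.sinh β ^ 2 := by
      linear_combination Real.sin α ^ 2 * e2 + Real.sinh β ^ 2 * e1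
    rw [this]
    positivity
  have hs0 : Complex.sin (α + β * Complex.I) ≠ 0 := fun h => by simp [h] at hN
  rw [hw]
  refine ⟨div_ne_zero hs0 hk, ?_⟩
  set N := Complex.normSq (Complex.sin (α + β * Complex.I)) with hNdef
  have hrew : 2 * ((t : ℂ) - Complex.cos (α + β * Complex.I)) /
      (Complex.sin (α + β * Complex.I) / (a + b * Complex.I)) =
      ((2 / (ℓ * N) : ℝ) : ℂ) * ((α + β * Complex.I) * (((t : ℂ) - Complex.cos (α + β * Complex.I)) *
        (starRingEnd ℂ) (Complex.sin (α + β * Complex.I)))) := by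
    have h1 : (N : ℂ) = Complex.sin (α + β * Complex.I) *
        (starRingEnd ℂ) (Complex.sin (α + β * Complex.I)) := (Complex.mul_conj _).symm
    have hl : (ℓ : ℂ) ≠ 0 := Complex.ofReal_ne_zero.2 hℓ.ne'
    have hst : (starRingEnd ℂ) (Complex.sin (α + β * Complex.I)) ≠ 0 :=
      (map_ne_zero _).2 hs0
    rw [← hw] at *
    push_cast
    rw [h1]
    field_simp
  rw [hrew, Complex.im_ofReal_mul]
  -- The imaginary part is affine in t; it is written as a convex combination of its values at t = 1
  -- and t = -1, where it factors.
  have him : ((α + β * Complex.I) * (((t : ℂ) - Complex.cos (α + β * Complex.I)) *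
        (starRingEnd ℂ) (Complex.sin (α + β * Complex.I)))).im =
      (1 + t) / 2 * ((Real.cosh β - Real.cos α) * (α * Real.sinh β + β * Real.sin α)) +
      (1 - t) / 2 * ((Real.cosh β + Real.cos α) * (α * Real.sinh β - β * Real.sin α)) := by
    rw [hs, hc]
    simp
    linear_combination α * Real.sinh β * Real.cosh β * e1 - β * Real.sin α * Real.cos α * e2
  rw [him]
  have hlt := abs_lt.1 (abs_sin_mul_lt hα0 hβ0)
  have hch : 1 < Real.cosh β := Real.one_lt_cosh.2 hβ0
  have p1 : 0 < α * β * ((Real.cosh β - Real.cos α) * (α * Real.sinh β + β * Real.sin α)) := by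
    have : 0 < (Real.cosh β - Real.cos α) * (α * β * (α * Real.sinh β) + α * β * (β * Real.sin α)) :=
      mul_pos (by linarith [Real.cos_le_one α]) (by linarith)
    linarith
  have p2 : 0 < α * β * ((Real.cosh β + Real.cos α) * (α * Real.sinh β - β * Real.sin α)) := by
    have : 0 < (Real.cosh β + Real.cos α) * (α * β * (α * Real.sinh β) - α * β * (β * Real.sin α)) :=
      mul_pos (by linarith [Real.neg_one_le_cos α]) (by linarith)
    linarith
  have hab : a * b = α * β / ℓ ^ 2 := by
    rw [hα, hβ]
    field_simp
  rw [hab]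
  set A := (Real.cosh β - Real.cos α) * (α * Real.sinh β + β * Real.sin α)
  set B := (Real.cosh β + Real.cos α) * (α * Real.sinh β - β * Real.sin α)
  have : 0 < (1 + t) / 2 * (α * β * A) + (1 - t) / 2 * (α * β * B) := by
    rcases le_total 0 t with h | h
    · have := mul_pos (show 0 < (1 + t) / 2 by linarith) p1
      have := mul_nonneg (show 0 ≤ (1 - t) / 2 by linarith [ht.2]) p2.le
      linarith
    · have := mul_pos (show 0 < (1 - t) / 2 by linarith) p2
      have := mul_nonneg (show 0 ≤ (1 + t) / 2 by linarith [ht.1]) p1.le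
      linarith
  calc (0 : ℝ) < 2 / (ℓ * N) / ℓ ^ 2 *
        ((1 + t) / 2 * (α * β * A) + (1 - t) / 2 * (α * β * B)) := by positivity
    _ = _ := by ring

/-! ### Real energies: admissible couplings form an interval -/

section Criterion

variable {ℓ₁ ℓ₂ : ℝ} {h₁ : 0 < ℓ₁} {h₂ : 0 < ℓ₂} {c : ℝ}

theorem im_eq_zero_of_mem_latticeSpectrum {z : ℂ} (hz : z ∈ latticeSpectrum ℓ₁ ℓ₂ h₁ h₂ c) :
    z.im = 0 := by
  by_contra him
  obtain ⟨k, hk⟩ := IsAlgClosed.exists_pow_nat_eq z two_pos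
  replace hk := hk.symm
  have hzim : z.im = 2 * (k.re * k.im) := by
    rw [hk, sq, Complex.mul_im]
    ring
  have ha : k.re ≠ 0 := fun h => him (by rw [hzim, h]; ring)
  have hb : k.im ≠ 0 := fun h => him (by rw [hzim, h]; ring)
  have hk0 : k ≠ 0 := fun h => ha (by rw [h]; rfl)
  rw [hk] at hz
  have hsym := fun (ℓ t : ℝ) (hℓ : 0 < ℓ) (ht : t ∈ Set.Icc (-1 : ℝ) 1) =>
    symbol_im_pos ha hb hℓ ht
  simp only [Complex.re_add_im] at hsym
  refine notMem_latticeSpectrum (isFund_complex hk0) (hsym ℓ₁ 0 h₁ (by norm_num)).1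
    (hsym ℓ₂ 0 h₂ (by norm_num)).1 (fun t₁ ht₁ t₂ ht₂ h => ?_) hz
  have e1 := (hsym ℓ₁ t₁ h₁ ht₁).2
  have e2 := (hsym ℓ₂ t₂ h₂ ht₂).2
  have e3 := congrArg Complex.im h
  rw [Complex.add_im, Complex.ofReal_im] at e3
  have e4 := add_pos e1 e2
  rw [← mul_add, e3, mul_zero] at e4
  exact lt_irrefl _ e4

theorem abs_symbol_le {p s t : ℝ} (hs : s ≠ 0) (ht : t ∈ Set.Icc (-1 : ℝ) 1) :
    -(2 * (1 / |s| + p / s)) ≤ 2 * (t - p) / s ∧ 2 * (t - p) / s ≤ 2 * (1 / |s| - p / s) := by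
  have h : |t / s| ≤ 1 / |s| := by
    rw [abs_div]
    gcongr
    exact abs_le.2 ht
  have e : 2 * (t - p) / s = 2 * (t / s) - 2 * (p / s) := by ring
  rw [abs_le] at h
  constructor <;> linarith

/-- At a real energy the symbol is affine in t₁ and t₂, so its values fill the interval between the
extremes over the square. -/
theorem mem_latticeSpectrum_iff {E : ℝ} {p s : ℝ → ℝ}
    (hF : IsFund E (fun x => (p x : ℂ)) (fun x => (s x : ℂ))) (hs₁ : s ℓ₁ ≠ 0) (hs₂ : s ℓ₂ ≠ 0) :
    (E : ℂ) ∈ latticeSpectrum ℓ₁ ℓ₂ h₁ h₂ c ↔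
      -(2 * (1 / |s ℓ₁| + p ℓ₁ / s ℓ₁)) - 2 * (1 / |s ℓ₂| + p ℓ₂ / s ℓ₂) ≤ c ∧
      c ≤ 2 * (1 / |s ℓ₁| - p ℓ₁ / s ℓ₁) + 2 * (1 / |s ℓ₂| - p ℓ₂ / s ℓ₂) := by
  have hs₁' : (s ℓ₁ : ℂ) ≠ 0 := Complex.ofReal_ne_zero.2 hs₁
  have hs₂' : (s ℓ₂ : ℂ) ≠ 0 := Complex.ofReal_ne_zero.2 hs₂
  constructor
  · intro h
    by_contra hc
    refine notMem_latticeSpectrum hF hs₁' hs₂' (fun t₁ ht₁ t₂ ht₂ he => hc ?_) h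
    have he' : 2 * (t₁ - p ℓ₁) / s ℓ₁ + 2 * (t₂ - p ℓ₂) / s ℓ₂ = c := by exact_mod_cast he
    have b1 := abs_symbol_le (p := p ℓ₁) hs₁ ht₁
    have b2 := abs_symbol_le (p := p ℓ₂) hs₂ ht₂
    constructor <;> linarith
  · rintro ⟨hc1, hc2⟩
    have a1 : 0 < |s ℓ₁| := abs_pos.2 hs₁
    have a2 : 0 < |s ℓ₂| := abs_pos.2 hs₂
    have hD : 0 < 1 / |s ℓ₁| + 1 / |s ℓ₂| := by positivity
    -- Setting each t to r times the sign of s reduces the search to a linear equation in r, whose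
    -- solution lies in [-1, 1] exactly under the two inequalities.
    let r : ℝ := (c / 2 + p ℓ₁ / s ℓ₁ + p ℓ₂ / s ℓ₂) / (1 / |s ℓ₁| + 1 / |s ℓ₂|)
    have hr : r * (1 / |s ℓ₁| + 1 / |s ℓ₂|) = c / 2 + p ℓ₁ / s ℓ₁ + p ℓ₂ / s ℓ₂ :=
      div_mul_cancel₀ _ hD.ne'
    have hr1 : |r| ≤ 1 := by
      simp only [r]
      rw [abs_div, abs_of_pos hD, div_le_one hD, abs_le]
      constructor <;> linarith
    have hsg : ∀ x : ℝ, x ≠ 0 → x / |x| * r ∈ Set.Icc (-1 : ℝ) 1 := fun x hx => by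
      rw [Set.mem_Icc, ← abs_le, abs_mul, abs_div, abs_abs, div_self (abs_ne_zero.2 hx), one_mul]
      exact hr1
    have hval : ∀ x q : ℝ, x ≠ 0 → 2 * (x / |x| * r - q) / x = 2 * (r * (1 / |x|)) - 2 * (q / x) :=
      fun x q hx => by
        have := abs_ne_zero.2 hx
        field_simp
    refine mem_latticeSpectrum hF hs₁' hs₂' (hsg _ hs₁) (hsg _ hs₂) ?_
    have : 2 * (s ℓ₁ / |s ℓ₁| * r - p ℓ₁) / s ℓ₁ + 2 * (s ℓ₂ / |s ℓ₂| * r - p ℓ₂) / s ℓ₂ = c := by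
      rw [hval _ _ hs₁, hval _ _ hs₂]
      linarith
    exact_mod_cast this

theorem notMem_kronigPenneySpectrum_of {E ℓ : ℝ} {h : 0 < ℓ} {p s : ℝ → ℝ}
    (hF : IsFund E (fun x => (p x : ℂ)) (fun x => (s x : ℂ))) (hs : s ℓ ≠ 0)
    (hc : c < -(2 * (1 / |s ℓ| + p ℓ / s ℓ)) ∨ 2 * (1 / |s ℓ| - p ℓ / s ℓ) < c) :
    (E : ℂ) ∉ kronigPenneySpectrum ℓ h c := by
  refine notMem_kronigPenneySpectrum h hF (Complex.ofReal_ne_zero.2 hs) fun t ht he => ?_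
  have he' : 2 * (t - p ℓ) / s ℓ = c := by exact_mod_cast he
  have b := abs_symbol_le (p := p ℓ) hs ht
  rcases hc with hc | hc <;> linarith

/-- Half-angle identities (1 ∓ cos 2y) / sin 2y = tan y, cot y. The sign (-1)^n from the shift by n
π cancels in the quotient and in the absolute value. -/
theorem trig_symbol {k ℓ y : ℝ} (hk : 0 < k) {n : ℕ} (hy : y ∈ Set.Ioo 0 (Real.pi / 2))
    (h : k * ℓ = 2 * y + n * Real.pi) :
    Real.sin (k * ℓ) / k ≠ 0 ∧
      2 * (1 / |Real.sin (k * ℓ) / k| - Real.cos (k * ℓ) / (Real.sin (k * ℓ) / k))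
        = 2 * k * Real.tan y ∧
      2 * (1 / |Real.sin (k * ℓ) / k| + Real.cos (k * ℓ) / (Real.sin (k * ℓ) / k))
        = 2 * k * (Real.tan y)⁻¹ := by
  have hs : 0 < Real.sin y := Real.sin_pos_of_pos_of_lt_pi hy.1 (by linarith [hy.2, Real.pi_pos])
  have hc : 0 < Real.cos y := Real.cos_pos_of_mem_Ioo ⟨by linarith [hy.1, Real.pi_pos], hy.2⟩
  rw [h, Real.sin_add_nat_mul_pi, Real.cos_add_nat_mul_pi, Real.sin_two_mul, abs_div, abs_mul,
    abs_pow, abs_neg, abs_one, one_pow, one_mul, abs_of_pos hk,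
    abs_of_pos (show 0 < 2 * Real.sin y * Real.cos y by positivity), Real.tan_eq_sin_div_cos]
  have hm : ((-1 : ℝ) ^ n) ≠ 0 := pow_ne_zero _ (by norm_num)
  refine ⟨by positivity, ?_, ?_⟩
  · rw [Real.cos_two_mul']
    field_simp
    linear_combination -Real.sin_sq_add_cos_sq y
  · rw [Real.cos_two_mul']
    field_simp
    linear_combination -Real.sin_sq_add_cos_sq y

theorem hyp_symbol {k ℓ : ℝ} (hk : 0 < k) (hℓ : 0 < ℓ) :
    Real.sinh (k * ℓ) / k ≠ 0 ∧
      2 * (1 / |Real.sinh (k * ℓ) / k| - Real.cosh (k * ℓ) / (Real.sinh (k * ℓ) / k))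
        = -(2 * k * Real.tanh (k * ℓ / 2)) ∧
      2 * (1 / |Real.sinh (k * ℓ) / k| + Real.cosh (k * ℓ) / (Real.sinh (k * ℓ) / k))
        = 2 * k * (Real.tanh (k * ℓ / 2))⁻¹ := by
  obtain ⟨y, hy⟩ : ∃ y, y = k * ℓ / 2 := ⟨_, rfl⟩
  have hy0 : 0 < y := by rw [hy]; positivity
  have hs : 0 < Real.sinh y := Real.sinh_pos_iff.2 hy0
  have hc : 0 < Real.cosh y := Real.cosh_pos y
  have e : k * ℓ = 2 * y := by rw [hy]; ring
  rw [← hy, e, Real.sinh_two_mul, abs_of_pos (by positivity), Real.tanh_eq_sinh_div_cosh,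
    Real.cosh_two_mul]
  refine ⟨by positivity, ?_, ?_⟩
  · field_simp
    linear_combination -Real.cosh_sq y
  · field_simp
    linear_combination -Real.cosh_sq y

end Criterion

/-! ### Merging touching intervals into bands -/

/-- A union of consecutive intervals, some of which may touch, has a band decomposition. -/
theorem exists_bandDecomposition {S : Set ℂ} {a b : ℕ → ℝ} (hab : ∀ i, a i < b i)
    (hba : ∀ i, b i ≤ a (i + 1)) (ha : Filter.Tendsto a Filter.atTop Filter.atTop)
    (hS : S = Complex.ofReal '' {x | ∃ i, a i ≤ x ∧ x ≤ b i}) :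
    ∃ (N : ℕ∞) (α : ℕ → ℝ) (β : ℕ → EReal), IsBandDecomposition S N α β ∧ α 1 = a 0 ∧
      (∀ r : ℕ, (r : ℕ∞) ≤ N → β r ≠ ⊤ → ((r + 1 : ℕ) : ℕ∞) ≤ N) ∧
      (∀ r : ℕ, 1 ≤ r → ((r + 1 : ℕ) : ℕ∞) ≤ N →
        ∃ i, r ≤ i + 1 ∧ b i < a (i + 1) ∧ β r = (b i : EReal) ∧ α (r + 1) = a (i + 1)) ∧
      (b 0 < a 1 → 2 ≤ N ∧ β 1 = (b 0 : EReal) ∧ α 2 = a 1) := by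
  classical
  have hamono : StrictMono a := strictMono_nat_of_lt_succ fun i => (hab i).trans_le (hba i)
  have hbmono : StrictMono b := strictMono_nat_of_lt_succ fun i => (hba i).trans_lt (hab (i + 1))
  -- The indices at which a new band starts; N counts them.
  let p : ℕ → Prop := fun i => i = 0 ∨ b (i - 1) < a i
  have hp0 : p 0 := Or.inl rfl
  let N : ℕ∞ := (Set.ofPred p).encard
  have hvalid : ∀ n : ℕ, ((n + 1 : ℕ) : ℕ∞) ≤ N ↔
      ∀ hf : (Set.ofPred p).Finite, n < hf.toFinset.card := by
    intro n
    refine ⟨fun h hf => ?_, fun h => ?_⟩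
    · simp only [N] at h
      rw [hf.encard_eq_coe_toFinset_card] at h
      exact_mod_cast h
    · by_cases hf : (Set.ofPred p).Finite
      · simp only [N]
        rw [hf.encard_eq_coe_toFinset_card]
        exact_mod_cast h hf
      · simp only [N]
        rw [Set.Infinite.encard_eq hf]
        exact le_top
  have hcount : ∀ n k : ℕ, n < Nat.count p k → ((n + 1 : ℕ) : ℕ∞) ≤ N := fun n k h =>
    (hvalid n).2 fun hf => h.trans_le (Nat.count_le_card hf k)
  have hmem : ∀ n : ℕ, 1 ≤ n → ((n + 1 : ℕ) : ℕ∞) ≤ N →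
      n ≤ Nat.nth p n ∧ b (Nat.nth p n - 1) < a (Nat.nth p n) := by
    intro n hn h
    have h1 := Nat.le_nth ((hvalid n).1 h)
    have h2 : p (Nat.nth p n) := Nat.nth_mem n ((hvalid n).1 h)
    exact ⟨h1, h2.resolve_left (by omega)⟩
  have hlt : ∀ m n : ℕ, m < n → ((n + 1 : ℕ) : ℕ∞) ≤ N → Nat.nth p m < Nat.nth p n :=
    fun m n hmn h => Nat.nth_lt_nth' hmn ((hvalid n).1 h)
  -- Bands are numbered from 1 and starts from 0, so band r begins at start number r - 1 and ends
  -- just before start number r, or at infinity if there is no such start.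
  let α : ℕ → ℝ := fun r => a (Nat.nth p (r - 1))
  let β : ℕ → EReal := fun r =>
    if ((r + 1 : ℕ) : ℕ∞) ≤ N then ((b (Nat.nth p r - 1) : ℝ) : EReal) else ⊤
  have hβ : ∀ r : ℕ, ((r + 1 : ℕ) : ℕ∞) ≤ N → β r = ((b (Nat.nth p r - 1) : ℝ) : EReal) :=
    fun r h => if_pos h
  have hα1 : α 1 = a 0 := by
    simp only [α]
    rw [Nat.sub_self, Nat.nth_zero_of_zero hp0]
  refine ⟨N, α, β, ⟨?_, ?_, fun r hr hrN => ?_, fun r hr hrN => ?_⟩, hα1, fun r _ hr => ?_,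
    fun r hr hrN => ?_, fun h01 => ?_⟩
  · have := hcount 0 1 (by rw [Nat.count_succ, if_pos hp0]; simp)
    simpa using this
  · rw [hS]
    congr 1
    ext x
    constructor
    · rintro ⟨i, hi1, hi2⟩
      have hr1 : 1 ≤ Nat.count p (i + 1) := by
        have := Nat.count_monotone p (show 1 ≤ i + 1 by omega)
        rw [Nat.count_succ, if_pos hp0] at this
        omega
      refine ⟨Nat.count p (i + 1), hr1, ?_, ?_, ?_⟩
      · have := hcount (Nat.count p (i + 1) - 1) (i + 1) (by omega)
        rwa [Nat.sub_add_cancel hr1] at this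
      · have h1 : Nat.nth p (Nat.count p (i + 1) - 1) < i + 1 := Nat.nth_lt_of_lt_count (by omega)
        exact_mod_cast (hamono.monotone (Nat.lt_succ_iff.1 h1)).trans hi1
      · by_cases hv : ((Nat.count p (i + 1) + 1 : ℕ) : ℕ∞) ≤ N
        · rw [hβ _ hv]
          have h1 : i + 1 ≤ Nat.nth p (Nat.count p (i + 1)) := by
            by_contra hcon
            have h2 := Nat.count_nth_succ ((hvalid _).1 hv)
            have h3 := Nat.count_monotone p
              (show Nat.nth p (Nat.count p (i + 1)) + 1 ≤ i + 1 by omega)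
            omega
          exact_mod_cast hi2.trans (hbmono.monotone (by omega))
        · simp only [β]
          rw [if_neg hv]
          exact le_top
    · rintro ⟨r, hr, hrN, h1, h2⟩
      have h1' : a (Nat.nth p (r - 1)) ≤ x := by exact_mod_cast h1
      -- Let i be the last index with a i ≤ x. If x were beyond b i, a new band would start at i +
      -- 1, and band r would have ended at b i or earlier.
      have hex : ∃ i, x < a i := (ha.eventually_gt_atTop x).exists
      have hi0 : x < a (Nat.find hex) := Nat.find_spec hex
      have hne : Nat.find hex ≠ 0 := by
        intro h
        rw [h] at hi0
        exact absurd (hamono.monotone (Nat.zero_le _)) (not_le.2 (h1'.trans_lt hi0))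
      obtain ⟨i, hi⟩ := Nat.exists_eq_succ_of_ne_zero hne
      have hai : a i ≤ x := not_lt.1 (Nat.find_min hex (by omega))
      rw [hi] at hi0
      refine ⟨i, hai, not_lt.1 fun hbi => ?_⟩
      have hpi : p (i + 1) := Or.inr (hbi.trans hi0)
      have hnm : Nat.nth p (Nat.count p (i + 1)) = i + 1 := Nat.nth_count hpi
      have hvm : ((Nat.count p (i + 1) + 1 : ℕ) : ℕ∞) ≤ N :=
        hcount _ (i + 2) (by rw [Nat.count_succ p (i + 1), if_pos hpi]; omega)
      have hji : Nat.nth p (r - 1) < i + 1 := hamono.lt_iff_lt.1 (h1'.trans_lt hi0)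
      have hrm : r ≤ Nat.count p (i + 1) := by
        by_contra hcon
        have h3 : ((r - 1 + 1 : ℕ) : ℕ∞) ≤ N := by rwa [Nat.sub_add_cancel hr]
        have := Nat.nth_le_nth' (show Nat.count p (i + 1) ≤ r - 1 by omega) ((hvalid _).1 h3)
        omega
      have hvr : ((r + 1 : ℕ) : ℕ∞) ≤ N := le_trans (by exact_mod_cast Nat.succ_le_succ hrm) hvm
      rw [hβ r hvr] at h2
      have h2' : x ≤ b (Nat.nth p r - 1) := by exact_mod_cast h2
      have h3 := Nat.nth_le_nth' hrm ((hvalid _).1 hvm)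
      have h4 := hbmono.monotone (show Nat.nth p r - 1 ≤ i by omega)
      linarith
  · by_cases hv : ((r + 1 : ℕ) : ℕ∞) ≤ N
    · rw [hβ r hv]
      have h1 := hlt (r - 1) r (by omega) hv
      exact_mod_cast (hamono.monotone (show Nat.nth p (r - 1) ≤ Nat.nth p r - 1 by omega)).trans_lt
        (hab _)
    · simp only [β]
      rw [if_neg hv]
      exact EReal.coe_lt_top _
  · rw [hβ r hrN]
    simp only [α, Nat.add_sub_cancel]
    exact_mod_cast (hmem r hr hrN).2
  · by_contra hv
    exact hr (if_neg hv)
  · obtain ⟨h1, h2⟩ := hmem r hr hrN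
    have h3 : Nat.nth p r - 1 + 1 = Nat.nth p r := by omega
    refine ⟨Nat.nth p r - 1, by omega, by rwa [h3], hβ r hrN, ?_⟩
    simp only [α, Nat.add_sub_cancel]
    rw [h3]
  · have hp1 : p 1 := Or.inr h01
    have hc1 : Nat.count p 1 = 1 := by rw [Nat.count_succ, if_pos hp0]; simp
    have hn1 : Nat.nth p 1 = 1 := by
      have := Nat.nth_count hp1
      rwa [hc1] at this
    have hv : ((1 + 1 : ℕ) : ℕ∞) ≤ N :=
      hcount 1 2 (by rw [Nat.count_succ p 1, if_pos hp1, hc1]; omega)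
    refine ⟨by exact_mod_cast hv, ?_, ?_⟩
    · rw [hβ 1 hv, hn1]
    · simp only [α]
      rw [show 2 - 1 = 1 from rfl, hn1]

/-! ### Inequalities for tan, cot, tanh and coth -/

section Monotonicity

theorem mul_sin_le_mul_sin {d s : ℝ} (hd : 0 ≤ d) (hds : d ≤ s) (hs : s ≤ Real.pi) :
    d * Real.sin s ≤ s * Real.sin d := by
  rcases hd.eq_or_lt with rfl | hd'
  · simp
  have hs0 : 0 < s := hd'.trans_le hds
  have h := strictConcaveOn_sin_Icc.concaveOn.2
    (show (0 : ℝ) ∈ Set.Icc 0 Real.pi from ⟨le_rfl, Real.pi_pos.le⟩)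
    (show s ∈ Set.Icc 0 Real.pi from ⟨hs0.le, hs⟩)
    (show 0 ≤ 1 - d / s by rw [sub_nonneg, div_le_one hs0]; exact hds)
    (show 0 ≤ d / s by positivity) (by ring)
  simp only [smul_eq_mul, mul_zero, zero_add, Real.sin_zero] at h
  rw [div_mul_cancel₀ _ hs0.ne', div_mul_eq_mul_div, div_le_iff₀ hs0] at h
  linarith

theorem convexOn_sinh : ConvexOn ℝ (Set.Ici 0) Real.sinh := by
  refine MonotoneOn.convexOn_of_deriv (convex_Ici 0) Real.continuous_sinh.continuousOn
    Real.differentiable_sinh.differentiableOn ?_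
  rw [interior_Ici, Real.deriv_sinh]
  intro x hx y hy hxy
  rw [Real.cosh_le_cosh, abs_of_pos hx, abs_of_pos hy]
  exact hxy

theorem mul_sinh_le_mul_sinh {d s : ℝ} (hd : 0 ≤ d) (hds : d ≤ s) :
    s * Real.sinh d ≤ d * Real.sinh s := by
  rcases hd.eq_or_lt with rfl | hd'
  · simp
  have hs0 : 0 < s := hd'.trans_le hds
  have h := convexOn_sinh.2 (show (0 : ℝ) ∈ Set.Ici 0 from Set.mem_Ici.2 le_rfl)
    (show s ∈ Set.Ici (0 : ℝ) from Set.mem_Ici.2 hs0.le)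
    (show 0 ≤ 1 - d / s by rw [sub_nonneg, div_le_one hs0]; exact hds)
    (show 0 ≤ d / s by positivity) (by ring)
  simp only [smul_eq_mul, mul_zero, zero_add, Real.sinh_zero] at h
  rw [div_mul_cancel₀ _ hs0.ne', div_mul_eq_mul_div, le_div_iff₀ hs0] at h
  linarith

theorem tan_le_tan {x y : ℝ} (hx : 0 < x) (hxy : x ≤ y) (hy : y < Real.pi / 2) :
    Real.tan x ≤ Real.tan y :=
  Real.strictMonoOn_tan.monotoneOn ⟨by linarith [Real.pi_pos], hxy.trans_lt hy⟩
    ⟨by linarith [Real.pi_pos], hy⟩ hxy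

theorem tan_pos {x : ℝ} (hx : x ∈ Set.Ioo 0 (Real.pi / 2)) : 0 < Real.tan x :=
  Real.tan_pos_of_pos_of_lt_pi_div_two hx.1 hx.2

/-- By the addition formulas the claim is (y - x) sin (y + x) ≤ (y + x) sin (y - x), an instance of
sin s / s being decreasing. -/
theorem div_tan_antitone {x y : ℝ} (hx : 0 < x) (hxy : x ≤ y) (hy : y < Real.pi / 2) :
    y * (Real.tan y)⁻¹ ≤ x * (Real.tan x)⁻¹ := by
  have hp := Real.pi_pos
  have sx := Real.sin_pos_of_pos_of_lt_pi hx (by linarith)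
  have sy := Real.sin_pos_of_pos_of_lt_pi (hx.trans_le hxy) (by linarith)
  have cx := Real.cos_pos_of_mem_Ioo (x := x) ⟨by linarith, by linarith⟩
  have cy := Real.cos_pos_of_mem_Ioo (x := y) ⟨by linarith, by linarith⟩
  have h := mul_sin_le_mul_sin (d := y - x) (s := y + x) (by linarith) (by linarith) (by linarith)
  rw [Real.sin_add, Real.sin_sub] at h
  rw [Real.tan_eq_sin_div_cos, Real.tan_eq_sin_div_cos, inv_div, inv_div, ← mul_div_assoc,
    ← mul_div_assoc, div_le_div_iff₀ sy sx]
  linarith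

theorem mul_inv_tan_le_one {x : ℝ} (hx : x ∈ Set.Ioo 0 (Real.pi / 2)) :
    x * (Real.tan x)⁻¹ ≤ 1 := by
  rw [← div_eq_mul_inv, div_le_one (tan_pos hx)]
  exact (Real.lt_tan hx.1 hx.2).le

/-- cot x = tan (π/2 - x), and the tangent dominates its argument. -/
theorem inv_tan_ge {x : ℝ} (hx : x ∈ Set.Ioo 0 (Real.pi / 2)) :
    Real.pi / 2 - x ≤ (Real.tan x)⁻¹ := by
  rw [← Real.tan_pi_div_two_sub]
  exact Real.le_tan (by linarith [hx.2]) (by linarith [hx.1])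

theorem tanh_pos {x : ℝ} (hx : 0 < x) : 0 < Real.tanh x := by
  rw [Real.tanh_eq_sinh_div_cosh]
  exact div_pos (Real.sinh_pos_iff.2 hx) (Real.cosh_pos x)

theorem tanh_strictMono : StrictMono Real.tanh := by
  intro x y hxy
  rw [Real.tanh_eq_sinh_div_cosh, Real.tanh_eq_sinh_div_cosh,
    div_lt_div_iff₀ (Real.cosh_pos x) (Real.cosh_pos y)]
  have h := Real.sinh_pos_iff.2 (sub_pos.2 hxy)
  rw [Real.sinh_sub] at h
  linarith

theorem tanh_lt_one' (x : ℝ) : Real.tanh x < 1 := by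
  rw [Real.tanh_eq_sinh_div_cosh, div_lt_one (Real.cosh_pos x)]
  exact Real.sinh_lt_cosh x

theorem continuous_tanh' : Continuous Real.tanh := by
  have : Real.tanh = fun x => Real.sinh x / Real.cosh x := funext Real.tanh_eq_sinh_div_cosh
  rw [this]
  exact Real.continuous_sinh.div Real.continuous_cosh fun x => (Real.cosh_pos x).ne'

theorem one_le_mul_inv_tanh {x : ℝ} (hx : 0 < x) : 1 ≤ x * (Real.tanh x)⁻¹ := by
  rw [← div_eq_mul_inv, one_le_div (tanh_pos hx), Real.tanh_eq_sinh_div_cosh,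
    div_le_iff₀ (Real.cosh_pos x)]
  have hd : ∀ y, HasDerivAt (fun y => y * Real.cosh y - Real.sinh y) (y * Real.sinh y) y := fun y =>
    (((hasDerivAt_id y).mul (Real.hasDerivAt_cosh y)).sub (Real.hasDerivAt_sinh y)).congr_deriv
      (by simp)
  have hm : MonotoneOn (fun y => y * Real.cosh y - Real.sinh y) (Set.Ici 0) := by
    refine monotoneOn_of_deriv_nonneg (convex_Ici 0)
      (fun y _ => (hd y).continuousAt.continuousWithinAt)
      (fun y _ => (hd y).differentiableAt.differentiableWithinAt) fun y hy => ?_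
    rw [interior_Ici] at hy
    rw [(hd y).deriv]
    exact mul_nonneg (le_of_lt hy) (Real.sinh_nonneg_iff.2 (le_of_lt hy))
  have h := hm (Set.mem_Ici.2 le_rfl) (Set.mem_Ici.2 hx.le) hx.le
  simp only [zero_mul, Real.sinh_zero, sub_zero] at h
  linarith

theorem mul_inv_tanh_mono {x y : ℝ} (hx : 0 < x) (hxy : x ≤ y) :
    x * (Real.tanh x)⁻¹ ≤ y * (Real.tanh y)⁻¹ := by
  have sx := Real.sinh_pos_iff.2 hx
  have sy := Real.sinh_pos_iff.2 (hx.trans_le hxy)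
  have h := mul_sinh_le_mul_sinh (d := y - x) (s := y + x) (by linarith) (by linarith)
  rw [Real.sinh_add, Real.sinh_sub] at h
  rw [Real.tanh_eq_sinh_div_cosh, Real.tanh_eq_sinh_div_cosh, inv_div, inv_div, ← mul_div_assoc,
    ← mul_div_assoc, div_le_div_iff₀ sx sy]
  linarith

end Monotonicity

/-! ### The criterion at positive, zero and negative energy -/

section Regimes

variable {ℓ₁ ℓ₂ : ℝ} {h₁ : 0 < ℓ₁} {h₂ : 0 < ℓ₂} {c : ℝ}

theorem sq_mem_latticeSpectrum_iff {k y₁ y₂ : ℝ} {n₁ n₂ : ℕ} (hk : 0 < k)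
    (hy₁ : y₁ ∈ Set.Ioo 0 (Real.pi / 2)) (hy₂ : y₂ ∈ Set.Ioo 0 (Real.pi / 2))
    (e₁ : k * ℓ₁ = 2 * y₁ + n₁ * Real.pi) (e₂ : k * ℓ₂ = 2 * y₂ + n₂ * Real.pi) :
    ((k ^ 2 : ℝ) : ℂ) ∈ latticeSpectrum ℓ₁ ℓ₂ h₁ h₂ c ↔
      -(2 * k * ((Real.tan y₁)⁻¹ + (Real.tan y₂)⁻¹)) ≤ c ∧
        c ≤ 2 * k * (Real.tan y₁ + Real.tan y₂) := by
  obtain ⟨a1, a2, a3⟩ := trig_symbol hk hy₁ e₁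
  obtain ⟨b1, b2, b3⟩ := trig_symbol hk hy₂ e₂
  rw [mem_latticeSpectrum_iff (isFund_trig hk.ne') a1 b1, a2, a3, b2, b3]
  ring_nf

theorem zero_mem_latticeSpectrum_iff :
    ((0 : ℝ) : ℂ) ∈ latticeSpectrum ℓ₁ ℓ₂ h₁ h₂ c ↔ -(4 / ℓ₁ + 4 / ℓ₂) ≤ c ∧ c ≤ 0 := by
  rw [mem_latticeSpectrum_iff (p := fun _ => 1) (s := fun x => x) isFund_free h₁.ne' h₂.ne',
    abs_of_pos h₁, abs_of_pos h₂]
  ring_nf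

theorem neg_sq_mem_latticeSpectrum_iff {k : ℝ} (hk : 0 < k) :
    ((-k ^ 2 : ℝ) : ℂ) ∈ latticeSpectrum ℓ₁ ℓ₂ h₁ h₂ c ↔
      -(2 * k * ((Real.tanh (k * ℓ₁ / 2))⁻¹ + (Real.tanh (k * ℓ₂ / 2))⁻¹)) ≤ c ∧
        c ≤ -(2 * k * (Real.tanh (k * ℓ₁ / 2) + Real.tanh (k * ℓ₂ / 2))) := by
  obtain ⟨a1, a2, a3⟩ := hyp_symbol hk h₁
  obtain ⟨b1, b2, b3⟩ := hyp_symbol hk h₂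
  rw [mem_latticeSpectrum_iff (isFund_hyp hk.ne') a1 b1, a2, a3, b2, b3]
  ring_nf

theorem sq_notMem_kronigPenneySpectrum {k y ℓ : ℝ} {h : 0 < ℓ} {n : ℕ} (hk : 0 < k)
    (hy : y ∈ Set.Ioo 0 (Real.pi / 2)) (e : k * ℓ = 2 * y + n * Real.pi)
    (hc : c < -(2 * k * (Real.tan y)⁻¹) ∨ 2 * k * Real.tan y < c) :
    ((k ^ 2 : ℝ) : ℂ) ∉ kronigPenneySpectrum ℓ h c := by
  obtain ⟨a1, a2, a3⟩ := trig_symbol hk hy e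
  refine notMem_kronigPenneySpectrum_of (isFund_trig hk.ne') a1 ?_
  rw [a2, a3]
  exact hc

theorem zero_notMem_kronigPenneySpectrum {ℓ : ℝ} {h : 0 < ℓ} (hc : c < -(4 / ℓ) ∨ 0 < c) :
    ((0 : ℝ) : ℂ) ∉ kronigPenneySpectrum ℓ h c := by
  refine notMem_kronigPenneySpectrum_of (p := fun _ => 1) (s := fun x => x) isFund_free h.ne' ?_
  rw [abs_of_pos h]
  refine hc.imp (fun hc => ?_) fun hc => ?_
  · convert hc using 2
    ring
  · convert hc using 1
    ring

theorem neg_sq_notMem_kronigPenneySpectrum {k ℓ : ℝ} {h : 0 < ℓ} (hk : 0 < k)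
    (hc : c < -(2 * k * (Real.tanh (k * ℓ / 2))⁻¹) ∨ -(2 * k * Real.tanh (k * ℓ / 2)) < c) :
    ((-k ^ 2 : ℝ) : ℂ) ∉ kronigPenneySpectrum ℓ h c := by
  obtain ⟨a1, a2, a3⟩ := hyp_symbol hk h
  refine notMem_kronigPenneySpectrum_of (isFund_hyp hk.ne') a1 ?_
  rw [a2, a3]
  exact hc

end Regimes

/-! ### Enumeration of the Dirichlet wave numbers -/

section ZeroSeq

/-- The increasing enumeration of `0` and the numbers `π n / ℓ₁` and `π n / ℓ₂`, `n ≥ 1`. -/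
noncomputable def zeroSeq (ℓ₁ ℓ₂ : ℝ) : ℕ → ℝ
  | 0 => 0
  | i + 1 => min ((⌊zeroSeq ℓ₁ ℓ₂ i * ℓ₁ / Real.pi⌋₊ + 1) * Real.pi / ℓ₁)
      ((⌊zeroSeq ℓ₁ ℓ₂ i * ℓ₂ / Real.pi⌋₊ + 1) * Real.pi / ℓ₂)

/-- The number of positive multiples of `π / ℓ` up to the `i`-th term of `zeroSeq`. -/
noncomputable def zeroIdx (ℓ₁ ℓ₂ ℓ : ℝ) (i : ℕ) : ℕ := ⌊zeroSeq ℓ₁ ℓ₂ i * ℓ / Real.pi⌋₊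

variable {ℓ₁ ℓ₂ : ℝ} (h₁ : 0 < ℓ₁) (h₂ : 0 < ℓ₂)
include h₁ h₂

theorem zeroSeq_nonneg (i : ℕ) : 0 ≤ zeroSeq ℓ₁ ℓ₂ i := by
  cases i with
  | zero => exact le_rfl
  | succ i =>
    rw [zeroSeq]
    have := Real.pi_pos
    exact le_min (by positivity) (by positivity)

theorem zeroIdx_mul_pi_le {ℓ : ℝ} (h : 0 < ℓ) (i : ℕ) :
    zeroIdx ℓ₁ ℓ₂ ℓ i * Real.pi ≤ zeroSeq ℓ₁ ℓ₂ i * ℓ := by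
  have := Real.pi_pos
  have h0 := zeroSeq_nonneg h₁ h₂ i
  rw [← le_div_iff₀ this]
  exact Nat.floor_le (by positivity)

omit h₁ h₂ in
theorem lt_zeroIdx_add_one {ℓ : ℝ} (i : ℕ) :
    zeroSeq ℓ₁ ℓ₂ i * ℓ < (zeroIdx ℓ₁ ℓ₂ ℓ i + 1) * Real.pi := by
  rw [← div_lt_iff₀ Real.pi_pos]
  exact Nat.lt_floor_add_one _

theorem zeroSeq_lt (i : ℕ) : zeroSeq ℓ₁ ℓ₂ i < zeroSeq ℓ₁ ℓ₂ (i + 1) := by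
  conv_rhs => rw [zeroSeq]
  exact lt_min ((lt_div_iff₀ h₁).2 (lt_zeroIdx_add_one i)) ((lt_div_iff₀ h₂).2 (lt_zeroIdx_add_one i))

omit h₂ in
theorem zeroSeq_succ_mul_le₁ (i : ℕ) :
    zeroSeq ℓ₁ ℓ₂ (i + 1) * ℓ₁ ≤ (zeroIdx ℓ₁ ℓ₂ ℓ₁ i + 1) * Real.pi := by
  rw [← le_div_iff₀ h₁, zeroSeq]
  exact min_le_left _ _

omit h₁ in
theorem zeroSeq_succ_mul_le₂ (i : ℕ) :
    zeroSeq ℓ₁ ℓ₂ (i + 1) * ℓ₂ ≤ (zeroIdx ℓ₁ ℓ₂ ℓ₂ i + 1) * Real.pi := by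
  rw [← le_div_iff₀ h₂, zeroSeq]
  exact min_le_right _ _

theorem zeroSeq_succ_mul_eq (i : ℕ) :
    zeroSeq ℓ₁ ℓ₂ (i + 1) * ℓ₁ = (zeroIdx ℓ₁ ℓ₂ ℓ₁ i + 1) * Real.pi ∨
    zeroSeq ℓ₁ ℓ₂ (i + 1) * ℓ₂ = (zeroIdx ℓ₁ ℓ₂ ℓ₂ i + 1) * Real.pi := by
  rw [← eq_div_iff h₁.ne', ← eq_div_iff h₂.ne', zeroSeq]
  exact min_choice _ _

omit h₁ h₂ in
theorem zeroIdx_eq_of_mul_eq {ℓ : ℝ} {i m : ℕ} (h : zeroSeq ℓ₁ ℓ₂ i * ℓ = m * Real.pi) :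
    zeroIdx ℓ₁ ℓ₂ ℓ i = m := by
  rw [zeroIdx, h, mul_div_assoc, div_self Real.pi_ne_zero, mul_one, Nat.floor_natCast]

theorem zeroIdx_le_succ {ℓ : ℝ} (h : 0 < ℓ) (i : ℕ) :
    zeroIdx ℓ₁ ℓ₂ ℓ i ≤ zeroIdx ℓ₁ ℓ₂ ℓ (i + 1) := by
  refine Nat.floor_le_floor ?_
  have := (zeroSeq_lt h₁ h₂ i).le
  have := Real.pi_pos
  gcongr

/-- Every step passes a multiple of π / ℓ₁ or of π / ℓ₂, so at least one of the two counters goes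
up. The resulting linear growth of `zeroSeq` is what makes the error in the gap estimate of order 1
/ r. -/
theorem le_zeroIdx_add (i : ℕ) : i ≤ zeroIdx ℓ₁ ℓ₂ ℓ₁ i + zeroIdx ℓ₁ ℓ₂ ℓ₂ i := by
  induction i with
  | zero => exact Nat.zero_le _
  | succ i ih =>
    have m1 := zeroIdx_le_succ h₁ h₂ h₁ i
    have m2 := zeroIdx_le_succ h₁ h₂ h₂ i
    rcases zeroSeq_succ_mul_eq h₁ h₂ i with h | h
    · have := zeroIdx_eq_of_mul_eq (m := zeroIdx ℓ₁ ℓ₂ ℓ₁ i + 1) (by rw [h]; push_cast; ring)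
      omega
    · have := zeroIdx_eq_of_mul_eq (m := zeroIdx ℓ₁ ℓ₂ ℓ₂ i + 1) (by rw [h]; push_cast; ring)
      omega

theorem mul_pi_le_zeroSeq_mul (i : ℕ) : i * Real.pi ≤ zeroSeq ℓ₁ ℓ₂ i * (ℓ₁ + ℓ₂) := by
  have e1 := zeroIdx_mul_pi_le h₁ h₂ h₁ i
  have e2 := zeroIdx_mul_pi_le h₁ h₂ h₂ i
  have e3 : (i : ℝ) ≤ zeroIdx ℓ₁ ℓ₂ ℓ₁ i + zeroIdx ℓ₁ ℓ₂ ℓ₂ i := by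
    exact_mod_cast le_zeroIdx_add h₁ h₂ i
  nlinarith [Real.pi_pos]

theorem zeroSeq_one : zeroSeq ℓ₁ ℓ₂ 1 = Real.pi / max ℓ₁ ℓ₂ := by
  have h : zeroSeq ℓ₁ ℓ₂ 1 = min (Real.pi / ℓ₁) (Real.pi / ℓ₂) := by
    rw [zeroSeq, zeroSeq]
    simp
  rw [h]
  rcases le_total ℓ₁ ℓ₂ with hl | hl
  · rw [max_eq_right hl, min_eq_right]
    exact div_le_div_of_nonneg_left Real.pi_pos.le h₁ hl
  · rw [max_eq_left hl, min_eq_left]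
    exact div_le_div_of_nonneg_left Real.pi_pos.le h₂ hl

theorem zeroSeq_pos (i : ℕ) : 0 < zeroSeq ℓ₁ ℓ₂ (i + 1) :=
  (zeroSeq_nonneg h₁ h₂ i).trans_lt (zeroSeq_lt h₁ h₂ i)

theorem tendsto_zeroSeq : Filter.Tendsto (zeroSeq ℓ₁ ℓ₂) Filter.atTop Filter.atTop := by
  have h : Filter.Tendsto (fun i : ℕ => (i : ℝ) * (Real.pi / (ℓ₁ + ℓ₂))) Filter.atTop
      Filter.atTop :=
    tendsto_natCast_atTop_atTop.atTop_mul_const (by have := Real.pi_pos; positivity)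
  refine Filter.tendsto_atTop_mono (fun i => ?_) h
  rw [← mul_div_assoc, div_le_iff₀ (by positivity)]
  exact mul_pi_le_zeroSeq_mul h₁ h₂ i

theorem exists_zeroSeq_sq_eq (i : ℕ) : ∃ (n : ℤ) (lam : ℝ), (lam = ℓ₁ ∨ lam = ℓ₂) ∧
    zeroSeq ℓ₁ ℓ₂ (i + 1) ^ 2 = (Real.pi * n / lam) ^ 2 := by
  rcases zeroSeq_succ_mul_eq h₁ h₂ i with h | h
  · refine ⟨(zeroIdx ℓ₁ ℓ₂ ℓ₁ i + 1 : ℕ), ℓ₁, Or.inl rfl, ?_⟩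
    congr 1
    rw [eq_div_iff h₁.ne', h]
    push_cast
    ring
  · refine ⟨(zeroIdx ℓ₁ ℓ₂ ℓ₂ i + 1 : ℕ), ℓ₂, Or.inr rfl, ?_⟩
    congr 1
    rw [eq_div_iff h₂.ne', h]
    push_cast
    ring

end ZeroSeq

/-! ### The spectrum inside one cell -/

/-- The real numbers in the lattice spectrum. -/
def realSpectrum (ℓ₁ ℓ₂ : ℝ) (h₁ : 0 < ℓ₁) (h₂ : 0 < ℓ₂) (c : ℝ) : Set ℝ :=
  {E | (E : ℂ) ∈ latticeSpectrum ℓ₁ ℓ₂ h₁ h₂ c}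

/-- The phase of `sin (k ℓ)`, halved, relative to the last zero before the `i`-th cell. -/
noncomputable def cellAngle (ℓ₁ ℓ₂ ℓ : ℝ) (i : ℕ) (k : ℝ) : ℝ :=
  (k * ℓ - zeroIdx ℓ₁ ℓ₂ ℓ i * Real.pi) / 2

/-- The largest coupling constant for which `k ^ 2`, with `k` in the `i`-th cell, is in the
spectrum. -/
noncomputable def cellUpper (ℓ₁ ℓ₂ : ℝ) (i : ℕ) (k : ℝ) : ℝ :=
  2 * k * (Real.tan (cellAngle ℓ₁ ℓ₂ ℓ₁ i k) + Real.tan (cellAngle ℓ₁ ℓ₂ ℓ₂ i k))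

/-- Minus the smallest coupling constant for which `k ^ 2`, with `k` in the `i`-th cell, is in the
spectrum. -/
noncomputable def cellLower (ℓ₁ ℓ₂ : ℝ) (i : ℕ) (k : ℝ) : ℝ :=
  2 * k * ((Real.tan (cellAngle ℓ₁ ℓ₂ ℓ₁ i k))⁻¹ + (Real.tan (cellAngle ℓ₁ ℓ₂ ℓ₂ i k))⁻¹)

section OneSided

variable {X : Set ℝ} {lo hi : ℝ}

/-- An upward closed subset of the open cell is an interval from its infimum on; closedness of X
adds both endpoints, in particular the Dirichlet energy `hi`, to which the symbol criterion does not
apply. -/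
theorem exists_up_cell (hX : IsClosed X)
    (hup : ∀ E ∈ Set.Ioo lo hi, E ∈ X → ∀ E' ∈ Set.Ioo lo hi, E ≤ E' → E' ∈ X)
    (hne : ∃ E ∈ Set.Ioo lo hi, E ∈ X) :
    ∃ a, lo ≤ a ∧ a < hi ∧ Set.Icc a hi ⊆ X ∧ ∀ E ∈ Set.Ioo lo hi, E ∈ X → a ≤ E := by
  obtain ⟨E₀, hE₀, hE₀X⟩ := hne
  let S := Set.Ioo lo hi ∩ X
  have hbdd : BddBelow S := ⟨lo, fun E hE => hE.1.1.le⟩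
  have hlt : sInf S < hi := (csInf_le hbdd ⟨hE₀, hE₀X⟩).trans_lt hE₀.2
  have hlo : lo ≤ sInf S := le_csInf ⟨E₀, hE₀, hE₀X⟩ fun E hE => hE.1.1.le
  refine ⟨sInf S, hlo, hlt, ?_, fun E hE hEX => csInf_le hbdd ⟨hE, hEX⟩⟩
  rw [← closure_Ioo hlt.ne, hX.closure_subset_iff]
  intro E hE
  obtain ⟨E₁, hE₁, hlt₁⟩ := exists_lt_of_csInf_lt (show S.Nonempty from ⟨E₀, hE₀, hE₀X⟩) hE.1
  exact hup E₁ hE₁.1 hE₁.2 E ⟨hlo.trans_lt hE.1, hE.2⟩ hlt₁.le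

theorem exists_down_cell (hX : IsClosed X)
    (hdn : ∀ E ∈ Set.Ioo lo hi, E ∈ X → ∀ E' ∈ Set.Ioo lo hi, E' ≤ E → E' ∈ X)
    (hne : ∃ E ∈ Set.Ioo lo hi, E ∈ X) :
    ∃ b, lo < b ∧ b ≤ hi ∧ Set.Icc lo b ⊆ X ∧ ∀ E ∈ Set.Ioo lo hi, E ∈ X → E ≤ b := by
  obtain ⟨E₀, hE₀, hE₀X⟩ := hne
  let S := Set.Ioo lo hi ∩ X
  have hbdd : BddAbove S := ⟨hi, fun E hE => hE.1.2.le⟩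
  have hlt : lo < sSup S := hE₀.1.trans_le (le_csSup hbdd ⟨hE₀, hE₀X⟩)
  have hlo : sSup S ≤ hi := csSup_le ⟨E₀, hE₀, hE₀X⟩ fun E hE => hE.1.2.le
  refine ⟨sSup S, hlt, hlo, ?_, fun E hE hEX => le_csSup hbdd ⟨hE, hEX⟩⟩
  rw [← closure_Ioo hlt.ne, hX.closure_subset_iff]
  intro E hE
  obtain ⟨E₁, hE₁, hlt₁⟩ := exists_lt_of_lt_csSup (show S.Nonempty from ⟨E₀, hE₀, hE₀X⟩) hE.2
  exact hdn E₁ hE₁.1 hE₁.2 E ⟨hE.1, hE.2.trans_le hlo⟩ hlt₁.le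

end OneSided

section Cells

variable {ℓ₁ ℓ₂ : ℝ} {h₁ : 0 < ℓ₁} {h₂ : 0 < ℓ₂} {c : ℝ}

theorem isClosed_realSpectrum : IsClosed (realSpectrum ℓ₁ ℓ₂ h₁ h₂ c) :=
  isClosed_latticeSpectrum.preimage Complex.continuous_ofReal

theorem latticeSpectrum_eq :
    latticeSpectrum ℓ₁ ℓ₂ h₁ h₂ c = Complex.ofReal '' realSpectrum ℓ₁ ℓ₂ h₁ h₂ c := by
  ext z
  refine ⟨fun hz => ?_, ?_⟩
  · have him := im_eq_zero_of_mem_latticeSpectrum hz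
    have e : (z.re : ℂ) = z := Complex.ext rfl him.symm
    refine ⟨z.re, ?_, e⟩
    change (z.re : ℂ) ∈ latticeSpectrum ℓ₁ ℓ₂ h₁ h₂ c
    rwa [e]
  · rintro ⟨E, hE, rfl⟩
    exact hE

theorem exists_sqrt {i : ℕ} (h₁ : 0 < ℓ₁) (h₂ : 0 < ℓ₂) {E : ℝ}
    (hE : E ∈ Set.Ioo (zeroSeq ℓ₁ ℓ₂ i ^ 2) (zeroSeq ℓ₁ ℓ₂ (i + 1) ^ 2)) :
    ∃ k ∈ Set.Ioo (zeroSeq ℓ₁ ℓ₂ i) (zeroSeq ℓ₁ ℓ₂ (i + 1)), E = k ^ 2 := by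
  have h0 := zeroSeq_nonneg h₁ h₂ i
  have h0' := zeroSeq_nonneg h₁ h₂ (i + 1)
  have hE0 : 0 ≤ E := (sq_nonneg _).trans hE.1.le
  refine ⟨√E, ⟨Real.lt_sqrt_of_sq_lt hE.1, (Real.sqrt_lt' (zeroSeq_pos h₁ h₂ i)).2 hE.2⟩,
    (Real.sq_sqrt hE0).symm⟩

theorem sq_mem_Ioo {a b k : ℝ} (ha : 0 ≤ a) (hk : k ∈ Set.Ioo a b) :
    k ^ 2 ∈ Set.Ioo (a ^ 2) (b ^ 2) :=
  ⟨pow_lt_pow_left₀ hk.1 ha two_ne_zero, pow_lt_pow_left₀ hk.2 (ha.trans hk.1.le) two_ne_zero⟩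

variable {i : ℕ} {k : ℝ}

section Angle

variable (h₁ h₂) (hk : k ∈ Set.Ioo (zeroSeq ℓ₁ ℓ₂ i) (zeroSeq ℓ₁ ℓ₂ (i + 1)))
include h₁ h₂ hk

theorem cell_pos : 0 < k := (zeroSeq_nonneg h₁ h₂ i).trans_lt hk.1

omit hk in
theorem le_cellAngle₁ : (k - zeroSeq ℓ₁ ℓ₂ i) * ℓ₁ / 2 ≤ cellAngle ℓ₁ ℓ₂ ℓ₁ i k ∧
    (zeroSeq ℓ₁ ℓ₂ (i + 1) - k) * ℓ₁ / 2 ≤ Real.pi / 2 - cellAngle ℓ₁ ℓ₂ ℓ₁ i k := by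
  have e1 := zeroIdx_mul_pi_le h₁ h₂ h₁ i
  have e2 := zeroSeq_succ_mul_le₁ (ℓ₂ := ℓ₂) h₁ i
  unfold cellAngle
  constructor <;> linarith

omit hk in
theorem le_cellAngle₂ : (k - zeroSeq ℓ₁ ℓ₂ i) * ℓ₂ / 2 ≤ cellAngle ℓ₁ ℓ₂ ℓ₂ i k ∧
    (zeroSeq ℓ₁ ℓ₂ (i + 1) - k) * ℓ₂ / 2 ≤ Real.pi / 2 - cellAngle ℓ₁ ℓ₂ ℓ₂ i k := by
  have e1 := zeroIdx_mul_pi_le h₁ h₂ h₂ i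
  have e2 := zeroSeq_succ_mul_le₂ (ℓ₁ := ℓ₁) h₂ i
  unfold cellAngle
  constructor <;> linarith

theorem cellAngle₁_mem : cellAngle ℓ₁ ℓ₂ ℓ₁ i k ∈ Set.Ioo 0 (Real.pi / 2) := by
  obtain ⟨e1, e2⟩ := le_cellAngle₁ (k := k) (i := i) h₁ h₂
  have := mul_pos (sub_pos.2 hk.1) h₁
  have := mul_pos (sub_pos.2 hk.2) h₁
  constructor <;> linarith

theorem cellAngle₂_mem : cellAngle ℓ₁ ℓ₂ ℓ₂ i k ∈ Set.Ioo 0 (Real.pi / 2) := by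
  obtain ⟨e1, e2⟩ := le_cellAngle₂ (k := k) (i := i) h₁ h₂
  have := mul_pos (sub_pos.2 hk.1) h₂
  have := mul_pos (sub_pos.2 hk.2) h₂
  constructor <;> linarith

theorem cellUpper_pos : 0 < cellUpper ℓ₁ ℓ₂ i k := by
  have := cell_pos h₁ h₂ hk
  have := tan_pos (cellAngle₁_mem h₁ h₂ hk)
  have := tan_pos (cellAngle₂_mem h₁ h₂ hk)
  unfold cellUpper
  positivity

theorem cellLower_pos : 0 < cellLower ℓ₁ ℓ₂ i k := by
  have := cell_pos h₁ h₂ hk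
  have := tan_pos (cellAngle₁_mem h₁ h₂ hk)
  have := tan_pos (cellAngle₂_mem h₁ h₂ hk)
  unfold cellLower
  positivity

theorem mem_cell_iff : k ^ 2 ∈ realSpectrum ℓ₁ ℓ₂ h₁ h₂ c ↔
    -cellLower ℓ₁ ℓ₂ i k ≤ c ∧ c ≤ cellUpper ℓ₁ ℓ₂ i k :=
  sq_mem_latticeSpectrum_iff (cell_pos h₁ h₂ hk) (cellAngle₁_mem h₁ h₂ hk)
    (cellAngle₂_mem h₁ h₂ hk) (by unfold cellAngle; ring) (by unfold cellAngle; ring)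

theorem mem_cell_iff_of_nonneg (hc : 0 ≤ c) : k ^ 2 ∈ realSpectrum ℓ₁ ℓ₂ h₁ h₂ c ↔
    c ≤ cellUpper ℓ₁ ℓ₂ i k := by
  rw [mem_cell_iff h₁ h₂ hk, and_iff_right]
  linarith [cellLower_pos h₁ h₂ hk]

theorem mem_cell_iff_of_neg (hc : c < 0) : k ^ 2 ∈ realSpectrum ℓ₁ ℓ₂ h₁ h₂ c ↔
    -c ≤ cellLower ℓ₁ ℓ₂ i k := by
  rw [mem_cell_iff h₁ h₂ hk, and_iff_left (by linarith [cellUpper_pos h₁ h₂ hk]), neg_le]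

/-- tan y ≥ y, and each half phase is at least (k - left end) ℓ / 2 because its own last zero is not
to the right of the left end. -/
theorem le_cellUpper : (k - zeroSeq ℓ₁ ℓ₂ i) * k * (ℓ₁ + ℓ₂) ≤ cellUpper ℓ₁ ℓ₂ i k := by
  have hk0 := cell_pos h₁ h₂ hk
  have a1 := cellAngle₁_mem h₁ h₂ hk
  have a2 := cellAngle₂_mem h₁ h₂ hk
  have e1 := (le_cellAngle₁ (k := k) (i := i) h₁ h₂).1.trans (Real.lt_tan a1.1 a1.2).le
  have e2 := (le_cellAngle₂ (k := k) (i := i) h₁ h₂).1.trans (Real.lt_tan a2.1 a2.2).le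
  have := mul_le_mul_of_nonneg_left (add_le_add e1 e2) (show 0 ≤ 2 * k by positivity)
  unfold cellUpper
  linarith

theorem le_cellLower : k * (zeroSeq ℓ₁ ℓ₂ (i + 1) - k) * (ℓ₁ + ℓ₂) ≤ cellLower ℓ₁ ℓ₂ i k := by
  have hk0 := cell_pos h₁ h₂ hk
  have e1 := (le_cellAngle₁ (k := k) (i := i) h₁ h₂).2.trans (inv_tan_ge (cellAngle₁_mem h₁ h₂ hk))
  have e2 := (le_cellAngle₂ (k := k) (i := i) h₁ h₂).2.trans (inv_tan_ge (cellAngle₂_mem h₁ h₂ hk))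
  have := mul_le_mul_of_nonneg_left (add_le_add e1 e2) (show 0 ≤ 2 * k by positivity)
  unfold cellLower
  linarith

end Angle

theorem cellAngle_mono {ℓ k' : ℝ} (hℓ : 0 < ℓ) (h : k ≤ k') :
    cellAngle ℓ₁ ℓ₂ ℓ i k ≤ cellAngle ℓ₁ ℓ₂ ℓ i k' := by
  unfold cellAngle
  gcongr

theorem cellUpper_mono (h₁ : 0 < ℓ₁) (h₂ : 0 < ℓ₂) {k' : ℝ}
    (hk : k ∈ Set.Ioo (zeroSeq ℓ₁ ℓ₂ i) (zeroSeq ℓ₁ ℓ₂ (i + 1)))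
    (hk' : k' ∈ Set.Ioo (zeroSeq ℓ₁ ℓ₂ i) (zeroSeq ℓ₁ ℓ₂ (i + 1))) (h : k ≤ k') :
    cellUpper ℓ₁ ℓ₂ i k ≤ cellUpper ℓ₁ ℓ₂ i k' := by
  have hk0 := cell_pos h₁ h₂ hk
  have a1 := cellAngle₁_mem h₁ h₂ hk
  have a2 := cellAngle₂_mem h₁ h₂ hk
  have b1 := tan_le_tan a1.1 (cellAngle_mono h₁ h) (cellAngle₁_mem h₁ h₂ hk').2
  have b2 := tan_le_tan a2.1 (cellAngle_mono h₂ h) (cellAngle₂_mem h₁ h₂ hk').2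
  have := tan_pos a1
  have := tan_pos a2
  have hk0' := cell_pos h₁ h₂ hk'
  unfold cellUpper
  gcongr

/-- The factor k grows while cot y falls, so monotonicity is not immediate; but k = (2y + n π) / ℓ
splits the product into 2 y cot y and n π cot y, both decreasing. -/
theorem mul_inv_tan_anti {k' ℓ y y' : ℝ} {n : ℕ} (hℓ : 0 < ℓ) (hy : y ∈ Set.Ioo 0 (Real.pi / 2))
    (hy' : y' ∈ Set.Ioo 0 (Real.pi / 2)) (e : y = (k * ℓ - n * Real.pi) / 2)
    (e' : y' = (k' * ℓ - n * Real.pi) / 2) (h : y ≤ y') :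
    k' * (Real.tan y')⁻¹ ≤ k * (Real.tan y)⁻¹ := by
  have h1 := div_tan_antitone hy.1 h hy'.2
  have h2 : (Real.tan y')⁻¹ ≤ (Real.tan y)⁻¹ :=
    inv_anti₀ (tan_pos hy) (tan_le_tan hy.1 h hy'.2)
  have h3 := mul_le_mul_of_nonneg_left h2 (show 0 ≤ n * Real.pi by have := Real.pi_pos; positivity)
  have f : k = (2 * y + n * Real.pi) / ℓ := by rw [eq_div_iff hℓ.ne', e]; ring
  have f' : k' = (2 * y' + n * Real.pi) / ℓ := by rw [eq_div_iff hℓ.ne', e']; ring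
  rw [f, f', div_mul_eq_mul_div, div_mul_eq_mul_div]
  gcongr ?_ / ℓ
  linarith

theorem cellLower_anti (h₁ : 0 < ℓ₁) (h₂ : 0 < ℓ₂) {k' : ℝ}
    (hk : k ∈ Set.Ioo (zeroSeq ℓ₁ ℓ₂ i) (zeroSeq ℓ₁ ℓ₂ (i + 1)))
    (hk' : k' ∈ Set.Ioo (zeroSeq ℓ₁ ℓ₂ i) (zeroSeq ℓ₁ ℓ₂ (i + 1))) (h : k ≤ k') :
    cellLower ℓ₁ ℓ₂ i k' ≤ cellLower ℓ₁ ℓ₂ i k := by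
  have b1 := mul_inv_tan_anti h₁ (cellAngle₁_mem h₁ h₂ hk) (cellAngle₁_mem h₁ h₂ hk') rfl rfl
    (cellAngle_mono h₁ h)
  have b2 := mul_inv_tan_anti h₂ (cellAngle₂_mem h₁ h₂ hk) (cellAngle₂_mem h₁ h₂ hk') rfl rfl
    (cellAngle_mono h₂ h)
  unfold cellLower
  linarith

theorem exists_large_tan {ℓ k₀ C hi : ℝ} {n : ℕ} (hℓ : 0 < ℓ) (hk₀ : 0 < k₀) (hk₀' : k₀ < hi)
    (hhi : hi * ℓ = (n + 1) * Real.pi) :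
    ∃ k, k₀ ≤ k ∧ k < hi ∧ C ≤ 2 * k * Real.tan ((k * ℓ - n * Real.pi) / 2) := by
  let y := max (Real.arctan (|C| / (2 * k₀))) ((k₀ * ℓ - n * Real.pi) / 2)
  have hy : y < Real.pi / 2 := by
    refine max_lt (Real.arctan_lt_pi_div_two _) ?_
    have := mul_lt_mul_of_pos_right hk₀' hℓ
    linarith
  have hy' : Real.arctan (|C| / (2 * k₀)) ≤ y := le_max_left _ _
  have hle : k₀ ≤ (2 * y + n * Real.pi) / ℓ := by
    rw [le_div_iff₀ hℓ]
    have : (k₀ * ℓ - n * Real.pi) / 2 ≤ y := le_max_right _ _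
    linarith
  have e : ((2 * y + n * Real.pi) / ℓ * ℓ - n * Real.pi) / 2 = y := by
    rw [div_mul_cancel₀ _ hℓ.ne']
    ring
  refine ⟨(2 * y + n * Real.pi) / ℓ, hle, ?_, ?_⟩
  · rw [div_lt_iff₀ hℓ]
    linarith
  · rw [e]
    have h1 : |C| / (2 * k₀) ≤ Real.tan y := by
      rw [← Real.tan_arctan (|C| / (2 * k₀))]
      exact Real.strictMonoOn_tan.monotoneOn (Real.arctan_mem_Ioo _)
        ⟨(Real.neg_pi_div_two_lt_arctan _).trans_le hy', hy⟩ hy'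
    calc C ≤ |C| := le_abs_self C
      _ = 2 * k₀ * (|C| / (2 * k₀)) := by field_simp
      _ ≤ _ := by gcongr

theorem exists_small_tan {ℓ k₀ C lo : ℝ} {n : ℕ} (hℓ : 0 < ℓ) (hlo : 0 < lo) (hk₀ : lo < k₀)
    (hlo' : lo * ℓ = n * Real.pi) (hC : 0 < C) :
    ∃ k, lo < k ∧ k ≤ k₀ ∧ C ≤ 2 * k * (Real.tan ((k * ℓ - n * Real.pi) / 2))⁻¹ := by
  let y := min (Real.arctan (2 * lo / C)) ((k₀ * ℓ - n * Real.pi) / 2)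
  have hy : 0 < y := by
    refine lt_min (Real.arctan_pos.2 (by positivity)) ?_
    have := mul_lt_mul_of_pos_right hk₀ hℓ
    linarith
  have hy' : y ≤ Real.arctan (2 * lo / C) := min_le_left _ _
  have hy2 : y < Real.pi / 2 := hy'.trans_lt (Real.arctan_lt_pi_div_two _)
  have hle : (2 * y + n * Real.pi) / ℓ ≤ k₀ := by
    rw [div_le_iff₀ hℓ]
    have : y ≤ (k₀ * ℓ - n * Real.pi) / 2 := min_le_right _ _
    linarith
  have e : ((2 * y + n * Real.pi) / ℓ * ℓ - n * Real.pi) / 2 = y := by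
    rw [div_mul_cancel₀ _ hℓ.ne']
    ring
  have hlt : lo < (2 * y + n * Real.pi) / ℓ := by
    rw [lt_div_iff₀ hℓ]
    linarith
  refine ⟨(2 * y + n * Real.pi) / ℓ, hlt, hle, ?_⟩
  rw [e]
  have h1 : Real.tan y ≤ 2 * lo / C := by
    rw [← Real.tan_arctan (2 * lo / C)]
    exact tan_le_tan hy hy' (Real.arctan_lt_pi_div_two _)
  have h2 : C / (2 * lo) ≤ (Real.tan y)⁻¹ := by
    rw [← inv_div]
    exact inv_anti₀ (tan_pos ⟨hy, hy2⟩) h1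
  calc C = 2 * lo * (C / (2 * lo)) := by field_simp
    _ ≤ _ := by gcongr

/-- At the right end of a cell one of the two half phases reaches π/2, and its tangent blows up. -/
theorem exists_le_cellUpper (h₁ : 0 < ℓ₁) (h₂ : 0 < ℓ₂) (i : ℕ) (C : ℝ) :
    ∃ k ∈ Set.Ioo (zeroSeq ℓ₁ ℓ₂ i) (zeroSeq ℓ₁ ℓ₂ (i + 1)), C ≤ cellUpper ℓ₁ ℓ₂ i k := by
  obtain ⟨k₀, hk₀, hk₀'⟩ := exists_between (zeroSeq_lt h₁ h₂ i)
  have hp := cell_pos h₁ h₂ ⟨hk₀, hk₀'⟩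
  rcases zeroSeq_succ_mul_eq h₁ h₂ i with h | h
  · obtain ⟨k, e1, e2, e3⟩ := exists_large_tan (C := C) h₁ hp hk₀' h
    have hk : k ∈ Set.Ioo (zeroSeq ℓ₁ ℓ₂ i) (zeroSeq ℓ₁ ℓ₂ (i + 1)) := ⟨hk₀.trans_le e1, e2⟩
    refine ⟨k, hk, e3.trans ?_⟩
    have h3 := mul_pos (cell_pos h₁ h₂ hk) (tan_pos (cellAngle₂_mem h₁ h₂ hk))
    simp only [cellUpper, cellAngle] at h3 ⊢
    linarith
  · obtain ⟨k, e1, e2, e3⟩ := exists_large_tan (C := C) h₂ hp hk₀' h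
    have hk : k ∈ Set.Ioo (zeroSeq ℓ₁ ℓ₂ i) (zeroSeq ℓ₁ ℓ₂ (i + 1)) := ⟨hk₀.trans_le e1, e2⟩
    refine ⟨k, hk, e3.trans ?_⟩
    have h3 := mul_pos (cell_pos h₁ h₂ hk) (tan_pos (cellAngle₁_mem h₁ h₂ hk))
    simp only [cellUpper, cellAngle] at h3 ⊢
    linarith

theorem zeroSeq_mul_eq_zeroIdx (h₁ : 0 < ℓ₁) (h₂ : 0 < ℓ₂) (i : ℕ) :
    zeroSeq ℓ₁ ℓ₂ (i + 1) * ℓ₁ = zeroIdx ℓ₁ ℓ₂ ℓ₁ (i + 1) * Real.pi ∨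
    zeroSeq ℓ₁ ℓ₂ (i + 1) * ℓ₂ = zeroIdx ℓ₁ ℓ₂ ℓ₂ (i + 1) * Real.pi := by
  refine (zeroSeq_succ_mul_eq h₁ h₂ i).imp (fun h => ?_) fun h => ?_
  · rw [zeroIdx_eq_of_mul_eq (m := zeroIdx ℓ₁ ℓ₂ ℓ₁ i + 1) (by rw [h]; push_cast; ring), h]
    push_cast
    ring
  · rw [zeroIdx_eq_of_mul_eq (m := zeroIdx ℓ₁ ℓ₂ ℓ₂ i + 1) (by rw [h]; push_cast; ring), h]
    push_cast
    ring

/-- At the left end one half phase tends to 0 while k stays away from 0, so k cot y blows up. The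
first cell is left out: there k tends to 0 as well and the bound stays finite. -/
theorem exists_le_cellLower (h₁ : 0 < ℓ₁) (h₂ : 0 < ℓ₂) (i : ℕ) {C : ℝ} (hC : 0 < C) :
    ∃ k ∈ Set.Ioo (zeroSeq ℓ₁ ℓ₂ (i + 1)) (zeroSeq ℓ₁ ℓ₂ (i + 1 + 1)),
      C ≤ cellLower ℓ₁ ℓ₂ (i + 1) k := by
  obtain ⟨k₀, hk₀, hk₀'⟩ := exists_between (zeroSeq_lt h₁ h₂ (i + 1))
  have hp := zeroSeq_pos h₁ h₂ i
  rcases zeroSeq_mul_eq_zeroIdx h₁ h₂ i with h | h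
  · obtain ⟨k, e1, e2, e3⟩ := exists_small_tan h₁ hp hk₀ h hC
    have hk : k ∈ Set.Ioo (zeroSeq ℓ₁ ℓ₂ (i + 1)) (zeroSeq ℓ₁ ℓ₂ (i + 1 + 1)) :=
      ⟨e1, e2.trans_lt hk₀'⟩
    refine ⟨k, hk, e3.trans ?_⟩
    have h3 := mul_pos (cell_pos h₁ h₂ hk) (inv_pos.2 (tan_pos (cellAngle₂_mem h₁ h₂ hk)))
    simp only [cellLower, cellAngle] at h3 ⊢
    linarith
  · obtain ⟨k, e1, e2, e3⟩ := exists_small_tan h₂ hp hk₀ h hC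
    have hk : k ∈ Set.Ioo (zeroSeq ℓ₁ ℓ₂ (i + 1)) (zeroSeq ℓ₁ ℓ₂ (i + 1 + 1)) :=
      ⟨e1, e2.trans_lt hk₀'⟩
    refine ⟨k, hk, e3.trans ?_⟩
    have h3 := mul_pos (cell_pos h₁ h₂ hk) (inv_pos.2 (tan_pos (cellAngle₁_mem h₁ h₂ hk)))
    simp only [cellLower, cellAngle] at h3 ⊢
    linarith

theorem exists_cell_of_nonneg (hc : 0 ≤ c) (i : ℕ) : ∃ a, zeroSeq ℓ₁ ℓ₂ i ^ 2 ≤ a ∧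
    a < zeroSeq ℓ₁ ℓ₂ (i + 1) ^ 2 ∧
    Set.Icc a (zeroSeq ℓ₁ ℓ₂ (i + 1) ^ 2) ⊆ realSpectrum ℓ₁ ℓ₂ h₁ h₂ c ∧
    (∀ E ∈ Set.Ioo (zeroSeq ℓ₁ ℓ₂ i ^ 2) (zeroSeq ℓ₁ ℓ₂ (i + 1) ^ 2),
      E ∈ realSpectrum ℓ₁ ℓ₂ h₁ h₂ c → a ≤ E) ∧
    a - zeroSeq ℓ₁ ℓ₂ i ^ 2 ≤ 2 * c / (ℓ₁ + ℓ₂) := by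
  have h0 := zeroSeq_nonneg h₁ h₂ i
  have hcell := exists_up_cell (X := realSpectrum ℓ₁ ℓ₂ h₁ h₂ c)
    (lo := zeroSeq ℓ₁ ℓ₂ i ^ 2) (hi := zeroSeq ℓ₁ ℓ₂ (i + 1) ^ 2) isClosed_realSpectrum
  specialize hcell ?_ ?_
  rotate_left 2
  · obtain ⟨a, ha1, ha2, ha3, ha4⟩ := hcell
    refine ⟨a, ha1, ha2, ha3, ha4, ?_⟩
    by_contra hB
    have hB0 : 0 ≤ 2 * c / (ℓ₁ + ℓ₂) := by positivity
    set B := 2 * c / (ℓ₁ + ℓ₂) with hBdef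
    -- If a were more than B above the cell's left end, the midpoint between that level and a would
    -- be outside the spectrum, although its tangent bound exceeds B (ℓ₁ + ℓ₂) / 2 = c.
    have hEI : (zeroSeq ℓ₁ ℓ₂ i ^ 2 + B + a) / 2 ∈
      Set.Ioo (zeroSeq ℓ₁ ℓ₂ i ^ 2) (zeroSeq ℓ₁ ℓ₂ (i + 1) ^ 2) := by constructor <;> linarith
    obtain ⟨k, hk, hEk⟩ := exists_sqrt h₁ h₂ hEI
    have hnot : ¬ c ≤ cellUpper ℓ₁ ℓ₂ i k := fun h => by
      rw [← mem_cell_iff_of_nonneg h₁ h₂ hk hc, ← hEk] at h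
      linarith [ha4 _ hEI h]
    have h1 := (le_cellUpper h₁ h₂ hk).trans (not_le.1 hnot).le
    have h2 : B * (ℓ₁ + ℓ₂) = 2 * c := div_mul_cancel₀ _ (by positivity)
    have h3 : k ^ 2 - zeroSeq ℓ₁ ℓ₂ i ^ 2 ≤ 2 * ((k - zeroSeq ℓ₁ ℓ₂ i) * k) := by
      nlinarith [hk.1]
    have h4 : B < k ^ 2 - zeroSeq ℓ₁ ℓ₂ i ^ 2 := by rw [← hEk]; linarith
    nlinarith
  · intro E hE hEX E' hE' hEE'
    obtain ⟨k, hk, rfl⟩ := exists_sqrt h₁ h₂ hE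
    obtain ⟨k', hk', rfl⟩ := exists_sqrt h₁ h₂ hE'
    rw [mem_cell_iff_of_nonneg h₁ h₂ hk hc] at hEX
    rw [mem_cell_iff_of_nonneg h₁ h₂ hk' hc]
    exact hEX.trans (cellUpper_mono h₁ h₂ hk hk'
      ((pow_le_pow_iff_left₀ (cell_pos h₁ h₂ hk).le (cell_pos h₁ h₂ hk').le two_ne_zero).1 hEE'))
  · obtain ⟨k, hk, hck⟩ := exists_le_cellUpper h₁ h₂ i c
    exact ⟨k ^ 2, sq_mem_Ioo h0 hk, (mem_cell_iff_of_nonneg h₁ h₂ hk hc).2 hck⟩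

theorem exists_cell_of_neg (hc : c < 0) (i : ℕ) : ∃ b, zeroSeq ℓ₁ ℓ₂ (i + 1) ^ 2 < b ∧
    b ≤ zeroSeq ℓ₁ ℓ₂ (i + 1 + 1) ^ 2 ∧
    Set.Icc (zeroSeq ℓ₁ ℓ₂ (i + 1) ^ 2) b ⊆ realSpectrum ℓ₁ ℓ₂ h₁ h₂ c ∧
    (∀ E ∈ Set.Ioo (zeroSeq ℓ₁ ℓ₂ (i + 1) ^ 2) (zeroSeq ℓ₁ ℓ₂ (i + 1 + 1) ^ 2),
      E ∈ realSpectrum ℓ₁ ℓ₂ h₁ h₂ c → E ≤ b) ∧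
    √b * (zeroSeq ℓ₁ ℓ₂ (i + 1 + 1) - √b) * (ℓ₁ + ℓ₂) ≤ -c := by
  have h0 := zeroSeq_nonneg h₁ h₂ (i + 1)
  have hcell := exists_down_cell (X := realSpectrum ℓ₁ ℓ₂ h₁ h₂ c)
    (lo := zeroSeq ℓ₁ ℓ₂ (i + 1) ^ 2) (hi := zeroSeq ℓ₁ ℓ₂ (i + 1 + 1) ^ 2)
    isClosed_realSpectrum
  specialize hcell ?_ ?_
  rotate_left 2
  · obtain ⟨b, hb1, hb2, hb3, hb4⟩ := hcell
    refine ⟨b, hb1, hb2, hb3, hb4, ?_⟩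
    have hb0 : 0 ≤ b := (sq_nonneg _).trans hb1.le
    have hsb : √b ^ 2 = b := Real.sq_sqrt hb0
    have hlow : zeroSeq ℓ₁ ℓ₂ (i + 1) < √b := Real.lt_sqrt_of_sq_lt hb1
    have hup : √b ≤ zeroSeq ℓ₁ ℓ₂ (i + 1 + 1) :=
      Real.sqrt_le_iff.2 ⟨zeroSeq_nonneg h₁ h₂ _, hb2⟩
    rcases hup.eq_or_lt with he | hlt
    · rw [he, sub_self]
      linarith
    · by_contra hcon
      -- If the estimate failed at √b, it would by continuity fail slightly to the right, and those
      -- k would satisfy the spectral condition beyond b.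
      have hcont : Continuous fun k : ℝ => k * (zeroSeq ℓ₁ ℓ₂ (i + 1 + 1) - k) * (ℓ₁ + ℓ₂) := by
        fun_prop
      have hev : ∀ᶠ k in nhdsWithin (√b) (Set.Ioi (√b)),
          -c < k * (zeroSeq ℓ₁ ℓ₂ (i + 1 + 1) - k) * (ℓ₁ + ℓ₂) :=
        (hcont.continuousAt.eventually (lt_mem_nhds (not_le.1 hcon))).filter_mono nhdsWithin_le_nhds
      have hev2 : ∀ᶠ k in nhdsWithin (√b) (Set.Ioi (√b)), k < zeroSeq ℓ₁ ℓ₂ (i + 1 + 1) :=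
        (gt_mem_nhds hlt).filter_mono nhdsWithin_le_nhds
      obtain ⟨k, hk1, hk2, hk3⟩ := (hev.and (hev2.and self_mem_nhdsWithin)).exists
      have hk : k ∈ Set.Ioo (zeroSeq ℓ₁ ℓ₂ (i + 1)) (zeroSeq ℓ₁ ℓ₂ (i + 1 + 1)) :=
        ⟨hlow.trans hk3, hk2⟩
      have hmem := (mem_cell_iff_of_neg h₁ h₂ hk hc).2 (hk1.le.trans (le_cellLower h₁ h₂ hk))
      have h5 := hb4 _ (sq_mem_Ioo h0 hk) hmem
      have h6 : √b ^ 2 < k ^ 2 := pow_lt_pow_left₀ hk3 (Real.sqrt_nonneg _) two_ne_zero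
      linarith
  · intro E hE hEX E' hE' hEE'
    obtain ⟨k, hk, rfl⟩ := exists_sqrt h₁ h₂ hE
    obtain ⟨k', hk', rfl⟩ := exists_sqrt h₁ h₂ hE'
    rw [mem_cell_iff_of_neg h₁ h₂ hk hc] at hEX
    rw [mem_cell_iff_of_neg h₁ h₂ hk' hc]
    exact hEX.trans (cellLower_anti h₁ h₂ hk' hk
      ((pow_le_pow_iff_left₀ (cell_pos h₁ h₂ hk').le (cell_pos h₁ h₂ hk).le two_ne_zero).1 hEE'))
  · obtain ⟨k, hk, hck⟩ := exists_le_cellLower h₁ h₂ i (neg_pos.2 hc)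
    exact ⟨k ^ 2, sq_mem_Ioo h0 hk, (mem_cell_iff_of_neg h₁ h₂ hk hc).2 hck⟩

/-- In the first cell the half phases are k ℓ / 2 without shift, and y cot y ≤ 1. The bound is the
critical coupling at energy zero. -/
theorem cellLower_zero_le (h₁ : 0 < ℓ₁) (h₂ : 0 < ℓ₂)
    (hk : k ∈ Set.Ioo (zeroSeq ℓ₁ ℓ₂ 0) (zeroSeq ℓ₁ ℓ₂ (0 + 1))) :
    cellLower ℓ₁ ℓ₂ 0 k ≤ 4 / ℓ₁ + 4 / ℓ₂ := by
  have a1 := mul_inv_tan_le_one (cellAngle₁_mem h₁ h₂ hk)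
  have a2 := mul_inv_tan_le_one (cellAngle₂_mem h₁ h₂ hk)
  have hidx : ∀ ℓ, zeroIdx ℓ₁ ℓ₂ ℓ 0 = 0 := fun ℓ => zeroIdx_eq_of_mul_eq (by simp [zeroSeq])
  have e : ∀ ℓ, cellAngle ℓ₁ ℓ₂ ℓ 0 k = k * ℓ / 2 := fun ℓ => by
    unfold cellAngle
    rw [hidx]
    push_cast
    ring
  unfold cellLower
  rw [e] at a1 a2 ⊢
  rw [e]
  have f : ∀ ℓ : ℝ, 0 < ℓ → k * ℓ / 2 * (Real.tan (k * ℓ / 2))⁻¹ ≤ 1 →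
      2 * k * (Real.tan (k * ℓ / 2))⁻¹ ≤ 4 / ℓ := fun ℓ hℓ h => by
    rw [le_div_iff₀ hℓ]
    linarith
  have := f ℓ₁ h₁ a1
  have := f ℓ₂ h₂ a2
  linarith

/-- The value at `- k ^ 2` of the largest admissible coupling constant, with the sign changed. -/
noncomputable def hypUpper (ℓ₁ ℓ₂ k : ℝ) : ℝ :=
  2 * k * (Real.tanh (k * ℓ₁ / 2) + Real.tanh (k * ℓ₂ / 2))

/-- The value at `- k ^ 2` of the smallest admissible coupling constant, with the sign changed. -/
noncomputable def hypLower (ℓ₁ ℓ₂ k : ℝ) : ℝ :=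
  2 * k * ((Real.tanh (k * ℓ₁ / 2))⁻¹ + (Real.tanh (k * ℓ₂ / 2))⁻¹)

theorem neg_sq_mem_iff (hk : 0 < k) : -k ^ 2 ∈ realSpectrum ℓ₁ ℓ₂ h₁ h₂ c ↔
    -c ≤ hypLower ℓ₁ ℓ₂ k ∧ hypUpper ℓ₁ ℓ₂ k ≤ -c := by
  have := neg_sq_mem_latticeSpectrum_iff (h₁ := h₁) (h₂ := h₂) (c := c) hk
  change ((-k ^ 2 : ℝ) : ℂ) ∈ latticeSpectrum ℓ₁ ℓ₂ h₁ h₂ c ↔ _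
  rw [this]
  unfold hypLower hypUpper
  exact and_congr neg_le le_neg

theorem hypUpper_strictMono (h₁ : 0 < ℓ₁) (h₂ : 0 < ℓ₂) {k' : ℝ} (hk : 0 < k) (h : k < k') :
    hypUpper ℓ₁ ℓ₂ k < hypUpper ℓ₁ ℓ₂ k' := by
  have a1 : Real.tanh (k * ℓ₁ / 2) < Real.tanh (k' * ℓ₁ / 2) := tanh_strictMono (by gcongr)
  have a2 : Real.tanh (k * ℓ₂ / 2) < Real.tanh (k' * ℓ₂ / 2) := tanh_strictMono (by gcongr)
  have b1 := tanh_pos (show 0 < k * ℓ₁ / 2 by positivity)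
  have b2 := tanh_pos (show 0 < k * ℓ₂ / 2 by positivity)
  unfold hypUpper
  gcongr

theorem hypLower_mono (h₁ : 0 < ℓ₁) (h₂ : 0 < ℓ₂) {k' : ℝ} (hk : 0 < k) (h : k ≤ k') :
    hypLower ℓ₁ ℓ₂ k ≤ hypLower ℓ₁ ℓ₂ k' := by
  have f : ∀ ℓ : ℝ, 0 < ℓ → k * (Real.tanh (k * ℓ / 2))⁻¹ ≤ k' * (Real.tanh (k' * ℓ / 2))⁻¹ :=
    fun ℓ hℓ => by
      have := mul_inv_tanh_mono (x := k * ℓ / 2) (y := k' * ℓ / 2) (by positivity) (by gcongr)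
      refine le_of_mul_le_mul_left ?_ (show 0 < ℓ / 2 by positivity)
      linarith
  have := f ℓ₁ h₁
  have := f ℓ₂ h₂
  unfold hypLower
  linarith

theorem le_hypLower (h₁ : 0 < ℓ₁) (h₂ : 0 < ℓ₂) (hk : 0 < k) :
    4 / ℓ₁ + 4 / ℓ₂ ≤ hypLower ℓ₁ ℓ₂ k := by
  have f : ∀ ℓ : ℝ, 0 < ℓ → 4 / ℓ ≤ 2 * k * (Real.tanh (k * ℓ / 2))⁻¹ := fun ℓ hℓ => by
    have := one_le_mul_inv_tanh (show 0 < k * ℓ / 2 by positivity)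
    rw [div_le_iff₀ hℓ]
    linarith
  have := f ℓ₁ h₁
  have := f ℓ₂ h₂
  unfold hypLower
  linarith

theorem four_mul_le_hypLower (h₁ : 0 < ℓ₁) (h₂ : 0 < ℓ₂) (hk : 0 < k) :
    4 * k ≤ hypLower ℓ₁ ℓ₂ k := by
  have f : ∀ ℓ : ℝ, 0 < ℓ → 1 ≤ (Real.tanh (k * ℓ / 2))⁻¹ := fun ℓ hℓ =>
    (one_le_inv₀ (tanh_pos (by positivity))).2 (tanh_lt_one' _).le
  have := mul_le_mul_of_nonneg_left (add_le_add (f ℓ₁ h₁) (f ℓ₂ h₂)) (show 0 ≤ 2 * k by positivity)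
  unfold hypLower
  linarith

theorem hypUpper_lt (hk : 0 < k) : hypUpper ℓ₁ ℓ₂ k < 4 * k := by
  have := mul_lt_mul_of_pos_left (add_lt_add (tanh_lt_one' (k * ℓ₁ / 2)) (tanh_lt_one' (k * ℓ₂ / 2)))
    (show 0 < 2 * k by positivity)
  unfold hypUpper
  linarith

theorem exists_hypUpper_eq (h₁ : 0 < ℓ₁) (h₂ : 0 < ℓ₂) {C : ℝ} (hC : 0 < C) :
    ∃ k, 0 < k ∧ hypUpper ℓ₁ ℓ₂ k = C := by
  have hcont : Continuous (hypUpper ℓ₁ ℓ₂) := by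
    unfold hypUpper
    have := continuous_tanh'
    fun_prop
  have ht := tanh_pos (show 0 < ℓ₁ / 2 by positivity)
  let K := 1 + C / (2 * Real.tanh (ℓ₁ / 2))
  have hK1 : 1 ≤ K := le_add_of_nonneg_right (by positivity)
  have hK : C ≤ hypUpper ℓ₁ ℓ₂ K := by
    have e1 : Real.tanh (ℓ₁ / 2) ≤ Real.tanh (K * ℓ₁ / 2) :=
      tanh_strictMono.monotone (by nlinarith)
    have e2 := tanh_pos (show 0 < K * ℓ₂ / 2 by positivity)
    have e3 : 2 * K * Real.tanh (ℓ₁ / 2) ≤ hypUpper ℓ₁ ℓ₂ K := by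
      unfold hypUpper
      gcongr
      linarith
    have e4 : 2 * K * Real.tanh (ℓ₁ / 2) = 2 * Real.tanh (ℓ₁ / 2) + C := by
      simp only [K]
      field_simp
    linarith
  have h0 : hypUpper ℓ₁ ℓ₂ 0 = 0 := by simp [hypUpper]
  obtain ⟨k, hk, hkC⟩ := intermediate_value_Icc (show (0 : ℝ) ≤ K by linarith) hcont.continuousOn
    (show C ∈ Set.Icc (hypUpper ℓ₁ ℓ₂ 0) (hypUpper ℓ₁ ℓ₂ K) from ⟨by rw [h0]; exact hC.le, hK⟩)
  refine ⟨k, hk.1.lt_of_ne ?_, hkC⟩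
  rintro rfl
  linarith

/-- For c < 0 the interval from the threshold -K² to the first Dirichlet energy is treated as one
cell. The tanh condition holds exactly above the threshold, where hypUpper K = -c. What remains is
downward closed across zero: the coth bound is at least 4 / ℓ₁ + 4 / ℓ₂, the cotangent bound at most
that, and both are monotone. -/
theorem exists_bottom_cell (hc : c < 0) : ∃ a b, a < 0 ∧ a < b ∧ b ≤ zeroSeq ℓ₁ ℓ₂ 1 ^ 2 ∧
    Set.Icc a b ⊆ realSpectrum ℓ₁ ℓ₂ h₁ h₂ c ∧
    (∀ E ∈ realSpectrum ℓ₁ ℓ₂ h₁ h₂ c, a ≤ E) ∧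
    (∀ E < zeroSeq ℓ₁ ℓ₂ 1 ^ 2, E ∈ realSpectrum ℓ₁ ℓ₂ h₁ h₂ c → E ≤ b) ∧
    (∀ k, 0 < k → a < -k ^ 2 → hypUpper ℓ₁ ℓ₂ k < -c) := by
  obtain ⟨K, hK, hKc⟩ := exists_hypUpper_eq h₁ h₂ (neg_pos.2 hc)
  have hz0 : zeroSeq ℓ₁ ℓ₂ 0 = 0 := rfl
  have hd1 : 0 < zeroSeq ℓ₁ ℓ₂ 1 := zeroSeq_pos h₁ h₂ 0
  have hneg : ∀ E : ℝ, E < 0 → 0 < √(-E) ∧ E = -√(-E) ^ 2 := fun E hE =>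
    ⟨Real.sqrt_pos.2 (by linarith), by rw [Real.sq_sqrt (by linarith)]; ring⟩
  have hlt : ∀ k, 0 < k → -K ^ 2 < -k ^ 2 → hypUpper ℓ₁ ℓ₂ k < -c := fun k hk h => by
    rw [← hKc]
    exact hypUpper_strictMono h₁ h₂ hk (lt_of_pow_lt_pow_left₀ 2 hK.le (by linarith))
  have hbot : ∀ E ∈ realSpectrum ℓ₁ ℓ₂ h₁ h₂ c, -K ^ 2 ≤ E := by
    intro E hE
    by_contra hcon
    obtain ⟨e1, e2⟩ := hneg E (by linarith [sq_nonneg K])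
    rw [e2, neg_sq_mem_iff e1, ← hKc] at hE
    have := hypUpper_strictMono h₁ h₂ hK
      (lt_of_pow_lt_pow_left₀ 2 e1.le (show K ^ 2 < √(-E) ^ 2 by linarith))
    linarith [hE.2]
  have hcell := exists_down_cell (X := realSpectrum ℓ₁ ℓ₂ h₁ h₂ c)
    (lo := -K ^ 2) (hi := zeroSeq ℓ₁ ℓ₂ 1 ^ 2) isClosed_realSpectrum
  specialize hcell ?_ ?_
  rotate_left 2
  · obtain ⟨b, hb1, hb2, hb3, hb4⟩ := hcell
    refine ⟨-K ^ 2, b, by linarith [pow_pos hK 2], hb1, hb2, hb3, hbot, fun E hE hEX => ?_, hlt⟩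
    rcases (hbot E hEX).eq_or_lt with h | h
    · linarith
    · exact hb4 E ⟨h, hE⟩ hEX
  · intro E hE hEX E' hE' hEE'
    have hpos : ∀ E, 0 < E → E < zeroSeq ℓ₁ ℓ₂ 1 ^ 2 →
        ∃ k ∈ Set.Ioo (zeroSeq ℓ₁ ℓ₂ 0) (zeroSeq ℓ₁ ℓ₂ (0 + 1)), E = k ^ 2 := fun E h h' =>
      exists_sqrt h₁ h₂ (i := 0) ⟨by rw [hz0]; simpa using h, h'⟩
    have hlow : 0 ≤ E → -c ≤ 4 / ℓ₁ + 4 / ℓ₂ := by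
      intro h
      rcases h.eq_or_lt with h | h
      · have := (zero_mem_latticeSpectrum_iff.1 (show ((0 : ℝ) : ℂ) ∈ latticeSpectrum ℓ₁ ℓ₂ h₁ h₂ c from h ▸ hEX)).1
        linarith
      · obtain ⟨k, hk, rfl⟩ := hpos E h hE.2
        exact ((mem_cell_iff_of_neg h₁ h₂ hk hc).1 hEX).trans (cellLower_zero_le h₁ h₂ hk)
    rcases lt_trichotomy E' 0 with h | h | h
    · obtain ⟨e1, e2⟩ := hneg E' h
      rw [e2, neg_sq_mem_iff e1]
      refine ⟨?_, (hlt _ e1 (by rw [← e2]; exact hE'.1)).le⟩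
      rcases lt_or_ge E 0 with h' | h'
      · obtain ⟨f1, f2⟩ := hneg E h'
        rw [f2, neg_sq_mem_iff f1] at hEX
        exact hEX.1.trans (hypLower_mono h₁ h₂ f1 (Real.sqrt_le_sqrt (by linarith)))
      · exact (hlow h').trans (le_hypLower h₁ h₂ e1)
    · have := hlow (h ▸ hEE')
      rw [h]
      exact zero_mem_latticeSpectrum_iff.2 ⟨by linarith, hc.le⟩
    · obtain ⟨k', hk', rfl⟩ := hpos E' h hE'.2
      obtain ⟨k, hk, rfl⟩ := hpos E (h.trans_le hEE') hE.2
      rw [mem_cell_iff_of_neg h₁ h₂ hk hc] at hEX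
      rw [mem_cell_iff_of_neg h₁ h₂ hk' hc]
      exact hEX.trans (cellLower_anti h₁ h₂ hk' hk
        ((pow_le_pow_iff_left₀ (cell_pos h₁ h₂ hk').le (cell_pos h₁ h₂ hk).le two_ne_zero).1 hEE'))
  -- Witness k = -c / 4: tanh < 1 gives hypUpper k < 4 k = -c, and coth ≥ 1 gives hypLower k ≥ 4 k =
  -- -c.
  · have hk0 : 0 < -c / 4 := by linarith
    have h1 := hypUpper_lt (ℓ₁ := ℓ₁) (ℓ₂ := ℓ₂) hK
    have h2 : -c / 4 < K := by linarith
    have h3 : -K ^ 2 < -(-c / 4) ^ 2 := neg_lt_neg (pow_lt_pow_left₀ h2 hk0.le two_ne_zero)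
    refine ⟨-(-c / 4) ^ 2, ⟨h3, ?_⟩, ?_⟩
    · have := pow_pos hd1 2
      have := pow_pos hk0 2
      linarith
    · rw [neg_sq_mem_iff hk0]
      refine ⟨?_, (hlt _ hk0 h3).le⟩
      have := four_mul_le_hypLower h₁ h₂ hk0
      linarith

end Cells

/-! ### Global structure: bands, gap lengths, comparison with Kronig-Penney -/

section Bands

variable {ℓ₁ ℓ₂ : ℝ} {h₁ : 0 < ℓ₁} {h₂ : 0 < ℓ₂} {c : ℝ}

/-- The real lattice spectrum is the union of the intervals `[a i, b i]`, which have disjoint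
interiors and are numbered in increasing order. -/
structure IsBandSeq (ℓ₁ ℓ₂ : ℝ) (h₁ : 0 < ℓ₁) (h₂ : 0 < ℓ₂) (c : ℝ) (a b : ℕ → ℝ) : Prop where
  lt : ∀ i, a i < b i
  le : ∀ i, b i ≤ a (i + 1)
  tendsto : Filter.Tendsto a Filter.atTop Filter.atTop
  eq : realSpectrum ℓ₁ ℓ₂ h₁ h₂ c = {x | ∃ i, a i ≤ x ∧ x ≤ b i}

theorem tendsto_zeroSeq_sq (h₁ : 0 < ℓ₁) (h₂ : 0 < ℓ₂) :
    Filter.Tendsto (fun i => zeroSeq ℓ₁ ℓ₂ i ^ 2) Filter.atTop Filter.atTop :=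
  (Filter.tendsto_pow_atTop two_ne_zero).comp (tendsto_zeroSeq h₁ h₂)

theorem exists_zeroSeq_bracket (h₁ : 0 < ℓ₁) (h₂ : 0 < ℓ₂) {E : ℝ} (hE : 0 ≤ E) :
    ∃ i, zeroSeq ℓ₁ ℓ₂ i ^ 2 ≤ E ∧ E < zeroSeq ℓ₁ ℓ₂ (i + 1) ^ 2 := by
  classical
  have hex : ∃ n, E < zeroSeq ℓ₁ ℓ₂ n ^ 2 :=
    ((tendsto_zeroSeq_sq h₁ h₂).eventually_gt_atTop E).exists
  have hspec := Nat.find_spec hex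
  have hmin := fun n => Nat.find_min (m := n) hex
  generalize Nat.find hex = n at hspec hmin
  cases n with
  | zero =>
    have : zeroSeq ℓ₁ ℓ₂ 0 ^ 2 = 0 := by simp [zeroSeq]
    linarith
  | succ i => exact ⟨i, not_lt.1 (hmin i (Nat.lt_succ_self i)), hspec⟩

theorem zeroSeq_sq_mem (i : ℕ) : zeroSeq ℓ₁ ℓ₂ (i + 1) ^ 2 ∈ realSpectrum ℓ₁ ℓ₂ h₁ h₂ c := by
  rcases le_or_gt 0 c with hc | hc
  · obtain ⟨a, -, ha, hI, -⟩ := exists_cell_of_nonneg (h₁ := h₁) (h₂ := h₂) hc i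
    exact hI ⟨ha.le, le_rfl⟩
  · obtain ⟨b, hb, -, hI, -⟩ := exists_cell_of_neg (h₁ := h₁) (h₂ := h₂) hc i
    exact hI ⟨le_rfl, hb.le⟩

theorem zero_mem_realSpectrum_iff : (0 : ℝ) ∈ realSpectrum ℓ₁ ℓ₂ h₁ h₂ c ↔
    -(4 / ℓ₁ + 4 / ℓ₂) ≤ c ∧ c ≤ 0 :=
  zero_mem_latticeSpectrum_iff

theorem sqrt_neg_pos {E : ℝ} (hE : E < 0) : 0 < √(-E) ∧ E = -√(-E) ^ 2 :=
  ⟨Real.sqrt_pos.2 (by linarith), by rw [Real.sq_sqrt (by linarith)]; ring⟩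

theorem nonneg_of_mem (hc : 0 ≤ c) {E : ℝ} (hE : E ∈ realSpectrum ℓ₁ ℓ₂ h₁ h₂ c) : 0 ≤ E := by
  by_contra hcon
  obtain ⟨e1, e2⟩ := sqrt_neg_pos (not_le.1 hcon)
  rw [e2, neg_sq_mem_iff e1] at hE
  have h0 : hypUpper ℓ₁ ℓ₂ 0 = 0 := by simp [hypUpper]
  have h3 : 0 < hypUpper ℓ₁ ℓ₂ (√(-E)) := by
    have := tanh_pos (show 0 < √(-E) * ℓ₁ / 2 by positivity)
    have := tanh_pos (show 0 < √(-E) * ℓ₂ / 2 by positivity)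
    unfold hypUpper
    positivity
  linarith [hE.2]

theorem exists_bands_of_nonneg (hc : 0 ≤ c) : ∃ a : ℕ → ℝ,
    IsBandSeq ℓ₁ ℓ₂ h₁ h₂ c a (fun i => zeroSeq ℓ₁ ℓ₂ (i + 1) ^ 2) ∧
    (∀ i, zeroSeq ℓ₁ ℓ₂ i ^ 2 ≤ a i) ∧
    ∀ i, a i - zeroSeq ℓ₁ ℓ₂ i ^ 2 ≤ 2 * c / (ℓ₁ + ℓ₂) := by
  choose a ha1 ha2 ha3 ha4 ha5 using exists_cell_of_nonneg (h₁ := h₁) (h₂ := h₂) hc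
  refine ⟨a, ⟨ha2, fun i => ha1 (i + 1),
    Filter.tendsto_atTop_mono ha1 (tendsto_zeroSeq_sq h₁ h₂), ?_⟩, ha1, ha5⟩
  ext E
  refine ⟨fun hE => ?_, fun ⟨i, h⟩ => ha3 i h⟩
  obtain ⟨i, hi1, hi2⟩ := exists_zeroSeq_bracket h₁ h₂ (nonneg_of_mem hc hE)
  rcases hi1.eq_or_lt with h | h
  · cases i with
    -- Energy 0 is in the spectrum only if c = 0, and then the length estimate puts the start of the
    -- first interval at 0.
    | zero =>
      have h0 : E = 0 := by rw [← h]; simp [zeroSeq]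
      have hc0 : c = 0 := le_antisymm (zero_mem_realSpectrum_iff.1 (h0 ▸ hE)).2 hc
      have := ha5 0
      rw [hc0, mul_zero, zero_div] at this
      exact ⟨0, by linarith, hi2.le⟩
    | succ j => exact ⟨j, by rw [← h]; exact (ha2 j).le, h.ge⟩
  · exact ⟨i, ha4 i E ⟨h, hi2⟩ hE, hi2.le⟩

theorem exists_bands_of_neg (hc : c < 0) : ∃ a b : ℕ → ℝ, IsBandSeq ℓ₁ ℓ₂ h₁ h₂ c a b ∧
    (∀ i, a (i + 1) = zeroSeq ℓ₁ ℓ₂ (i + 1) ^ 2) ∧ a 0 < 0 ∧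
    (c < -(4 / ℓ₁ + 4 / ℓ₂) → b 0 < 0) ∧
    (∀ k, 0 < k → a 0 < -k ^ 2 → hypUpper ℓ₁ ℓ₂ k < -c) ∧
    ∀ i, zeroSeq ℓ₁ ℓ₂ (i + 1) ^ 2 < b (i + 1) ∧ b (i + 1) ≤ zeroSeq ℓ₁ ℓ₂ (i + 1 + 1) ^ 2 ∧
      √(b (i + 1)) * (zeroSeq ℓ₁ ℓ₂ (i + 1 + 1) - √(b (i + 1))) * (ℓ₁ + ℓ₂) ≤ -c := by
  obtain ⟨a₀, b₀, ha0, hab, hb0, hI, hbot, htop, hup⟩ :=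
    exists_bottom_cell (h₁ := h₁) (h₂ := h₂) hc
  choose b hb1 hb2 hb3 hb4 hb5 using exists_cell_of_neg (h₁ := h₁) (h₂ := h₂) hc
  let a' : ℕ → ℝ := fun i => Nat.casesOn i a₀ fun j => zeroSeq ℓ₁ ℓ₂ (j + 1) ^ 2
  let b' : ℕ → ℝ := fun i => Nat.casesOn i b₀ b
  refine ⟨a', b', ⟨?_, ?_, ?_, ?_⟩, fun _ => rfl, ha0, fun h => ?_, hup,
    fun i => ⟨hb1 i, hb2 i, hb5 i⟩⟩
  · rintro (_ | i)
    exacts [hab, hb1 i]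
  · rintro (_ | i)
    exacts [hb0, hb2 i]
  · exact (Filter.tendsto_add_atTop_iff_nat 1).1
      ((Filter.tendsto_add_atTop_iff_nat (f := fun i => zeroSeq ℓ₁ ℓ₂ i ^ 2) 1).2
        (tendsto_zeroSeq_sq h₁ h₂))
  · ext E
    refine ⟨fun hE => ?_, ?_⟩
    · rcases lt_or_ge E (zeroSeq ℓ₁ ℓ₂ 1 ^ 2) with h | h
      · exact ⟨0, hbot E hE, htop E h hE⟩
      · obtain ⟨i, hi1, hi2⟩ := exists_zeroSeq_bracket h₁ h₂ ((sq_nonneg _).trans h)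
        cases i with
        | zero => exact absurd hi2 (not_lt.2 h)
        | succ j =>
          refine ⟨j + 1, hi1, ?_⟩
          rcases hi1.eq_or_lt with h' | h'
          · rw [← h']
            exact (hb1 j).le
          · exact hb4 j E ⟨h', hi2⟩ hE
    · rintro ⟨_ | i, hi⟩
      exacts [hI hi, hb3 i hi]
  · change b₀ < 0
    by_contra hcon
    have := (zero_mem_realSpectrum_iff.1 (hI ⟨ha0.le, not_lt.1 hcon⟩)).1
    linarith

theorem zeroSeq_succ_sub_le (h₁ : 0 < ℓ₁) (h₂ : 0 < ℓ₂) (i : ℕ) :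
    zeroSeq ℓ₁ ℓ₂ (i + 1) - zeroSeq ℓ₁ ℓ₂ i ≤ Real.pi / ℓ₁ := by
  rw [le_div_iff₀ h₁]
  have := zeroIdx_mul_pi_le h₁ h₂ h₁ i
  have := zeroSeq_succ_mul_le₁ (ℓ₂ := ℓ₂) h₁ i
  linarith

/-- Write d² - s² = 2 s (d - s) + (d - s)². The first term is at most 2A / S. Since d times the
second is bounded and d grows at least linearly in n, the second is of order 1 / n. -/
theorem sq_sub_le_of_mul_le {s d D A S : ℝ} {n : ℕ} (hs : 0 ≤ s) (hsd : s ≤ d) (hD : d - s ≤ D)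
    (hS : 0 < S) (hA : s * (d - s) * S ≤ A) (hn : (n + 1 : ℕ) * Real.pi ≤ d * S) :
    d ^ 2 - s ^ 2 ≤ 2 * A / S + (D * (A / S) + D ^ 3) * S / Real.pi / (n + 1) := by
  have hpi := Real.pi_pos
  have hδ : 0 ≤ d - s := sub_nonneg.2 hsd
  have e1 : s * (d - s) ≤ A / S := (le_div_iff₀ hS).2 hA
  have e2 : (d - s) ^ 2 * d ≤ D * (A / S) + D ^ 3 := by
    have f1 : (d - s) * (s * (d - s)) ≤ D * (A / S) :=
      mul_le_mul hD e1 (mul_nonneg hs hδ) (hδ.trans hD)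
    have f2 : (d - s) ^ 3 ≤ D ^ 3 := pow_le_pow_left₀ hδ hD 3
    nlinarith
  have e3 : (d - s) ^ 2 ≤ (D * (A / S) + D ^ 3) * S / Real.pi / (n + 1) := by
    rw [le_div_iff₀ (by positivity), le_div_iff₀ hpi]
    push_cast at hn
    calc (d - s) ^ 2 * (n + 1) * Real.pi = (d - s) ^ 2 * ((n + 1) * Real.pi) := by ring
      _ ≤ (d - s) ^ 2 * (d * S) := by gcongr
      _ = (d - s) ^ 2 * d * S := by ring
      _ ≤ _ := by gcongr
  have e4 : 2 * A / S = 2 * (A / S) := mul_div_assoc _ _ _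
  rw [e4]
  linarith [show d ^ 2 - s ^ 2 = 2 * (s * (d - s)) + (d - s) ^ 2 by ring]

theorem exists_bands (ℓ₁ ℓ₂ : ℝ) (h₁ : 0 < ℓ₁) (h₂ : 0 < ℓ₂) (c : ℝ) : ∃ a b : ℕ → ℝ,
    IsBandSeq ℓ₁ ℓ₂ h₁ h₂ c a b ∧
    (0 ≤ c → ∀ i, b i = zeroSeq ℓ₁ ℓ₂ (i + 1) ^ 2) ∧
    (c < 0 → ∀ i, a (i + 1) = zeroSeq ℓ₁ ℓ₂ (i + 1) ^ 2) ∧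
    (0 < a 0 ↔ 0 < c) ∧ (a 0 < 0 ↔ c < 0) ∧
    (c < -(4 / ℓ₁ + 4 / ℓ₂) → b 0 < 0) ∧
    (c < 0 → ∀ k, 0 < k → a 0 < -k ^ 2 → hypUpper ℓ₁ ℓ₂ k < -c) ∧
    ∃ C, 0 ≤ C ∧ ∀ i : ℕ, a (i + 1) - b i < 2 * |c| / (ℓ₁ + ℓ₂) + C / (i + 1) := by
  rcases le_or_gt 0 c with hc | hc
  · obtain ⟨a, hab, ha1, ha2⟩ := exists_bands_of_nonneg (h₁ := h₁) (h₂ := h₂) hc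
    have h0 : 0 ≤ a 0 := (sq_nonneg _).trans (ha1 0)
    have hS : 0 < 4 / ℓ₁ + 4 / ℓ₂ := by positivity
    refine ⟨a, _, hab, fun _ _ => rfl, fun h => absurd h (not_lt.2 hc), ⟨fun h => ?_, fun h => ?_⟩,
      ⟨fun h => absurd h (not_lt.2 h0), fun h => absurd h (not_lt.2 hc)⟩, fun h => ?_,
      fun h => absurd h (not_lt.2 hc), 1, zero_le_one, fun i => ?_⟩
    · refine hc.lt_of_ne ?_
      rintro rfl
      have := ha2 0
      simp only [zeroSeq, mul_zero, zero_div] at this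
      linarith
    · refine h0.lt_of_ne fun h' => ?_
      have hmem : (0 : ℝ) ∈ realSpectrum ℓ₁ ℓ₂ h₁ h₂ c := by
        rw [hab.eq]
        exact ⟨0, h'.ge, sq_nonneg _⟩
      linarith [(zero_mem_realSpectrum_iff.1 hmem).2]
    · linarith
    · have := ha2 (i + 1)
      have : (0 : ℝ) < 1 / (i + 1) := by positivity
      rw [abs_of_nonneg hc]
      linarith
  · obtain ⟨a, b, hab, ha, ha0, hb0, hup, hb⟩ := exists_bands_of_neg (h₁ := h₁) (h₂ := h₂) hc
    have hpi := Real.pi_pos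
    have hK : 0 ≤ (Real.pi / ℓ₁ * (|c| / (ℓ₁ + ℓ₂)) + (Real.pi / ℓ₁) ^ 3) * (ℓ₁ + ℓ₂) / Real.pi := by
      positivity
    -- The constant: the one from `sq_sub_le_of_mul_le` for the gaps above the first cell, |a 1 - b
    -- 0| for the gap below the first Dirichlet energy, and 1 for strictness.
    refine ⟨a, b, hab, fun h => absurd hc (not_lt.2 h), fun _ => ha,
      ⟨fun h => by linarith, fun h => by linarith⟩, iff_of_true ha0 hc, hb0, fun _ => hup,
      (Real.pi / ℓ₁ * (|c| / (ℓ₁ + ℓ₂)) + (Real.pi / ℓ₁) ^ 3) * (ℓ₁ + ℓ₂) / Real.pi +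
        |a 1 - b 0| + 1, by positivity, ?_⟩
    have hA : 0 ≤ 2 * |c| / (ℓ₁ + ℓ₂) := by positivity
    rintro (_ | i)
    · have := le_abs_self (a 1 - b 0)
      simp only [Nat.cast_zero, zero_add, div_one]
      linarith
    · obtain ⟨g1, g2, g3⟩ := hb i
      have hb0 : 0 ≤ b (i + 1) := (sq_nonneg _).trans g1.le
      have f1 : zeroSeq ℓ₁ ℓ₂ (i + 1) < √(b (i + 1)) := Real.lt_sqrt_of_sq_lt g1
      have f2 : √(b (i + 1)) ≤ zeroSeq ℓ₁ ℓ₂ (i + 1 + 1) :=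
        Real.sqrt_le_iff.2 ⟨zeroSeq_nonneg h₁ h₂ _, g2⟩
      have f3 := zeroSeq_succ_sub_le h₁ h₂ (i + 1)
      rw [← abs_of_neg hc] at g3
      have := sq_sub_le_of_mul_le (D := Real.pi / ℓ₁) (n := i + 1) (Real.sqrt_nonneg _) f2
        (by linarith) (by positivity) g3 (mul_pi_le_zeroSeq_mul h₁ h₂ (i + 1 + 1))
      rw [Real.sq_sqrt hb0] at this
      rw [ha (i + 1)]
      refine this.trans_lt ?_
      gcongr
      linarith [abs_nonneg (a 1 - b 0)]

/-- Dirichlet energies are in the lattice spectrum, so the criterion applies at E. A coupling beyond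
a sum of two positive bounds is beyond each of them. The only case where this argument points the
wrong way is c < 0 with the tanh condition violated, that is, E below the threshold; the second
alternative of `hc` rules it out. -/
theorem notMem_kronigPenneySpectrum_of_notMem {E : ℝ} (hE : E ∉ realSpectrum ℓ₁ ℓ₂ h₁ h₂ c)
    (hc : 0 ≤ c ∨ ∀ k, 0 < k → E = -k ^ 2 → hypUpper ℓ₁ ℓ₂ k < -c) :
    (E : ℂ) ∉ kronigPenneySpectrum ℓ₁ h₁ c ∧ (E : ℂ) ∉ kronigPenneySpectrum ℓ₂ h₂ c := by
  rcases lt_trichotomy E 0 with h | rfl | h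
  · obtain ⟨e1, e2⟩ := sqrt_neg_pos h
    have t1 := mul_pos e1 (tanh_pos (show 0 < √(-E) * ℓ₁ / 2 by positivity))
    have t2 := mul_pos e1 (tanh_pos (show 0 < √(-E) * ℓ₂ / 2 by positivity))
    rcases hc with hc | hc
    · rw [e2]
      exact ⟨neg_sq_notMem_kronigPenneySpectrum e1 (Or.inr (by linarith)),
        neg_sq_notMem_kronigPenneySpectrum e1 (Or.inr (by linarith))⟩
    · have h3 := hc _ e1 e2
      rw [e2, neg_sq_mem_iff e1, not_and] at hE
      have h4 := not_le.1 fun h => hE h h3.le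
      have s1 := mul_pos e1 (inv_pos.2 (tanh_pos (show 0 < √(-E) * ℓ₁ / 2 by positivity)))
      have s2 := mul_pos e1 (inv_pos.2 (tanh_pos (show 0 < √(-E) * ℓ₂ / 2 by positivity)))
      unfold hypLower at h4
      rw [e2]
      exact ⟨neg_sq_notMem_kronigPenneySpectrum e1 (Or.inl (by linarith)),
        neg_sq_notMem_kronigPenneySpectrum e1 (Or.inl (by linarith))⟩
  · rw [zero_mem_realSpectrum_iff, not_and_or, not_le, not_le] at hE
    have s1 : 0 < 4 / ℓ₁ := by positivity
    have s2 : 0 < 4 / ℓ₂ := by positivity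
    exact ⟨zero_notMem_kronigPenneySpectrum (hE.imp_left fun h => by linarith),
      zero_notMem_kronigPenneySpectrum (hE.imp_left fun h => by linarith)⟩
  · obtain ⟨i, hi1, hi2⟩ := exists_zeroSeq_bracket h₁ h₂ h.le
    have hi3 : zeroSeq ℓ₁ ℓ₂ i ^ 2 < E := by
      refine hi1.lt_of_ne fun he => ?_
      cases i with
      | zero => simp [zeroSeq] at he; linarith
      | succ j => exact hE (he ▸ zeroSeq_sq_mem j)
    obtain ⟨k, hk, rfl⟩ := exists_sqrt h₁ h₂ ⟨hi3, hi2⟩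
    have a1 := cellAngle₁_mem h₁ h₂ hk
    have a2 := cellAngle₂_mem h₁ h₂ hk
    have hk0 := cell_pos h₁ h₂ hk
    have t1 := mul_pos hk0 (tan_pos a1)
    have t2 := mul_pos hk0 (tan_pos a2)
    have s1 := mul_pos hk0 (inv_pos.2 (tan_pos a1))
    have s2 := mul_pos hk0 (inv_pos.2 (tan_pos a2))
    rw [mem_cell_iff h₁ h₂ hk, not_and_or, not_le, not_le, cellUpper, cellLower] at hE
    exact ⟨sq_notMem_kronigPenneySpectrum hk0 a1 (by unfold cellAngle; ring)
        (hE.imp (fun h => by linarith) fun h => by linarith),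
      sq_notMem_kronigPenneySpectrum hk0 a2 (by unfold cellAngle; ring)
        (hE.imp (fun h => by linarith) fun h => by linarith)⟩

theorem realSpectrum_zero : realSpectrum ℓ₁ ℓ₂ h₁ h₂ 0 = Set.Ici 0 := by
  ext E
  refine ⟨fun h => nonneg_of_mem le_rfl h, fun h => ?_⟩
  have hS : 0 < 4 / ℓ₁ + 4 / ℓ₂ := by positivity
  obtain ⟨i, hi1, hi2⟩ := exists_zeroSeq_bracket h₁ h₂ (Set.mem_Ici.1 h)
  rcases hi1.eq_or_lt with he | hlt
  · cases i with
    | zero =>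
      have h0 : E = 0 := by rw [← he]; simp [zeroSeq]
      rw [h0, zero_mem_realSpectrum_iff]
      exact ⟨by linarith, le_rfl⟩
    | succ j => exact he ▸ zeroSeq_sq_mem j
  · obtain ⟨k, hk, rfl⟩ := exists_sqrt h₁ h₂ ⟨hlt, hi2⟩
    exact (mem_cell_iff_of_nonneg h₁ h₂ hk le_rfl).2 (cellUpper_pos h₁ h₂ hk).le

/-- At a fixed nonnegative energy the admissible couplings form an interval containing 0 (the whole
line at positive Dirichlet energies), so moving c' towards 0 stays inside. -/
theorem mem_realSpectrum_of_abs_lt {c' E : ℝ} (hcc : 0 ≤ c * c') (habs : |c| < |c'|) (hE0 : 0 ≤ E)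
    (hE : E ∈ realSpectrum ℓ₁ ℓ₂ h₁ h₂ c') : E ∈ realSpectrum ℓ₁ ℓ₂ h₁ h₂ c := by
  have hS : 0 < 4 / ℓ₁ + 4 / ℓ₂ := by positivity
  have key : (0 < c' ∧ 0 ≤ c ∧ c < c') ∨ (c' < 0 ∧ c ≤ 0 ∧ c' < c) := by
    have hc' : c' ≠ 0 := by
      rintro rfl
      simp only [abs_zero] at habs
      exact absurd habs (not_lt.2 (abs_nonneg c))
    rcases hc'.lt_or_gt with h | h
    · have hc : c ≤ 0 := by
        by_contra hcon
        nlinarith [mul_pos_of_neg_of_neg h (neg_lt_zero.2 (not_le.1 hcon))]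
      rw [abs_of_neg h, abs_of_nonpos hc] at habs
      exact Or.inr ⟨h, hc, by linarith⟩
    · have hc : 0 ≤ c := nonneg_of_mul_nonneg_left hcc h
      rw [abs_of_pos h, abs_of_nonneg hc] at habs
      exact Or.inl ⟨h, hc, habs⟩
  obtain ⟨i, hi1, hi2⟩ := exists_zeroSeq_bracket h₁ h₂ hE0
  rcases hi1.eq_or_lt with he | hlt
  · cases i with
    | zero =>
      have h0 : E = 0 := by rw [← he]; simp [zeroSeq]
      rw [h0, zero_mem_realSpectrum_iff] at hE ⊢
      rcases key with ⟨k1, k2, k3⟩ | ⟨k1, k2, k3⟩ <;> constructor <;> linarith [hE.1, hE.2]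
    | succ j => exact he ▸ zeroSeq_sq_mem j
  · obtain ⟨k, hk, rfl⟩ := exists_sqrt h₁ h₂ ⟨hlt, hi2⟩
    rw [mem_cell_iff h₁ h₂ hk] at hE ⊢
    have := cellUpper_pos h₁ h₂ hk
    have := cellLower_pos h₁ h₂ hk
    rcases key with ⟨k1, k2, k3⟩ | ⟨k1, k2, k3⟩ <;> constructor <;> linarith [hE.1, hE.2]

theorem subset_connectedComponentIn_of_isGap {S T : Set ℂ} {J : Set ℝ} (hJ : IsGap S J)
    (h : ∀ x ∈ J, (x : ℂ) ∉ T) : ∃ J', IsGap T J' ∧ J ⊆ J' := by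
  obtain ⟨x, hx, rfl⟩ := hJ
  have hxJ : x ∈ connectedComponentIn {y : ℝ | (y : ℂ) ∉ S} x := mem_connectedComponentIn hx
  exact ⟨_, ⟨x, h x hxJ, rfl⟩,
    isPreconnected_connectedComponentIn.subset_connectedComponentIn hxJ h⟩

/-- The spectrum is unbounded above, and a connected gap cannot jump over a spectral point. -/
theorem isBounded_of_isGap {S : Set ℂ} {J : Set ℝ} {m : ℝ} (hJ : IsGap S J) (hm : ∀ x ∈ J, m < x)
    (hS : ∀ x : ℝ, ∃ y, x < y ∧ (y : ℂ) ∈ S) : Bornology.IsBounded J := by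
  obtain ⟨x, hx, rfl⟩ := hJ
  obtain ⟨y, hxy, hy⟩ := hS x
  refine (Metric.isBounded_Ioo m y).subset fun z hz => ⟨hm z hz, ?_⟩
  by_contra hcon
  exact connectedComponentIn_subset _ _ (isPreconnected_connectedComponentIn.Icc_subset
    (mem_connectedComponentIn hx) hz ⟨hxy.le, not_lt.1 hcon⟩) hy

end Bands

/-! ### Assembly of the statement -/

theorem four_mul_inv_sqrt_mul_rpow {ℓ₁ ℓ₂ : ℝ} (h₁ : 0 < ℓ₁) (h₂ : 0 < ℓ₂) :
    -4 * (√(ℓ₁ * ℓ₂))⁻¹ * ((ℓ₂ / ℓ₁) ^ (1 / 2 : ℝ) + (ℓ₂ / ℓ₁) ^ (-(1 / 2) : ℝ)) =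
      -(4 / ℓ₁ + 4 / ℓ₂) := by
  have e1 : √ℓ₁ ^ 2 = ℓ₁ := Real.sq_sqrt h₁.le
  have e2 : √ℓ₂ ^ 2 = ℓ₂ := Real.sq_sqrt h₂.le
  have p1 := Real.sqrt_pos.2 h₁
  have p2 := Real.sqrt_pos.2 h₂
  rw [Real.rpow_neg (by positivity), ← Real.sqrt_eq_rpow, Real.sqrt_div h₂.le, Real.sqrt_mul h₁.le,
    ← congrArg (4 / ·) e1, ← congrArg (4 / ·) e2]
  field_simp

theorem mainTheorem2 (ℓ₁ ℓ₂ : ℝ) (h₁ : 0 < ℓ₁) (h₂ : 0 < ℓ₂) (ℓ θ L : ℝ)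
    (hℓ : ℓ = √(ℓ₁ * ℓ₂)) (hθ : θ = ℓ₂ / ℓ₁) (hL : L = max ℓ₁ ℓ₂) :
    -- (b)
    latticeSpectrum ℓ₁ ℓ₂ h₁ h₂ 0 = Complex.ofReal '' Set.Ici 0 ∧
    -- (f)
    (∀ c c' : ℝ, 0 ≤ c * c' → |c| < |c'| →
      latticeSpectrum ℓ₁ ℓ₂ h₁ h₂ c' ∩ Complex.ofReal '' Set.Ici 0 ⊆
        latticeSpectrum ℓ₁ ℓ₂ h₁ h₂ c ∩ Complex.ofReal '' Set.Ici 0) ∧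
    ∀ c : ℝ, ∃ (N : ℕ∞) (α : ℕ → ℝ) (β : ℕ → EReal),
      -- (a)
      IsBandDecomposition (latticeSpectrum ℓ₁ ℓ₂ h₁ h₂ c) N α β ∧
      -- (c)
      (0 < c → ∀ r : ℕ, 1 ≤ r → (r : ℕ∞) ≤ N → β r ≠ ⊤ →
        ∃ (n : ℤ) (lam : ℝ), (lam = ℓ₁ ∨ lam = ℓ₂) ∧
          β r = (((Real.pi * n / lam) ^ 2 : ℝ) : EReal)) ∧
      (c < 0 → ∀ r : ℕ, 2 ≤ r → (r : ℕ∞) ≤ N →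
        ∃ (m : ℤ) (lam : ℝ), (lam = ℓ₁ ∨ lam = ℓ₂) ∧ α r = (Real.pi * m / lam) ^ 2) ∧
      -- (d)
      (0 < α 1 ↔ 0 < c) ∧ (α 1 < 0 ↔ c < 0) ∧
      -- (e)
      (c < -4 * ℓ⁻¹ * (θ ^ (1 / 2 : ℝ) + θ ^ (-(1 / 2) : ℝ)) →
        β 1 < 0 ∧ 2 ≤ N ∧ α 2 = (Real.pi / L) ^ 2) ∧
      -- (g)
      (∀ J : Set ℝ, IsGap (latticeSpectrum ℓ₁ ℓ₂ h₁ h₂ c) J → (0 ≤ c ∨ ∀ x ∈ J, α 1 < x) →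
        ∃ J₁ J₂ : Set ℝ, IsGap (kronigPenneySpectrum ℓ₁ h₁ c) J₁ ∧
          IsGap (kronigPenneySpectrum ℓ₂ h₂ c) J₂ ∧ J ⊆ J₁ ∩ J₂) ∧
      -- (h)
      (∀ J : Set ℝ, IsGap (latticeSpectrum ℓ₁ ℓ₂ h₁ h₂ c) J → (∀ x ∈ J, α 1 < x) →
        Bornology.IsBounded J) ∧
      (N = ⊤ → ∃ C : ℝ, ∀ r : ℕ, 1 ≤ r →
        α (r + 1) - (β r).toReal < 2 * |c| / (ℓ₁ + ℓ₂) + C / r) := by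
  refine ⟨by rw [latticeSpectrum_eq, realSpectrum_zero], fun c c' hcc habs => ?_, fun c => ?_⟩
  · rintro z ⟨hz, E, hE, rfl⟩
    exact ⟨mem_realSpectrum_of_abs_lt hcc habs hE hz, E, hE, rfl⟩
  obtain ⟨a, b, hab, hb, ha, hd1, hd2, hb0, hup, C, hC, hgap⟩ := exists_bands ℓ₁ ℓ₂ h₁ h₂ c
  obtain ⟨N, α, β, hband, hα1, hlast, hstep, hfirst⟩ := exists_bandDecomposition hab.lt hab.le
    hab.tendsto (latticeSpectrum_eq.trans (congrArg (Complex.ofReal '' ·) hab.eq))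
  refine ⟨N, α, β, hband, fun hc r hr hrN hβ => ?_, fun hc r hr hrN => ?_, hα1 ▸ hd1, hα1 ▸ hd2,
    fun hc => ?_, fun J hJ hJc => ?_, fun J hJ hJα => ?_, fun hN => ⟨C, fun r hr => ?_⟩⟩
  · obtain ⟨i, -, -, e, -⟩ := hstep r hr (hlast r hrN hβ)
    obtain ⟨n, lam, hlam, hn⟩ := exists_zeroSeq_sq_eq h₁ h₂ i
    exact ⟨n, lam, hlam, by rw [e, hb hc.le, hn]⟩
  · obtain ⟨s, rfl⟩ : ∃ s, r = s + 1 := ⟨r - 1, by omega⟩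
    obtain ⟨i, -, -, -, e⟩ := hstep s (by omega) hrN
    obtain ⟨n, lam, hlam, hn⟩ := exists_zeroSeq_sq_eq h₁ h₂ i
    exact ⟨n, lam, hlam, by rw [e, ha hc, hn]⟩
  -- The constant in (e) is the critical coupling 4 / ℓ₁ + 4 / ℓ₂ at energy zero: beyond it the
  -- first interval ends below 0 and cannot touch the second.
  · rw [hℓ, hθ, four_mul_inv_sqrt_mul_rpow h₁ h₂] at hc
    have hS : 0 < 4 / ℓ₁ + 4 / ℓ₂ := by positivity
    have ha1 := ha (by linarith) 0
    have hd := pow_pos (zeroSeq_pos h₁ h₂ 0) 2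
    obtain ⟨e1, e2, e3⟩ := hfirst (by linarith [hb0 hc])
    refine ⟨?_, e1, ?_⟩
    · rw [e2]
      exact_mod_cast hb0 hc
    · rw [e3, ha1, zero_add, zeroSeq_one h₁ h₂, hL]
  · have hKP : ∀ x ∈ J, (x : ℂ) ∉ kronigPenneySpectrum ℓ₁ h₁ c ∧
        (x : ℂ) ∉ kronigPenneySpectrum ℓ₂ h₂ c := fun x hx => by
      refine notMem_kronigPenneySpectrum_of_notMem (h₁ := h₁) (h₂ := h₂) ?_ ?_
      · obtain ⟨y, hy, rfl⟩ := hJ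
        exact connectedComponentIn_subset _ _ hx
      · rcases le_or_gt 0 c with hc | hc
        · exact Or.inl hc
        · have h := hJc.resolve_left (not_le.2 hc) x hx
          exact Or.inr fun k hk e => hup hc k hk (by rw [← e, ← hα1]; exact h)
    obtain ⟨J₁, hJ₁, hs₁⟩ := subset_connectedComponentIn_of_isGap hJ fun x hx => (hKP x hx).1
    obtain ⟨J₂, hJ₂, hs₂⟩ := subset_connectedComponentIn_of_isGap hJ fun x hx => (hKP x hx).2
    exact ⟨J₁, J₂, hJ₁, hJ₂, Set.subset_inter hs₁ hs₂⟩
  · refine isBounded_of_isGap hJ hJα fun x => ?_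
    obtain ⟨i, -, hi⟩ := exists_zeroSeq_bracket h₁ h₂ (le_max_right x 0)
    exact ⟨_, (le_max_left x 0).trans_lt hi, zeroSeq_sq_mem i⟩
  -- The r-th gap follows the interval with index i ≥ r - 1, and C ≥ 0, so C / (i + 1) ≤ C / r.
  · obtain ⟨i, hri, -, e1, e2⟩ := hstep r hr (by rw [hN]; exact le_top)
    rw [e1, e2, EReal.toReal_coe]
    refine (hgap i).trans_le ?_
    have hr0 : (0 : ℝ) < r := by exact_mod_cast hr
    have hri' : (r : ℝ) ≤ i + 1 := by exact_mod_cast hri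
    gcongr
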